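/- **Setting.** Fix an integer $M>1$. For $n\in\mathbb Z^4$ put $\|n\|^2=\sum_{c=1}^4 n_c^2$ and $C(n)=1/(\|n\|^2+1)$, also viewed as a diagonal operator $C$ on $\ell_2(\mathbb Z)^{\otimes 4}=\ell_2(\mathbb Z^4)$. For $j\ge 1$ let $\mathbf 1_{\le j}$ be the projection onto the momenta $n$ with $1+\|n\|^2\le M^{2j}$. Let $A_1,A_2$ be the diagonal operators (renormalized two-point amplitudes) $A_i(n)=\sum_{c=1}^4a_i(n_c)$ with $$a_1(k)=\sum_{p\in\mathbb Z^3}\bigl[C(k,p)-C(0,p)\bigr],\qquad a_2(k)=\sum_{p\in\mathbb Z^3}\bigl[C(k,p)^2A_1(k,p)-C(0,p)^2A_1(0,p)\bigr].$$ For $\rho>0$ let $\mathrm{Card}_\rho=\{g\in\mathbb C\setminus\{0\}:\ |\arg g|<\pi,\ |g|<\rho\cos^2(\tfrac12\arg g)\}$. For $g\in \mathrm{Card}_\rho$ let $\lambda=\sqrt g$ (principal branch), $B_1=i\lambda A_1$, $B_2=-i\lambda^3A_2$. For a quadruple $\vec\sigma=(\sigma_1,\dots,\sigma_4)$ of Hermitian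 matrices indexed by $\mathbb Z$, let $\sigma$ be the sum over $c$ of the operators acting as $\sigma_c$ on the $c$-th tensor factor and as the identity on the others, and, for $j\ge1$, set (as finite matrices on the range of $\mathbf 1_{\le j}$) $$\Sigma_{\le j}=i\lambda\,\mathbf 1_{\le j}C^{1/2}\sigma C^{1/2}\mathbf 1_{\le j},\quad D_{i,\le j}=i\lambda\,\mathbf 1_{\le j}C^{1/2}B_iC^{1/2}\mathbf 1_{\le j}\ (i=1,2),\quad U_{\le j}=\Sigma_{\le j}+D_{1,\le j}+D_{2,\le j},$$ $$V^{\ge3}_{\le j}(\vec\sigma)=\mathrm{Tr}\log_3(1-U_{\le j})+\mathrm{Tr}\bigl[D_{1,\le j}\Sigma_{\le j}^2\bigr]+\mathrm{Tr}\bigl[\tfrac13D_{1,\le j}^3+D_{1,\le j}^2D_{2,\le j}+\tfrac14D_{1,\le j}^4\bigr],$$ where $\log_3(1-U)=U+\tfrac12U^2+\log(1-U)$ and $\log(1-U)=-\int_0^1U(1-sU)^{-1}ds$. Put $V^{\ge3}_{\le0}=0$ and $V^{\ge3}_j=V^{\ge3}_{\le j}-V^{\ge3}_{\le j-1}$ for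 $j\ge 1$. A *block* is a finite non-empty set $\mathcal B$ of nodes together with a tree $\mathcal T$ on $\mathcal B$ and pairwise distinct scales $j_a\in\mathbb N$, $j_a\ge1$ ($a\in\mathcal B$). Given parameters $w=(w_\ell)\in[0,1]^{E(\mathcal T)}$, let $X_{aa}(w)=1$ and, for $a\ne b$, let $X_{ab}(w)$ be the infimum of $w_\ell$ over the edges $\ell$ of the path from $a$ to $b$ in $\mathcal T$. Let $\nu_{\mathcal B}$ be the centred Gaussian law of families $(\vec\sigma^{\,a})_{a\in\mathcal B}$ of quadruples of Hermitian matrices with covariances $\mathbb E\bigl[(\sigma^a_c)_{mn}(\sigma^b_{c'})_{pq}\bigr]=X_{ab}(w)\,\delta_{cc'}\delta_{mq}\delta_{np}$. **Theorem.** For every real $\alpha$ there are $\rho_0>0$ and positive constants $K^1_\alpha,K^2_\alpha$ (depending only on $\alpha$ and on the fixed ratio $M$) such that for all $0<\rho\le\rho_0$, all $g\in\mathrm{Card}_\rho$, all blocks $\mathcal B$ with arbitrary pairwise distinct scales, all values of the parameters $w$, and all subsets $\mathcal B'\subset\mathcal B$, the function $\prod_{a\in\mathcal B'}e^{\alpha|V^{\ge3}_{j_a}(\vec\sigma^{\,a})|}$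 is $\nu_{\mathcal B}$-integrable and $$\int d\nu_{\mathcal B}\ \prod_{a\in\mathcal B'}e^{\alpha\,|V^{\ge3}_{j_a}(\vec\sigma^{\,a})|}\ \le\ K^1_\alpha\,2^{|\mathcal B'|}\,e^{K^2_\alpha\,\rho^{3/2}\,|\mathcal B'|}.$$ -/

import Mathlib

noncomputable section

namespace TensorT44

open MeasureTheory ProbabilityTheory Complex

/-! ### Momenta, cutoffs and propagator -/

/-- Momenta of the rank four model: points of `ℤ⁴`, one integer for each colour. -/
abbrev Momentum : Type := Fin 4 → ℤ

/-- The propagator `C(n) = 1 / (n₁² + n₂² + n₃² + n₄² + 1)`. -/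
def propagator (n : Momentum) : ℝ := 1 / ((∑ c, (n c : ℝ) ^ 2) + 1)

/-- The momenta kept by the sharp cutoff `𝟏_{≤ j}`: those with `1 + ‖n‖² ≤ M ^ (2 j)`. -/
def momenta (M j : ℕ) : Finset Momentum :=
  (Fintype.piFinset fun _ : Fin 4 => Finset.Icc (-(M : ℤ) ^ j) ((M : ℤ) ^ j)).filter
    fun n => 1 + ∑ c, n c ^ 2 ≤ (M : ℤ) ^ (2 * j)

theorem mem_momenta {M j : ℕ} {n : Momentum} :
    n ∈ momenta M j ↔ 1 + ∑ c, n c ^ 2 ≤ (M : ℤ) ^ (2 * j) := by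
  simp only [momenta, Finset.mem_filter, Fintype.mem_piFinset, Finset.mem_Icc,
    and_iff_right_iff_imp]
  intro h c
  have h1 : n c ^ 2 ≤ ∑ c, n c ^ 2 :=
    Finset.single_le_sum (f := fun c => n c ^ 2) (fun i _ => sq_nonneg _) (Finset.mem_univ c)
  have h2 : n c ^ 2 ≤ ((M : ℤ) ^ j) ^ 2 := by
    rw [← pow_mul, mul_comm j 2]; linarith
  exact abs_le.mp (abs_le_of_sq_le_sq h2 (by positivity))

/-! ### Renormalized two-point amplitudes

By colour symmetry every colour component is the same function of one integer; `Fin.cons n p`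
is the momentum with `n` in the distinguished colour and `p` in the three other ones. -/

/-- Colour component of the renormalized amplitude of the tadpole: the partial trace of `C` over
the three other colours, minus its value at zero external momentum. -/
def tadpoleComp (n : ℤ) : ℝ :=
  ∑' p : Fin 3 → ℤ,
    (propagator (Fin.cons n p : Momentum) - propagator (Fin.cons 0 p : Momentum))

/-- The renormalized amplitude of the linearly divergent two-point graph (the tadpole), a diagonal
operator in momentum space. -/
def amplitudeOne (n : Momentum) : ℝ := ∑ c, tadpoleComp (n c)

/-- Colour component of the renormalized amplitude of the second divergent two-point graph: the
partial trace over the three other colours of `C²` with one renormalized tadpole inserted, minus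
its value at zero external momentum. -/
def secondComp (n : ℤ) : ℝ :=
  ∑' p : Fin 3 → ℤ,
    (propagator (Fin.cons n p : Momentum) ^ 2 * amplitudeOne (Fin.cons n p : Momentum)
      - propagator (Fin.cons 0 p : Momentum) ^ 2 * amplitudeOne (Fin.cons 0 p : Momentum))

/-- The renormalized amplitude of the logarithmically divergent two-point graph, a diagonal
operator in momentum space. -/
def amplitudeTwo (n : Momentum) : ℝ := ∑ c, secondComp (n c)

/-! ### The operators of the model, cut off at scale `j` -/

/-- `λ = √g`, principal branch. -/
def coupling (g : ℂ) : ℂ := g ^ (1 / 2 : ℂ)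

/-- `B₁ = i λ A^r(M₁)`. -/
def shiftOne (g : ℂ) (n : Momentum) : ℂ := I * coupling g * (amplitudeOne n : ℂ)

/-- `B₂ = - i λ³ A^r(M₂)`. -/
def shiftTwo (g : ℂ) (n : Momentum) : ℂ := -(I * coupling g ^ 3 * (amplitudeTwo n : ℂ))

/-- An intermediate field configuration: for each colour `c` an infinite matrix `(σ_c)_{mn}`. -/
abbrev Field : Type := Fin 4 → ℤ → ℤ → ℂ

/-- Matrix element of `σ = σ₁⊗1⊗1⊗1 + 1⊗σ₂⊗1⊗1 + 1⊗1⊗σ₃⊗1 + 1⊗1⊗1⊗σ₄`. -/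
def tensorSum (σ : Field) (m n : Momentum) : ℂ :=
  ∑ c, if ∀ c', c' ≠ c → m c' = n c' then σ c (m c) (n c) else 0

/-- `Σ_{≤ j} = i λ C_{≤ j}^{1/2} σ C_{≤ j}^{1/2}`, as a matrix on the range of `𝟏_{≤ j}`. -/
def sigmaOp (M : ℕ) (g : ℂ) (j : ℕ) (σ : Field) : Matrix (momenta M j) (momenta M j) ℂ :=
  Matrix.of fun m n =>
    I * coupling g * (√(propagator m) : ℂ) * tensorSum σ m n * (√(propagator n) : ℂ)

/-- `D_{1,≤ j} = i λ C_{≤ j}^{1/2} B₁ C_{≤ j}^{1/2}`. -/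
def dOne (M : ℕ) (g : ℂ) (j : ℕ) : Matrix (momenta M j) (momenta M j) ℂ :=
  Matrix.diagonal fun n => I * coupling g * shiftOne g n * (propagator n : ℂ)

/-- `D_{2,≤ j} = i λ C_{≤ j}^{1/2} B₂ C_{≤ j}^{1/2}`. -/
def dTwo (M : ℕ) (g : ℂ) (j : ℕ) : Matrix (momenta M j) (momenta M j) ℂ :=
  Matrix.diagonal fun n => I * coupling g * shiftTwo g n * (propagator n : ℂ)

/-- `U_{≤ j} = Σ_{≤ j} + D_{1,≤ j} + D_{2,≤ j}`. -/
def uOp (M : ℕ) (g : ℂ) (j : ℕ) (σ : Field) : Matrix (momenta M j) (momenta M j) ℂ :=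
  sigmaOp M g j σ + dOne M g j + dTwo M g j

/-- `Tr log₃ (1 - U)`, where `log₃ (1 - U) = U + U² / 2 + log (1 - U)` and
`log (1 - U) = - ∫₀¹ U (1 - s U)⁻¹ ds` is the principal logarithm. -/
def traceLogThree {ι : Type*} [Fintype ι] [DecidableEq ι] (U : Matrix ι ι ℂ) : ℂ :=
  U.trace + (U ^ 2).trace / 2 - ∫ s in (0 : ℝ)..1, (U * (1 - (s : ℂ) • U)⁻¹).trace

/-- The vacuum counterterms `Tr (D₁³ / 3 + D₁² D₂ + D₁⁴ / 4)` with cutoff `≤ j`. -/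
def vacuumTerm (M : ℕ) (g : ℂ) (j : ℕ) : ℂ :=
  ((1 / 3 : ℂ) • dOne M g j ^ 3 + dOne M g j ^ 2 * dTwo M g j
    + (1 / 4 : ℂ) • dOne M g j ^ 4).trace

/-- The higher order interaction with cutoff `≤ j`, that is
`V^{≥3}_{≤ j} = Tr log₃ (1 - U_{≤ j}) + Tr (D_{1,≤ j} Σ_{≤ j}²) + E_{≤ j}` for `j ≥ 1`, and
`V^{≥3}_{≤ 0} = 0`. -/
def interactionLe (M : ℕ) (g : ℂ) (j : ℕ) (σ : Field) : ℂ :=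
  if j = 0 then 0
  else traceLogThree (uOp M g j σ) + (dOne M g j * sigmaOp M g j σ ^ 2).trace + vacuumTerm M g j

/-- The part of the higher order interaction in the slice `j ≥ 1`:
`V^{≥3}_j = V^{≥3}_{≤ j} - V^{≥3}_{≤ j-1}`. -/
def interactionSlice (M : ℕ) (g : ℂ) (j : ℕ) (σ : Field) : ℂ :=
  interactionLe M g j σ - interactionLe M g (j - 1) σ

/-- The open cardioid `|arg g| < π`, `|g| < ρ cos² (arg g / 2)`. -/
def cardioid (ρ : ℝ) : Set ℂ :=
  {g | g ≠ 0 ∧ |arg g| < Real.pi ∧ ‖g‖ < ρ * Real.cos (arg g / 2) ^ 2}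

/-! ### The interpolated Gaussian measure of a Bosonic block -/

/-- The weakening matrix `X(w)` of a forest `T` with edge parameters `w`: `1` on the diagonal, and
otherwise the infimum of `w` along the unique path in `T` from `a` to `b` (`0` if there is no such
path, as `sInf ∅ = 0`). -/
def weakening {B : Type*} [DecidableEq B] (T : SimpleGraph B) (w : Sym2 B → ℝ) : Matrix B B ℝ :=
  Matrix.of fun a b =>
    if a = b then 1 else sInf {x | ∃ p : T.Path a b, ∃ e ∈ p.1.edges, x = w e}

/-- The law of the real coordinates of the replicated fields: for each colour `c` and each pair
`(m, n)` an independent centred Gaussian vector, indexed by the nodes, of covariance `X(w)`. -/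
def blockMeasure {B : Type*} [Fintype B] [DecidableEq B] (T : SimpleGraph B) (w : Sym2 B → ℝ) :
    Measure (Fin 4 × ℤ × ℤ → EuclideanSpace ℝ B) :=
  Measure.infinitePi fun _ => multivariateGaussian 0 (weakening T w)

/-- The Hermitian matrix fields `σ^a_c` of the node `a` in terms of real coordinates. Under
`blockMeasure T w` they are centred, jointly Gaussian, with covariances
`𝔼 [(σ^a_c)_{mn} (σ^b_{c'})_{pq}] = X_{ab}(w) δ_{cc'} δ_{mq} δ_{np}`
(replicated GUE matrices of covariance one). -/
def replica {B : Type*} (ξ : Fin 4 × ℤ × ℤ → EuclideanSpace ℝ B) (a : B) : Field :=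
  fun c m n =>
    if m = n then (ξ (c, m, m) a : ℂ)
    else if m < n then ((ξ (c, m, n) a : ℂ) + I * (ξ (c, n, m) a : ℂ)) / (√2 : ℂ)
    else ((ξ (c, n, m) a : ℂ) - I * (ξ (c, m, n) a : ℂ)) / (√2 : ℂ)

end TensorT44

end

noncomputable section

namespace TensorT44

open MeasureTheory ProbabilityTheory Complex

/-! ### Hilbert-Schmidt estimates, and resolvents from the numerical range. -/

section HilbertSchmidt

set_option linter.unusedSectionVars false

open scoped Matrix.Norms.L2Operator

variable {ι : Type*} [Fintype ι] [DecidableEq ι]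

/-- The square of the Hilbert-Schmidt norm. -/
def hsSq (A : Matrix ι ι ℂ) : ℝ := ∑ i, ∑ j, ‖A i j‖ ^ 2

theorem hsSq_nonneg (A : Matrix ι ι ℂ) : 0 ≤ hsSq A :=
  Finset.sum_nonneg fun _ _ => Finset.sum_nonneg fun _ _ => sq_nonneg _

theorem hsSq_conjTranspose (A : Matrix ι ι ℂ) : hsSq A.conjTranspose = hsSq A := by
  unfold hsSq
  rw [Finset.sum_comm]
  simp [Matrix.conjTranspose_apply]

theorem hsSq_add_le (A B : Matrix ι ι ℂ) : hsSq (A + B) ≤ 2 * hsSq A + 2 * hsSq B := by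
  unfold hsSq
  simp only [Finset.mul_sum, ← Finset.sum_add_distrib]
  refine Finset.sum_le_sum fun i _ => Finset.sum_le_sum fun j _ => ?_
  have h := norm_add_le (A i j) (B i j)
  have h0 := norm_nonneg (A i j + B i j)
  rw [Matrix.add_apply]
  nlinarith [sq_nonneg (‖A i j‖ - ‖B i j‖)]

theorem hsSq_smul (c : ℂ) (A : Matrix ι ι ℂ) : hsSq (c • A) = ‖c‖ ^ 2 * hsSq A := by
  unfold hsSq
  simp [Finset.mul_sum, mul_pow]

theorem sum_norm_mulVec_sq_le (A : Matrix ι ι ℂ) (x : ι → ℂ) :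
    ∑ i, ‖(A.mulVec x) i‖ ^ 2 ≤ ‖A‖ ^ 2 * ∑ i, ‖x i‖ ^ 2 := by
  have h := A.l2_opNorm_mulVec (WithLp.toLp 2 x)
  have h2 := pow_le_pow_left₀ (norm_nonneg _) h 2
  rw [mul_pow, EuclideanSpace.norm_sq_eq, EuclideanSpace.norm_sq_eq] at h2
  simpa using h2

theorem hsSq_mul_le (A B : Matrix ι ι ℂ) : hsSq (A * B) ≤ ‖A‖ ^ 2 * hsSq B := by
  unfold hsSq
  rw [Finset.sum_comm, Finset.sum_comm (f := fun i j => ‖B i j‖ ^ 2), Finset.mul_sum]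
  refine Finset.sum_le_sum fun j _ => ?_
  simpa [Matrix.mul_apply, Matrix.mulVec, dotProduct] using
    sum_norm_mulVec_sq_le A (fun i => B i j)

theorem hsSq_mul_le' (A B : Matrix ι ι ℂ) : hsSq (A * B) ≤ hsSq A * ‖B‖ ^ 2 := by
  rw [← hsSq_conjTranspose, Matrix.conjTranspose_mul, ← hsSq_conjTranspose A,
    ← Matrix.l2_opNorm_conjTranspose B, mul_comm]
  exact hsSq_mul_le _ _

theorem norm_trace_mul_sq_le (A B : Matrix ι ι ℂ) :
    ‖(A * B).trace‖ ^ 2 ≤ hsSq A * hsSq B := by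
  have h1 : ‖(A * B).trace‖ ≤ ∑ x : ι × ι, ‖A x.1 x.2‖ * ‖B x.2 x.1‖ := by
    rw [Fintype.sum_prod_type]
    simp only [Matrix.trace, Matrix.diag, Matrix.mul_apply]
    refine (norm_sum_le _ _).trans (Finset.sum_le_sum fun i _ => ?_)
    refine (norm_sum_le _ _).trans (Finset.sum_le_sum fun j _ => ?_)
    rw [norm_mul]
  have h2 : hsSq B = ∑ x : ι × ι, ‖B x.2 x.1‖ ^ 2 := by
    rw [Fintype.sum_prod_type, hsSq, Finset.sum_comm]
  have h3 : hsSq A = ∑ x : ι × ι, ‖A x.1 x.2‖ ^ 2 := by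
    rw [Fintype.sum_prod_type, hsSq]
  rw [h2, h3]
  exact (pow_le_pow_left₀ (norm_nonneg _) h1 2).trans (Finset.sum_mul_sq_le_sq_mul_sq _ _ _)

/-- The workhorse for traces with resolvents: the middle factor is known only in operator norm, and
the slice factors at the two ends supply the Hilbert-Schmidt norms. -/
theorem norm_trace_mul_mul_le {A Z B : Matrix ι ι ℂ} {a b z : ℝ} (ha : 0 ≤ a) (hb : 0 ≤ b)
    (hA : hsSq A ≤ a ^ 2) (hB : hsSq B ≤ b ^ 2) (hZ : ‖Z‖ ≤ z) :
    ‖(A * Z * B).trace‖ ≤ z * a * b := by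
  have hz : 0 ≤ z := (norm_nonneg _).trans hZ
  refine abs_le_of_sq_le_sq' ?_ (by positivity) |>.2
  refine (norm_trace_mul_sq_le _ _).trans ?_
  have h1 : hsSq (A * Z) ≤ a ^ 2 * z ^ 2 :=
    (hsSq_mul_le' A Z).trans (by gcongr)
  calc _ ≤ (a ^ 2 * z ^ 2) * b ^ 2 := mul_le_mul h1 hB (hsSq_nonneg _) (by positivity)
    _ = _ := by ring

theorem l2_opNorm_one_le : ‖(1 : Matrix ι ι ℂ)‖ ≤ 1 := by
  rw [← Matrix.diagonal_one, Matrix.l2_opNorm_diagonal]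
  exact (pi_norm_le_iff_of_nonneg zero_le_one).2 fun i => by simp

theorem l2_opNorm_diagonal_le {d : ι → ℂ} {a : ℝ} (ha : 0 ≤ a) (h : ∀ i, ‖d i‖ ≤ a) :
    ‖Matrix.diagonal d‖ ≤ a := by
  rw [Matrix.l2_opNorm_diagonal]
  exact (pi_norm_le_iff_of_nonneg ha).2 h

/-- A matrix whose numerical range stays away from zero is invertible. -/
theorem isUnit_and_norm_inv_le_of_numericalRange {A : Matrix ι ι ℂ} {κ : ℝ} (hκ : 0 < κ)
    (h : ∀ x : EuclideanSpace ℂ ι,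
      κ * ‖x‖ ^ 2 ≤ ‖inner ℂ x (Matrix.toEuclideanCLM (𝕜 := ℂ) A x)‖) :
    IsUnit A ∧ ‖A⁻¹‖ ≤ κ⁻¹ := by
  -- Cauchy-Schwarz turns the lower bound of the numerical range into a lower bound of ‖Ax‖; for
  -- square matrices injectivity is invertibility.
  have hlow : ∀ x : EuclideanSpace ℂ ι, κ * ‖x‖ ≤ ‖Matrix.toEuclideanCLM (𝕜 := ℂ) A x‖ := by
    intro x
    rcases eq_or_ne x 0 with rfl | hx
    · simp
    have hx' : 0 < ‖x‖ := norm_pos_iff.2 hx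
    have := (h x).trans (norm_inner_le_norm _ _)
    have h3 : ‖x‖ * (κ * ‖x‖) ≤ ‖x‖ * ‖Matrix.toEuclideanCLM (𝕜 := ℂ) A x‖ := by
      calc _ = κ * ‖x‖ ^ 2 := by ring
        _ ≤ _ := this
    exact le_of_mul_le_mul_left h3 hx'
  have hU : IsUnit A := by
    rw [← Matrix.mulVec_injective_iff_isUnit]
    intro x y hxy
    have h0 : Matrix.toEuclideanCLM (𝕜 := ℂ) A (WithLp.toLp 2 (x - y)) = 0 := by
      rw [Matrix.toEuclideanCLM_toLp, Matrix.mulVec_sub, sub_eq_zero.2 hxy]; rfl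
    have := hlow (WithLp.toLp 2 (x - y))
    rw [h0, norm_zero] at this
    have h1 : ‖(WithLp.toLp 2 (x - y) : EuclideanSpace ℂ ι)‖ = 0 :=
      le_antisymm (by nlinarith) (norm_nonneg _)
    have h2 := norm_eq_zero.1 h1
    have h3 : x - y = 0 := by simpa using congrArg WithLp.ofLp h2
    exact sub_eq_zero.1 h3
  refine ⟨hU, ?_⟩
  rw [Matrix.cstar_norm_def]
  refine ContinuousLinearMap.opNorm_le_bound _ (by positivity) fun x => ?_
  have := hlow (Matrix.toEuclideanCLM (𝕜 := ℂ) A⁻¹ x)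
  rw [← mul_apply_eq_comp, ← map_mul, Matrix.mul_nonsing_inv _
    ((Matrix.isUnit_iff_isUnit_det _).1 hU), map_one] at this
  rw [inv_mul_eq_div, le_div_iff₀ hκ, mul_comm]
  simpa using this

/-- For Hermitian `H` the value ⟨x, Hx⟩ is t‖x‖² with `t` real, so the numerical range of `1 - μ •
H` has distance at least `c` from zero, and the perturbation `E` uses up at most half of it. Nothing
is assumed on the size of `H`. -/
theorem norm_resolvent_le {H E : Matrix ι ι ℂ} (hH : H.IsHermitian) {μ : ℂ} {c : ℝ} (hc : 0 < c)
    (hμ : ∀ t : ℝ, c ≤ ‖1 - μ * t‖) (hE : ‖E‖ ≤ c / 2) :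
    IsUnit (1 - (μ • H + E)) ∧ ‖(1 - (μ • H + E))⁻¹‖ ≤ 2 / c := by
  have := isUnit_and_norm_inv_le_of_numericalRange (A := 1 - (μ • H + E)) (half_pos hc) ?_
  · simpa using this
  intro x
  set T := Matrix.toEuclideanCLM (𝕜 := ℂ) (n := ι)
  rcases eq_or_ne x 0 with rfl | hx
  · simp
  have hx' : 0 < ‖x‖ ^ 2 := by positivity
  have hsa : IsSelfAdjoint (T H) := by
    have : IsSelfAdjoint H := hH
    exact this.map T
  obtain ⟨t, ht⟩ : ∃ t : ℝ, inner ℂ x (T H x) = ((t * ‖x‖ ^ 2 : ℝ) : ℂ) := by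
    refine ⟨(inner ℂ x (T H x)).re / ‖x‖ ^ 2, ?_⟩
    rw [div_mul_cancel₀ _ hx'.ne']
    have := hsa.isSymmetric.coe_re_inner_self_apply x
    exact this.symm
  have hD : ‖inner ℂ x (T E x)‖ ≤ c / 2 * ‖x‖ ^ 2 := by
    refine (norm_inner_le_norm _ _).trans ?_
    have := (T E).le_opNorm x
    have h2 : ‖T E‖ ≤ c / 2 := hE
    calc ‖x‖ * ‖T E x‖ ≤ ‖x‖ * (c / 2 * ‖x‖) := by gcongr; exact this.trans (by gcongr)
      _ = _ := by ring
  have heq : inner ℂ x (T (1 - (μ • H + E)) x)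
      = (1 - μ * t) * ((‖x‖ ^ 2 : ℝ) : ℂ) - inner ℂ x (T E x) := by
    rw [map_sub, map_add, map_one, map_smul]
    simp only [sub_apply, add_apply, smul_apply, one_apply_eq_self, inner_sub_right,
      inner_add_right, inner_smul_right, ht, inner_self_eq_norm_sq_to_K]
    push_cast
    simp only [coe_algebraMap]
    ring
  rw [heq]
  have h1 : c * ‖x‖ ^ 2 ≤ ‖(1 - μ * t) * ((‖x‖ ^ 2 : ℝ) : ℂ)‖ := by
    rw [norm_mul, norm_real, Real.norm_of_nonneg hx'.le]
    exact mul_le_mul_of_nonneg_right (hμ t) hx'.le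
  have h2 := norm_sub_norm_le ((1 - μ * t) * ((‖x‖ ^ 2 : ℝ) : ℂ)) (inner ℂ x (T E x))
  linarith

end HilbertSchmidt

end TensorT44
end

noncomputable section

namespace TensorT44

open MeasureTheory ProbabilityTheory Complex

/-! ### Algebra of the difference of two resolvents. -/

section Resolvents

variable {ι : Type*} [Fintype ι] [DecidableEq ι]

theorem resolvent_comm {A R : Matrix ι ι ℂ} {s : ℂ} (hl : R = 1 + s • (A * R))
    (hr : R = 1 + s • (R * A)) : A * R = R * A := by
  calc A * R = (R - s • (R * A)) * (A * R) := by rw [sub_eq_of_eq_add hr, one_mul]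
    _ = R * A * (R - s • (A * R)) := by
      simp only [sub_mul, mul_sub, smul_mul_assoc, mul_smul_comm, mul_assoc]
    _ = R * A := by rw [sub_eq_of_eq_add hl, mul_one]

/-- A projection `P`, its complement `Q`, and the resolvents `R`, `R'` of `U` and of its
compression `P U P` at the parameter `s`. -/
structure ResolventPair (U P Q R R' : Matrix ι ι ℂ) (s : ℂ) : Prop where
  compl : Q = 1 - P
  idem : P * P = P
  left : R = 1 + s • (U * R)
  right : R = 1 + s • (R * U)
  left' : R' = 1 + s • (P * U * P * R')
  right' : R' = 1 + s • (R' * (P * U * P))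

namespace ResolventPair

variable {U P Q R R' : Matrix ι ι ℂ} {s : ℂ}

theorem of_isUnit {U P : Matrix ι ι ℂ} {s : ℂ} (hP : P * P = P) (h : IsUnit (1 - s • U))
    (h' : IsUnit (1 - s • (P * U * P))) :
    ResolventPair U P (1 - P) (1 - s • U)⁻¹ (1 - s • (P * U * P))⁻¹ s := by
  rw [Matrix.isUnit_iff_isUnit_det] at h h'
  refine ⟨rfl, hP, ?_, ?_, ?_, ?_⟩
  · have := Matrix.mul_nonsing_inv _ h
    rw [sub_mul, one_mul, smul_mul_assoc] at this
    exact eq_add_of_sub_eq this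
  · have := Matrix.nonsing_inv_mul _ h
    rw [mul_sub, mul_one, mul_smul_comm] at this
    exact eq_add_of_sub_eq this
  · have := Matrix.mul_nonsing_inv _ h'
    rw [sub_mul, one_mul, smul_mul_assoc] at this
    exact eq_add_of_sub_eq this
  · have := Matrix.nonsing_inv_mul _ h'
    rw [mul_sub, mul_one, mul_smul_comm] at this
    exact eq_add_of_sub_eq this

theorem PQ (h : ResolventPair U P Q R R' s) : P * Q = 0 := by
  rw [h.compl, mul_sub, h.idem, mul_one, sub_self]

theorem QP (h : ResolventPair U P Q R R' s) : Q * P = 0 := by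
  rw [h.compl, sub_mul, h.idem, one_mul, sub_self]

theorem QQ (h : ResolventPair U P Q R R' s) : Q * Q = Q := by
  nth_rewrite 1 [h.compl]
  rw [sub_mul, h.PQ, one_mul, sub_zero]

theorem R'Q (h : ResolventPair U P Q R R' s) : R' * Q = Q := by
  nth_rewrite 1 [h.right']
  simp only [add_mul, smul_mul_assoc, mul_assoc, h.PQ, mul_zero, smul_zero, one_mul, add_zero]

theorem QR' (h : ResolventPair U P Q R R' s) : Q * R' = Q := by
  nth_rewrite 1 [h.left']
  simp only [mul_add, mul_smul_comm, ← mul_assoc, h.QP, zero_mul, smul_zero, mul_one, add_zero]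

theorem PR' (h : ResolventPair U P Q R R' s) : P * R' = R' * P := by
  have h1 := h.QR'
  have h2 := h.R'Q
  rw [h.compl, sub_mul, one_mul] at h1
  rw [h.compl, mul_sub, mul_one] at h2
  linear_combination (norm := abel) h2 - h1

theorem UR (h : ResolventPair U P Q R R' s) : U * R = R * U :=
  resolvent_comm h.left h.right

/-- This is the resolvent identity R - R' = s R (U - PUP) R' divided by `s`; the proof avoids the
division, as `s` may vanish. -/
theorem diff_eq (h : ResolventPair U P Q R R' s) :
    U * R - P * U * P * R' = R * (U - P * U * P) * R' := by
  have e1 : R * U = R * U * (R' - s • (P * U * P * R')) := by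
    rw [sub_eq_of_eq_add h.left', mul_one]
  have e3 : P * U * P * R' = (R - s • (R * U)) * (P * U * P * R') := by
    rw [sub_eq_of_eq_add h.right, one_mul]
  simp only [mul_sub, mul_smul_comm] at e1
  simp only [sub_mul, smul_mul_assoc] at e3
  rw [h.UR]
  simp only [mul_assoc, mul_sub, sub_mul] at e1 e3 ⊢
  linear_combination (norm := abel) e1 - e3

/-- Second order Taylor formula with exact remainder. The first piece of the remainder is enclosed
between two `P`, so its trace against U - PUP vanishes, because P(U - PUP)P = 0; the other pieces
produce the factors `Q`. -/
theorem mul_expand (h : ResolventPair U P Q R R' s) :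
    R' * R = 1 + s • (U + P * U * P) + s ^ 2 •
      (P * (U * P * U * R') * P + P * (U * R') * P * U + R' * U * U * R) := by
  have e1 : P * (U * R') * P = P * U * P * R' := by simp only [mul_assoc, h.PR']
  have e2 : P * (U * P * U * R') * P = P * U * P * (P * U * P * R') := by
    have : P * (P * (U * (P * R'))) = P * (U * (P * R')) := by rw [← mul_assoc, h.idem]
    simp only [mul_assoc, this]
    rw [h.PR']
  have e3 : R' * R = R' + s • (R' * U) + s ^ 2 • (R' * U * U * R) := by
    nth_rewrite 1 [h.right]
    nth_rewrite 1 [← h.UR]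
    nth_rewrite 1 [h.left]
    simp only [mul_add, mul_one, mul_smul_comm, smul_add, smul_smul, mul_assoc, pow_two, add_assoc]
  have e4 : R' * U = U + s • (P * U * P * R' * U) := by
    nth_rewrite 1 [h.left']
    simp only [add_mul, one_mul, smul_mul_assoc]
  have e5 : R' = 1 + s • (P * U * P) + s ^ 2 • (P * U * P * (P * U * P * R')) := by
    nth_rewrite 1 [h.left']
    nth_rewrite 1 [h.left']
    simp only [mul_add, mul_one, mul_smul_comm, smul_add, smul_smul, pow_two, add_assoc]
  rw [e1, e2, e3, e4]
  nth_rewrite 1 [e5]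
  simp only [smul_add, smul_smul, pow_two]
  abel

/-- The factor between `Q U` and `U Q` in the second order difference of the resolvent traces. -/
def core (U P R R' : Matrix ι ι ℂ) : Matrix ι ι ℂ :=
  P * U * P * R' + U * R * P + R' * U * R

/-- By `diff_eq` and cyclicity the left side is Tr((U - PUP) R'R). Orders zero and one of
`mul_expand` are the terms subtracted by log₃. In the remainder, U - PUP = QU + PUQ and cyclicity
bring a `Q` to each end, which makes the difference a slice quantity. -/
theorem trace_diff (h : ResolventPair U P Q R R' s) :
    (U * R).trace - (P * U * P * R').trace =
      (U.trace - (P * U * P).trace) + s * ((U ^ 2).trace - ((P * U * P) ^ 2).trace)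
        + s ^ 2 * (Q * U * core U P R R' * (U * Q)).trace := by
  have hPP : ∀ Y, P * (P * Y) = P * Y := fun Y => by rw [← mul_assoc, h.idem]
  have hW : P * (U - P * U * P) * P = 0 := by
    simp only [mul_sub, sub_mul, mul_assoc, hPP, h.idem, sub_self]
  have hW' : U - P * U * P = Q * U + P * U * Q := by
    rw [h.compl]; noncomm_ring
  have t0 : (R * (U - P * U * P) * R').trace = ((U - P * U * P) * (R' * R)).trace := by
    rw [mul_assoc, Matrix.trace_mul_comm, mul_assoc]
  have t1 : ((U - P * U * P) * (P * (U * P * U * R') * P)).trace = 0 := by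
    rw [Matrix.trace_mul_comm, mul_assoc, mul_assoc, Matrix.trace_mul_comm]
    simp only [mul_assoc] at hW ⊢
    rw [hW]; simp
  have t2 : ((U - P * U * P) * (P * (U * R') * P * U)).trace
      = (Q * U * (P * U * P * R') * (U * Q)).trace := by
    have e : P * U * P * R' = P * (U * R') * P := by simp only [mul_assoc, h.PR']
    have e2 : P * U * (U - P * U * P) * P = P * (U * Q) * (Q * U) * P := by
      rw [mul_assoc P (U * Q), mul_assoc U, ← mul_assoc Q Q U, h.QQ, h.compl]
      simp only [mul_sub, sub_mul, mul_assoc, one_mul, h.idem]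
    calc _ = (U * ((U - P * U * P) * (P * (U * R'))) * P).trace := by
          rw [mul_assoc U, Matrix.trace_mul_comm U]; simp only [mul_assoc]
      _ = (P * U * (U - P * U * P) * P * (U * R')).trace := by
          rw [Matrix.trace_mul_comm]; simp only [mul_assoc]
      _ = (P * (U * Q * (Q * U) * P * (U * R'))).trace := by rw [e2]; simp only [mul_assoc]
      _ = (U * Q * ((Q * U) * (P * (U * R') * P))).trace := by
          rw [Matrix.trace_mul_comm]; simp only [mul_assoc]
      _ = _ := by rw [Matrix.trace_mul_comm, e]
  have t3 : ((U - P * U * P) * (R' * U * U * R)).trace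
      = (Q * U * (U * R * P + R' * U * R) * (U * Q)).trace := by
    have e1 : (P * U * Q * (R' * U * U * R)).trace = (Q * U * (U * R * P) * (U * Q)).trace := by
      have e4 : Q * (R' * U * U * R) = Q * (Q * (U * (U * R))) := by
        rw [← mul_assoc Q Q, h.QQ, ← mul_assoc Q, ← mul_assoc Q, ← mul_assoc Q, h.QR']
        simp only [mul_assoc]
      calc _ = (P * U * Q * (Q * (U * (U * R)))).trace := by rw [mul_assoc (P * U), e4, ← mul_assoc]
        _ = _ := by rw [Matrix.trace_mul_comm]; simp only [mul_assoc]
    have e2 : (Q * U * (R' * U * U * R)).trace = (Q * U * (R' * U * R) * (U * Q)).trace := by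
      calc _ = (Q * (Q * U * R' * U * (R * U))).trace := by
            rw [← h.UR]; simp only [← mul_assoc, h.QQ]
        _ = _ := by rw [Matrix.trace_mul_comm]; simp only [mul_assoc]
    rw [hW', add_mul, mul_add (Q * U), add_mul, Matrix.trace_add, Matrix.trace_add, e1, e2,
      add_comm]
  have t4 : ((U - P * U * P) * (U + P * U * P)).trace
      = (U ^ 2).trace - ((P * U * P) ^ 2).trace := by
    rw [pow_two, pow_two, ← Matrix.trace_sub]
    simp only [mul_add, sub_mul, Matrix.trace_add, Matrix.trace_sub]
    rw [Matrix.trace_mul_comm U (P * U * P)]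
    ring
  rw [← Matrix.trace_sub, h.diff_eq, t0, h.mul_expand]
  simp only [mul_add, Matrix.trace_add, mul_smul_comm, Matrix.trace_smul, mul_one, smul_eq_mul]
    at t1 t2 t3 t4 ⊢
  rw [core, ← Matrix.trace_sub]
  simp only [mul_add, add_mul, Matrix.trace_add] at t2 t3 ⊢
  linear_combination s * t4 + s ^ 2 * (t1 + t2 + t3)

/-- Since QR' = Q, the resolvent of the compression disappears next to `Q`, and a new factor QU
comes out; `split` lives on this. -/
theorem Q_core (h : ResolventPair U P Q R R' s) : Q * core U P R R' = Q * U * R * (1 + P) := by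
  have e1 : Q * (P * U * P * R') = 0 := by
    rw [mul_assoc P, mul_assoc P, ← mul_assoc, h.QP, zero_mul]
  have e2 : Q * (R' * U * R) = Q * U * R := by
    rw [← mul_assoc, ← mul_assoc, h.QR']
  rw [core, mul_add, mul_add, e1, e2, zero_add, mul_add, mul_one, add_comm]
  simp only [mul_assoc]

theorem core_Q (h : ResolventPair U P Q R R' s) : core U P R R' * Q = R' * R * (U * Q) := by
  have e1 : P * U * P * R' * Q = 0 := by
    rw [mul_assoc, h.R'Q, mul_assoc, h.PQ, mul_zero]
  have e2 : U * R * P * Q = 0 := by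
    rw [mul_assoc, h.PQ, mul_zero]
  rw [core, add_mul, add_mul, e1, e2, zero_add, zero_add, mul_assoc R', h.UR]
  simp only [mul_assoc]

/-- With the notation of `norm_trace_split_le`, a term with two `E` and one field factor, if it
contained a resolvent, would have size δ²qa, which grows with the scale. The resolvent equation is
therefore used next to each `E` until the resolvents survive only in terms of size at most δa², δ³qa
or δ⁴q², apart from the term with the field at both ends. What is left is E³ and three traces linear
in the field and free of resolvents. -/
theorem split {A B E : Matrix ι ι ℂ} (h : ResolventPair U P Q R R' s) (hA : Q * U = A + E)
    (hB : U * Q = B + E) (hQE : Q * E = E) (hEQ : E * Q = E) :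
    (A + E) * core U P R R' * (B + E) = A * core U P R R' * B + E * E * E
      + (E * E * B + A * (E * E) + E * A * E)
      + (E * A * (R * (1 + P)) * B + s • (E * E * A * (R * (1 + P)) * B)
        + s • (E * E * E * (R * (1 + P)) * B)
        + A * (R' * R) * (B * E) + s • (A * (R' * R) * (B * (E * E)))
        + s • (A * (R' * R) * (E * E * E))
        + s • (E * A * R * (B * E)) + s • (E * A * R * (E * E)) + s • (E * E * R * (B * E))
        + s • (E * E * R * (E * E))) := by
  have hEP : E * P = 0 := by rw [← hEQ, mul_assoc, h.QP, mul_zero]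
  have hPE : P * E = 0 := by rw [← hQE, ← mul_assoc, h.PQ, zero_mul]
  have hX1 : E * core U P R R' = E * (A + E) * (R * (1 + P)) := by
    rw [← hEQ, mul_assoc E Q, h.Q_core, hA]; simp only [← mul_assoc, hEQ]
  have hX2 : core U P R R' * E = R' * R * ((B + E) * E) := by
    rw [← hQE, ← mul_assoc _ Q E, h.core_Q, hB]; simp only [mul_assoc, hQE]
  have hER : E * R = E + s • (E * (A + E) * R) := by
    nth_rewrite 1 [h.left]
    rw [mul_add, mul_one, mul_smul_comm, ← hA]
    simp only [← mul_assoc, hEQ]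
  have hRE : R * E = E + s • (R * ((B + E) * E)) := by
    nth_rewrite 1 [h.right]
    rw [add_mul, one_mul, smul_mul_assoc, ← hB]
    simp only [mul_assoc, hQE]
  have hR'RE : R' * R * E = E + s • (R' * R * ((B + E) * E)) := by
    have : R' * E = E := by rw [← hQE, ← mul_assoc, h.R'Q]
    rw [mul_assoc, hRE, mul_add, this, mul_smul_comm, mul_assoc R' R]
  have i2 : E * core U P R R' * B = E * A * (R * (1 + P)) * B + E * E * B
      + s • (E * E * A * (R * (1 + P)) * B) + s • (E * E * E * (R * (1 + P)) * B) := by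
    rw [hX1]
    have : E * E * (R * (1 + P)) = E * E + s • (E * E * (A + E) * (R * (1 + P))) := by
      rw [← mul_assoc, mul_assoc E E R, hER]
      simp only [mul_add, add_mul, mul_one, mul_assoc, smul_mul_assoc, mul_smul_comm, hEP,
        mul_zero, smul_add]
      abel
    rw [mul_add, add_mul, this]
    simp only [mul_add, add_mul, smul_add, smul_mul_assoc, mul_assoc]
    abel
  have i3 : A * core U P R R' * E = A * (R' * R) * (B * E) + A * (E * E)
      + s • (A * (R' * R) * (B * (E * E))) + s • (A * (R' * R) * (E * E * E)) := by
    rw [mul_assoc, hX2, add_mul, mul_add, ← mul_assoc (R' * R) E E, hR'RE]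
    simp only [mul_add, add_mul, smul_add, smul_mul_assoc, mul_smul_comm, mul_assoc]
    abel
  have i4 : E * core U P R R' * E = E * A * E + s • (E * A * R * (B * E))
      + s • (E * A * R * (E * E)) + E * E * E + s • (E * E * R * (B * E))
      + s • (E * E * R * (E * E)) := by
    have : (1 + P) * E = E := by rw [add_mul, one_mul, hPE, add_zero]
    rw [hX1, mul_assoc, mul_assoc R, this, hRE]
    simp only [mul_add, add_mul, smul_add, mul_smul_comm, mul_assoc]
    abel
  rw [mul_add, add_mul, add_mul, add_mul, i2, i3, i4]
  abel

end ResolventPair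
end Resolvents

/-! ### Bounds of the second order difference. -/

section Bounds

open scoped Matrix.Norms.L2Operator

variable {ι : Type*} [Fintype ι] [DecidableEq ι]

/-- Sum of the sizes of the ten terms of `split` with a resolvent and a factor `E`. The mixed size
δ³qa is interpolated between δ²a² and δ⁴q². -/
theorem split_arith {r δ a q : ℝ} (hr : 1 ≤ r) (hδ : 0 ≤ δ) (hδ1 : δ ≤ 1) (ha : 0 ≤ a)
    (hq : 0 ≤ q) :
    r * 2 * (δ * a) * a + r * 2 * (δ * (δ * a)) * a + r * 2 * (δ * (δ * (δ * q))) * a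
      + r * r * a * (δ * a) + r * r * a * (δ * (δ * a)) + r * r * a * (δ * (δ * (δ * q)))
      + r * (δ * a) * (δ * a) + r * (δ * a) * (δ * (δ * q)) + r * (δ * (δ * q)) * (δ * a)
      + r * (δ * (δ * q)) * (δ * (δ * q)) ≤ r ^ 2 * (12 * δ * a ^ 2 + 6 * δ ^ 4 * q ^ 2) := by
  have c1 : δ * δ * a ^ 2 ≤ δ * a ^ 2 :=
    mul_le_mul_of_nonneg_right (by nlinarith) (sq_nonneg a)
  have c2 : 2 * (δ ^ 3 * q * a) ≤ δ * a ^ 2 + δ ^ 4 * q ^ 2 := by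
    have : 2 * (δ ^ 3 * q * a) ≤ δ * δ * a ^ 2 + δ ^ 4 * q ^ 2 := by
      nlinarith [sq_nonneg (δ * a - δ ^ 2 * q)]
    linarith
  have c3 : 0 ≤ δ ^ 3 * q * a := by positivity
  have c4 : 0 ≤ δ ^ 4 * q ^ 2 := by positivity
  have c5 : 0 ≤ δ * a ^ 2 := by positivity
  have hr2 : r ≤ r ^ 2 := by nlinarith
  have S1 : r * (2 * (δ * a ^ 2) + 2 * (δ * δ * a ^ 2) + 2 * (δ ^ 3 * q * a) + δ * δ * a ^ 2
      + δ ^ 3 * q * a + δ ^ 3 * q * a + δ ^ 4 * q ^ 2)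
      ≤ r ^ 2 * (2 * (δ * a ^ 2) + 2 * (δ * δ * a ^ 2) + 2 * (δ ^ 3 * q * a) + δ * δ * a ^ 2
      + δ ^ 3 * q * a + δ ^ 3 * q * a + δ ^ 4 * q ^ 2) :=
    mul_le_mul_of_nonneg_right hr2 (by positivity)
  have S2 : r ^ 2 * (2 * (δ * a ^ 2) + 2 * (δ * δ * a ^ 2) + 2 * (δ ^ 3 * q * a) + δ * δ * a ^ 2
      + δ ^ 3 * q * a + δ ^ 3 * q * a + δ ^ 4 * q ^ 2 + (δ * a ^ 2 + δ * δ * a ^ 2 + δ ^ 3 * q * a))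
      ≤ r ^ 2 * (12 * δ * a ^ 2 + 6 * δ ^ 4 * q ^ 2) :=
    mul_le_mul_of_nonneg_left (by linarith) (sq_nonneg r)
  linarith

namespace ResolventPair

variable {U P Q R R' : Matrix ι ι ℂ} {s : ℂ}

/-- In the application δ is of order 1/N and q of order N², with N = M^J, and a² is |λ|² times a
form which is at most N times one of bounded trace; hence δa² and δ⁴q² do not grow with the scale.
The trace of E³ is set aside because it diverges and must meet the counterterms. The traces bounded
by `l` are linear in the field and are estimated on the diagonal. -/
theorem norm_trace_split_le {A B E : Matrix ι ι ℂ} (h : ResolventPair U P Q R R' s)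
    (hA : Q * U = A + E) (hB : U * Q = B + E) (hQE : Q * E = E) (hEQ : E * Q = E)
    {r δ a q l : ℝ} (hr : 1 ≤ r) (hδ : 0 ≤ δ) (hδ1 : δ ≤ 1) (ha : 0 ≤ a) (hq : 0 ≤ q)
    (hs : ‖s‖ ≤ 1) (hP : ‖P‖ ≤ 1) (hR : ‖R‖ ≤ r) (hR' : ‖R'‖ ≤ r)
    (hE : ‖E‖ ≤ δ) (hAa : hsSq A ≤ a ^ 2) (hBa : hsSq B ≤ a ^ 2) (hQq : hsSq Q ≤ q ^ 2)
    (hl1 : ‖(E * E * B).trace‖ ≤ l) (hl2 : ‖(A * (E * E)).trace‖ ≤ l)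
    (hl3 : ‖(E * A * E).trace‖ ≤ l) :
    ‖((A + E) * core U P R R' * (B + E)).trace - (E * E * E).trace‖
      ≤ ‖(A * core U P R R' * B).trace‖ + 3 * l
        + r ^ 2 * (12 * δ * a ^ 2 + 6 * δ ^ 4 * q ^ 2) := by
  have h1P : ‖1 + P‖ ≤ 2 := by
    linarith [norm_add_le (1 : Matrix ι ι ℂ) P, l2_opNorm_one_le (ι := ι)]
  have r0 : 0 ≤ r := by linarith
  have hZ1 : ‖R * (1 + P)‖ ≤ r * 2 :=
    (norm_mul_le _ _).trans (mul_le_mul hR h1P (norm_nonneg _) r0)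
  have hZ2 : ‖R' * R‖ ≤ r * r := (norm_mul_le _ _).trans (mul_le_mul hR' hR (norm_nonneg _) r0)
  have step : ∀ {X : Matrix ι ι ℂ} {x : ℝ}, hsSq X ≤ x ^ 2 → hsSq (E * X) ≤ (δ * x) ^ 2 := by
    intro X x hX
    refine (hsSq_mul_le _ _).trans ?_
    rw [mul_pow]
    exact mul_le_mul (pow_le_pow_left₀ (norm_nonneg _) hE 2) hX (hsSq_nonneg _) (by positivity)
  have step' : ∀ {X : Matrix ι ι ℂ} {x : ℝ}, hsSq X ≤ x ^ 2 → hsSq (X * E) ≤ (δ * x) ^ 2 := by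
    intro X x hX
    refine (hsSq_mul_le' _ _).trans ?_
    rw [mul_pow, mul_comm]
    exact mul_le_mul (pow_le_pow_left₀ (norm_nonneg _) hE 2) hX (hsSq_nonneg _) (by positivity)
  have hE1 : hsSq E ≤ (δ * q) ^ 2 := by rw [← hEQ]; exact step hQq
  have hE2 : hsSq (E * E) ≤ (δ * (δ * q)) ^ 2 := step hE1
  have hE3 : hsSq (E * E * E) ≤ (δ * (δ * (δ * q))) ^ 2 := step' hE2
  have hEA := step hAa
  have hEEA : hsSq (E * E * A) ≤ (δ * (δ * a)) ^ 2 := by rw [mul_assoc]; exact step hEA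
  have hBE := step' hBa
  have hBEE : hsSq (B * (E * E)) ≤ (δ * (δ * a)) ^ 2 := by rw [← mul_assoc]; exact step' hBE
  have sm : ∀ (z : ℂ) {b : ℝ}, ‖z‖ ≤ b → ‖s * z‖ ≤ b := by
    intro z b hz
    rw [norm_mul]
    exact (mul_le_mul_of_nonneg_right hs (norm_nonneg _)).trans (by rwa [one_mul])
  have T1 := norm_trace_mul_mul_le (by positivity) ha hEA hBa hZ1
  have T2 := sm _ (norm_trace_mul_mul_le (by positivity) ha hEEA hBa hZ1)
  have T3 := sm _ (norm_trace_mul_mul_le (by positivity) ha hE3 hBa hZ1)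
  have T4 := norm_trace_mul_mul_le ha (by positivity) hAa hBE hZ2
  have T5 := sm _ (norm_trace_mul_mul_le ha (by positivity) hAa hBEE hZ2)
  have T6 := sm _ (norm_trace_mul_mul_le ha (by positivity) hAa hE3 hZ2)
  have T7 := sm _ (norm_trace_mul_mul_le (by positivity) (by positivity) hEA hBE hR)
  have T8 := sm _ (norm_trace_mul_mul_le (by positivity) (by positivity) hEA hE2 hR)
  have T9 := sm _ (norm_trace_mul_mul_le (by positivity) (by positivity) hE2 hBE hR)
  have T10 := sm _ (norm_trace_mul_mul_le (by positivity) (by positivity) hE2 hE2 hR)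
  rw [h.split hA hB hQE hEQ]
  simp only [Matrix.trace_add, Matrix.trace_smul, smul_eq_mul]
  have key : ∀ x0 e l1 l2 l3 t1 t2 t3 t4 t5 t6 t7 t8 t9 t10 : ℂ,
      ‖x0 + e + (l1 + l2 + l3) + (t1 + t2 + t3 + t4 + t5 + t6 + t7 + t8 + t9 + t10) - e‖
        ≤ ‖x0‖ + (‖l1‖ + ‖l2‖ + ‖l3‖) + (‖t1‖ + ‖t2‖ + ‖t3‖ + ‖t4‖ + ‖t5‖ + ‖t6‖ + ‖t7‖ + ‖t8‖
          + ‖t9‖ + ‖t10‖) := by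
    intro x0 e l1 l2 l3 t1 t2 t3 t4 t5 t6 t7 t8 t9 t10
    rw [show x0 + e + (l1 + l2 + l3) + (t1 + t2 + t3 + t4 + t5 + t6 + t7 + t8 + t9 + t10) - e
      = x0 + (l1 + l2 + l3) + (t1 + t2 + t3 + t4 + t5 + t6 + t7 + t8 + t9 + t10) by ring]
    refine (norm_add_le _ _).trans (add_le_add ((norm_add_le _ _).trans
      (add_le_add_right norm_add₃_le _)) ?_)
    iterate 8 refine (norm_add_le _ _).trans (add_le_add_left ?_ _)
    exact norm_add_le _ _
  refine (key _ _ _ _ _ _ _ _ _ _ _ _ _ _ _).trans ?_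
  have := split_arith (q := q) hr hδ hδ1 ha hq
  linarith

/-- As sUR = R - 1, the matrix `s • core` is a polynomial in the resolvents and `P` alone, so it is
bounded whatever the field; one of the two factors `s` is spent on this. -/
theorem norm_trace_core_le {A B : Matrix ι ι ℂ} (h : ResolventPair U P Q R R' s) {r a : ℝ}
    (hr : 1 ≤ r) (ha : 0 ≤ a) (hs : ‖s‖ ≤ 1) (hP : ‖P‖ ≤ 1) (hR : ‖R‖ ≤ r) (hR' : ‖R'‖ ≤ r)
    (hAa : hsSq A ≤ a ^ 2) (hBa : hsSq B ≤ a ^ 2) :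
    ‖s ^ 2 * (A * core U P R R' * B).trace‖ ≤ 6 * r ^ 2 * a ^ 2 := by
  have h1 := l2_opNorm_one_le (ι := ι)
  have e : s • core U P R R' = (R' - 1) + (R - 1) * P + R' * (R - 1) := by
    have e1 : s • (P * U * P * R') = R' - 1 := eq_sub_of_add_eq' h.left'.symm
    have e2 : s • (U * R) = R - 1 := eq_sub_of_add_eq' h.left.symm
    rw [core, smul_add, smul_add, e1, ← smul_mul_assoc, e2, mul_assoc R', ← mul_smul_comm, e2]
  have hR1 : ‖R - 1‖ ≤ r + 1 := by linarith [norm_sub_le R 1]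
  have hR1' : ‖R' - 1‖ ≤ r + 1 := by linarith [norm_sub_le R' 1]
  have hZ : ‖s • core U P R R'‖ ≤ 6 * r ^ 2 := by
    rw [e]
    refine norm_add₃_le.trans ?_
    have i1 : ‖(R - 1) * P‖ ≤ (r + 1) * 1 :=
      (norm_mul_le _ _).trans (mul_le_mul hR1 hP (norm_nonneg _) (by linarith))
    have i2 : ‖R' * (R - 1)‖ ≤ r * (r + 1) :=
      (norm_mul_le _ _).trans (mul_le_mul hR' hR1 (norm_nonneg _) (by linarith))
    nlinarith
  have := norm_trace_mul_mul_le ha ha hAa hBa hZ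
  rw [mul_smul_comm, smul_mul_assoc, Matrix.trace_smul, smul_eq_mul] at this
  rw [pow_two s, mul_assoc, norm_mul]
  calc _ ≤ 1 * (6 * r ^ 2 * a * a) := mul_le_mul hs this (norm_nonneg _) zero_le_one
    _ = _ := by ring

/-- The core is expanded by one more order. Its first order part is kept exactly, and in each
remaining term a resolvent factor has a `U` on each side. Attached to `A` and `B`, these factors
give products whose Hilbert-Schmidt norm is far better controlled for typical fields than that of
`A` itself. -/
theorem norm_trace_core_le' {A B : Matrix ι ι ℂ} (h : ResolventPair U P Q R R' s) {r y : ℝ}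
    (hr : 1 ≤ r) (hy : 0 ≤ y) (hs : ‖s‖ ≤ 1) (hP : ‖P‖ ≤ 1) (hR : ‖R‖ ≤ r) (hR' : ‖R'‖ ≤ r)
    (hA1 : hsSq (A * U) ≤ y ^ 2) (hA2 : hsSq (A * P * U) ≤ y ^ 2)
    (hB1 : hsSq (U * B) ≤ y ^ 2) (hB2 : hsSq (U * P * B) ≤ y ^ 2) :
    ‖(A * core U P R R' * B).trace‖
      ≤ ‖(A * (P * U * P + U * P + U) * B).trace‖ + 6 * r ^ 2 * y ^ 2 := by
  have h1 := l2_opNorm_one_le (ι := ι)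
  have e : core U P R R' = (P * U * P + U * P + U) + s • (P * U * P * R' * (P * U * P)
      + U * R * (U * P) + P * U * P * R' * U + U * R * U + P * U * P * (R' * (R - 1)) * U) := by
    have e1 : P * U * P * R' = P * U * P + s • (P * U * P * R' * (P * U * P)) := by
      nth_rewrite 1 [h.right']
      simp only [mul_add, mul_one, mul_smul_comm, mul_assoc]
    have e2 : U * R = U + s • (U * R * U) := by
      nth_rewrite 1 [h.right]
      simp only [mul_add, mul_one, mul_smul_comm, mul_assoc]
    have e3 : R' * U * R = U + s • (P * U * P * R' * U) + s • (U * R * U)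
        + s • (P * U * P * (R' * (R - 1)) * U) := by
      have e4 : R - 1 = s • (R * U) := sub_eq_of_eq_add' h.right
      have e5 : (R - 1) * U = s • (U * R * U) := by rw [e4, smul_mul_assoc, h.UR]
      have e6 : R' * U * R = R' * U + R' * (s • (U * R * U)) := by
        rw [← mul_add, ← e2, mul_assoc]
      have e7 : R' * U = U + s • (P * U * P * R' * U) := by
        nth_rewrite 1 [h.left']
        simp only [add_mul, one_mul, smul_mul_assoc]
      have e8 : R' * (s • (U * R * U))
          = s • (U * R * U) + s • (P * U * P * (R' * (R - 1)) * U) := by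
        nth_rewrite 1 [h.left']
        rw [add_mul, one_mul, smul_mul_assoc, ← e5]
        simp only [mul_assoc]
      rw [e6, e7, e8, ← add_assoc]
    have e2P : U * R * P = U * P + s • (U * R * (U * P)) := by
      nth_rewrite 1 [e2]
      simp only [add_mul, smul_mul_assoc, mul_assoc]
    rw [core, e2P, e3]
    nth_rewrite 1 [e1]
    simp only [smul_add]
    abel
  have r0 : 0 ≤ r := by linarith
  have hA3 : hsSq (A * P * U * P) ≤ y ^ 2 := by
    refine (hsSq_mul_le' _ _).trans ?_
    calc _ ≤ y ^ 2 * 1 ^ 2 := mul_le_mul hA2 (pow_le_pow_left₀ (norm_nonneg _) hP 2)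
          (by positivity) (sq_nonneg y)
      _ = _ := by ring
  have hB3 : hsSq (P * (U * P * B)) ≤ y ^ 2 := by
    refine (hsSq_mul_le _ _).trans ?_
    calc _ ≤ 1 ^ 2 * y ^ 2 := mul_le_mul (pow_le_pow_left₀ (norm_nonneg _) hP 2) hB2
          (hsSq_nonneg _) (by positivity)
      _ = _ := by ring
  have hR1 : ‖R' * (R - 1)‖ ≤ r * (r + 1) :=
    (norm_mul_le _ _).trans (mul_le_mul hR' (by linarith [norm_sub_le R 1]) (norm_nonneg _) r0)
  have T1 := norm_trace_mul_mul_le hy hy hA3 hB3 hR'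
  have T2 := norm_trace_mul_mul_le hy hy hA1 hB2 hR
  have T3 := norm_trace_mul_mul_le hy hy hA3 hB1 hR'
  have T4 := norm_trace_mul_mul_le hy hy hA1 hB1 hR
  have T5 := norm_trace_mul_mul_le hy hy hA3 hB1 hR1
  rw [e, mul_add A (P * U * P + U * P + U), add_mul, Matrix.trace_add]
  refine (norm_add_le _ _).trans (add_le_add_right ?_ _)
  rw [mul_smul_comm, smul_mul_assoc, Matrix.trace_smul, norm_smul]
  refine (mul_le_mul_of_nonneg_right hs (norm_nonneg _)).trans ?_
  simp only [mul_add, add_mul, Matrix.trace_add, one_mul]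
  simp only [mul_assoc] at T1 T2 T3 T4 T5 ⊢
  refine (norm_add_le _ _).trans ?_
  refine (add_le_add_left norm_add₄_le _).trans ?_
  have : r * (y * y) ≤ r ^ 2 * (y * y) := mul_le_mul_of_nonneg_right (by nlinarith) (by positivity)
  rw [pow_two y]
  nlinarith

end ResolventPair
end Bounds

end TensorT44
end

noncomputable section

namespace TensorT44

open MeasureTheory ProbabilityTheory Complex

/-! ### The trace of the logarithm as an integral of resolvent traces. -/

section TraceLog

variable {ι κ : Type*} [Fintype ι] [DecidableEq ι] [Fintype κ] [DecidableEq κ]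

theorem inv_eq_det_inv_smul (A : Matrix ι ι ℂ) : A⁻¹ = A.det⁻¹ • A.adjugate := by
  rw [Matrix.inv_def, Ring.inverse_eq_inv']

/-- By Cramer's rule the inverse is a quotient of continuous functions of `s`, with nonvanishing
denominator. -/
theorem continuousOn_trace_resolvent (U : Matrix ι ι ℂ)
    (h : ∀ s ∈ Set.Icc (0 : ℝ) 1, IsUnit (1 - (s : ℂ) • U)) :
    ContinuousOn (fun s : ℝ => (U * (1 - (s : ℂ) • U)⁻¹).trace) (Set.Icc 0 1) := by
  have hc : Continuous fun s : ℝ => (1 - (s : ℂ) • U) := by fun_prop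
  simp only [inv_eq_det_inv_smul, Matrix.mul_smul, Matrix.trace_smul, smul_eq_mul]
  refine ContinuousOn.mul (ContinuousOn.inv₀ hc.matrix_det.continuousOn fun s hs => ?_) ?_
  · exact ((Matrix.isUnit_iff_isUnit_det _).1 (h s hs)).ne_zero
  · exact (Continuous.matrix_trace (continuous_const.matrix_mul hc.matrix_adjugate)).continuousOn

theorem intervalIntegrable_trace_resolvent (U : Matrix ι ι ℂ)
    (h : ∀ s ∈ Set.Icc (0 : ℝ) 1, IsUnit (1 - (s : ℂ) • U)) :
    IntervalIntegrable (fun s : ℝ => (U * (1 - (s : ℂ) • U)⁻¹).trace) volume 0 1 := by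
  refine ContinuousOn.intervalIntegrable ?_
  rw [Set.uIcc_of_le zero_le_one]
  exact continuousOn_trace_resolvent U h

/-- Extending a matrix by zero to a larger index set does not change `traceLogThree`. -/
theorem traceLogThree_embed (f : κ → ι) (hf : Function.Injective f) (A : Matrix κ κ ℂ)
    (A' : Matrix ι ι ℂ) (hA : ∀ a b, A' (f a) (f b) = A a b)
    (hl : ∀ i j, i ∉ Set.range f → A' i j = 0) (hr : ∀ i j, j ∉ Set.range f → A' i j = 0)
    (h : ∀ s ∈ Set.Icc (0 : ℝ) 1, IsUnit (1 - (s : ℂ) • A)) :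
    traceLogThree A' = traceLogThree A := by
  -- `F` is the isometry extending vectors by zero: A' = F A Fᵀ and Fᵀ F = 1.
  set F : Matrix ι κ ℂ := Matrix.of fun i k => if i = f k then 1 else 0 with hF
  have hFF : F.transpose * F = 1 := by
    ext a b
    simp [hF, Matrix.mul_apply, Matrix.one_apply, hf.eq_iff, eq_comm]
  have hA' : A' = F * A * F.transpose := by
    ext i j
    by_cases hi : i ∈ Set.range f
    · by_cases hj : j ∈ Set.range f
      · obtain ⟨a, rfl⟩ := hi
        obtain ⟨b, rfl⟩ := hj
        simp [hF, Matrix.mul_apply, hf.eq_iff, hA]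
      · rw [hr i j hj]
        simp only [Matrix.mul_apply, Matrix.transpose_apply]
        refine (Finset.sum_eq_zero fun b _ => ?_).symm
        rw [hF, Matrix.of_apply, if_neg fun e => hj ⟨b, e.symm⟩, mul_zero]
    · rw [hl i j hi]
      simp only [Matrix.mul_apply]
      refine (Finset.sum_eq_zero fun b _ => ?_).symm
      rw [Finset.sum_eq_zero fun a _ => ?_, zero_mul]
      rw [hF, Matrix.of_apply, if_neg fun e => hi ⟨a, e.symm⟩, zero_mul]
  have htr : ∀ X : Matrix κ κ ℂ, (F * X * F.transpose).trace = X.trace := fun X => by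
    rw [Matrix.trace_mul_comm, ← Matrix.mul_assoc, hFF, Matrix.one_mul]
  have hmul : ∀ X Y : Matrix κ κ ℂ,
      F * X * F.transpose * (F * Y * F.transpose) = F * (X * Y) * F.transpose := fun X Y => by
    calc _ = F * X * (F.transpose * F) * Y * F.transpose := by simp only [Matrix.mul_assoc]
      _ = _ := by rw [hFF, Matrix.mul_one]; simp only [Matrix.mul_assoc]
  have hres : ∀ s ∈ Set.Icc (0 : ℝ) 1, (A' * (1 - (s : ℂ) • A')⁻¹).trace
      = (A * (1 - (s : ℂ) • A)⁻¹).trace := by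
    intro s hs
    have hu := (Matrix.isUnit_iff_isUnit_det _).1 (h s hs)
    set R := (1 - (s : ℂ) • A)⁻¹
    have hR : (1 - (s : ℂ) • A) * R = 1 := Matrix.mul_nonsing_inv _ hu
    rw [sub_mul, one_mul, smul_mul_assoc] at hR
    have hR' : R = 1 + (s : ℂ) • (A * R) := eq_add_of_sub_eq hR
    -- The resolvent of `A'` is the identity off the range of `F`, so it is not F R Fᵀ.
    have hinv : (1 - (s : ℂ) • A')⁻¹ = 1 + (s : ℂ) • (F * (A * R) * F.transpose) := by
      refine Matrix.inv_eq_right_inv ?_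
      rw [sub_mul, one_mul, mul_add, mul_one, hA', mul_smul_comm, smul_mul_assoc, hmul]
      have h2 : F * (A * R) * F.transpose
          = F * A * F.transpose + (s : ℂ) • (F * (A * (A * R)) * F.transpose) := by
        nth_rewrite 1 [hR']
        simp only [mul_add, mul_one, mul_smul_comm, Matrix.mul_add, Matrix.add_mul,
          Matrix.mul_smul, Matrix.smul_mul]
      nth_rewrite 1 [h2]
      simp only [smul_add, smul_smul]
      abel
    rw [hinv, mul_add, mul_one, mul_smul_comm, hA', hmul, Matrix.trace_add, Matrix.trace_smul, htr,
      htr]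
    have h3 : A * R = A + (s : ℂ) • (A * (A * R)) := by
      nth_rewrite 1 [hR']
      rw [mul_add, mul_one, mul_smul_comm]
    rw [← Matrix.trace_smul, ← Matrix.trace_add, ← h3]
  unfold traceLogThree
  congr 1
  · rw [pow_two A', hA', hmul, htr, htr, pow_two]
  · refine intervalIntegral.integral_congr fun s hs => ?_
    rw [Set.uIcc_of_le zero_le_one] at hs
    exact hres s hs

/-- Integrates `trace_diff` over `s`. The terms c0 and s c1 give exactly what log₃ adds back, and s²
e gives e / 3; the sign comes from the minus in front of the integral defining the logarithm. -/
theorem norm_traceLogThree_sub_le {U P : Matrix ι ι ℂ} (hP : P * P = P)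
    (hU : ∀ s ∈ Set.Icc (0 : ℝ) 1, IsUnit (1 - (s : ℂ) • U))
    (hU' : ∀ s ∈ Set.Icc (0 : ℝ) 1, IsUnit (1 - (s : ℂ) • (P * U * P))) {e : ℂ} {b : ℝ}
    (hb : ∀ s ∈ Set.Icc (0 : ℝ) 1, ‖(s : ℂ) ^ 2 * ((1 - P) * U * ResolventPair.core U P
      (1 - (s : ℂ) • U)⁻¹ (1 - (s : ℂ) • (P * U * P))⁻¹ * (U * (1 - P))).trace
        - (s : ℂ) ^ 2 * e‖ ≤ b) :
    ‖traceLogThree U - traceLogThree (P * U * P) + e / 3‖ ≤ b := by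
  set c0 := U.trace - (P * U * P).trace with hc0
  set c1 := (U ^ 2).trace - ((P * U * P) ^ 2).trace with hc1
  set τ : ℝ → ℂ := fun s => ((1 - P) * U * ResolventPair.core U P
      (1 - (s : ℂ) • U)⁻¹ (1 - (s : ℂ) • (P * U * P))⁻¹ * (U * (1 - P))).trace
  have hint := intervalIntegrable_trace_resolvent U hU
  have hint' := intervalIntegrable_trace_resolvent _ hU'
  have hdiff : ∀ s ∈ Set.Icc (0 : ℝ) 1, (U * (1 - (s : ℂ) • U)⁻¹).trace
      - (P * U * P * (1 - (s : ℂ) • (P * U * P))⁻¹).trace = c0 + s * c1 + s ^ 2 * τ s :=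
    fun s hs => (ResolventPair.of_isUnit hP (hU s hs) (hU' s hs)).trace_diff
  have hpoly : ∫ s in (0 : ℝ)..1, (c0 + (s : ℂ) * c1 + (s : ℂ) ^ 2 * e)
      = c0 + c1 / 2 + e / 3 := by
    have i1 : ∫ s in (0 : ℝ)..1, (s : ℂ) = 1 / 2 := by
      have := integral_id (a := (0 : ℝ)) (b := 1)
      rw [intervalIntegral.integral_ofReal, this]; norm_num
    have i2 : ∫ s in (0 : ℝ)..1, (s : ℂ) ^ 2 = 1 / 3 := by
      have := integral_pow (a := (0 : ℝ)) (b := 1) 2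
      simp only [← ofReal_pow]
      rw [intervalIntegral.integral_ofReal, this]; norm_num
    rw [intervalIntegral.integral_add, intervalIntegral.integral_add,
      intervalIntegral.integral_mul_const, intervalIntegral.integral_mul_const, i1, i2]
    · simp; ring
    all_goals exact Continuous.intervalIntegrable (by fun_prop) _ _
  have key : traceLogThree U - traceLogThree (P * U * P) + e / 3
      = -∫ s in (0 : ℝ)..1, ((U * (1 - (s : ℂ) • U)⁻¹).trace
        - (P * U * P * (1 - (s : ℂ) • (P * U * P))⁻¹).trace
        - (c0 + (s : ℂ) * c1 + (s : ℂ) ^ 2 * e)) := by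
    rw [intervalIntegral.integral_sub (hint.sub hint')
      (Continuous.intervalIntegrable (by fun_prop) _ _), hpoly,
      intervalIntegral.integral_sub hint hint', traceLogThree, traceLogThree, hc0, hc1]
    ring
  rw [key, norm_neg]
  have := intervalIntegral.norm_integral_le_of_norm_le_const (a := 0) (b := 1) (C := b)
    (f := fun s : ℝ => (U * (1 - (s : ℂ) • U)⁻¹).trace
        - (P * U * P * (1 - (s : ℂ) • (P * U * P))⁻¹).trace
        - (c0 + (s : ℂ) * c1 + (s : ℂ) ^ 2 * e)) ?_
  · simpa using this
  intro s hs
  rw [Set.uIoc_of_le zero_le_one] at hs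
  have hs' : s ∈ Set.Icc (0 : ℝ) 1 := ⟨hs.1.le, hs.2⟩
  rw [hdiff s hs']
  have := hb s hs'
  rw [show c0 + (s : ℂ) * c1 + (s : ℂ) ^ 2 * τ s - (c0 + (s : ℂ) * c1 + (s : ℂ) ^ 2 * e)
    = (s : ℂ) ^ 2 * τ s - (s : ℂ) ^ 2 * e by ring]
  exact this

end TraceLog

end TensorT44
end

noncomputable section

namespace TensorT44

open MeasureTheory ProbabilityTheory Complex

/-! ### Lattice sums and growth of the renormalized amplitudes. -/

section LatticeSums

theorem sum_range_inv_mul_le {b : ℝ} (hb : 0 < b) (n : ℕ) :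
    ∑ i ∈ Finset.range n, 1 / (((i : ℝ) + b) * ((i : ℝ) + b + 1)) ≤ 1 / b := by
  have h : ∀ i : ℕ, 1 / (((i : ℝ) + b) * ((i : ℝ) + b + 1))
      = 1 / ((i : ℝ) + b) - 1 / (((i + 1 : ℕ) : ℝ) + b) := by
    intro i
    have : (0 : ℝ) < i + b := by positivity
    push_cast
    field_simp
    ring
  simp only [h]
  rw [Finset.sum_range_sub' (fun i : ℕ => 1 / ((i : ℝ) + b))]
  have : 0 ≤ 1 / ((n : ℝ) + b) := by positivity
  simpa using this

/-- Comparison with a telescoping series, since (x + √a)(x + √a + 1) ≤ 4(x² + a) when √a ≥ 1.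
Working in extended nonnegative reals makes summability proofs unnecessary. -/
theorem tsum_nat_inv_sq_add_le {a : ℝ} (ha : 1 ≤ a) :
    ∑' x : ℕ, ENNReal.ofReal (1 / ((x : ℝ) ^ 2 + a)) ≤ ENNReal.ofReal (4 / √a) := by
  have hb : 1 ≤ √a := Real.one_le_sqrt.2 ha
  have hb2 : √a ^ 2 = a := Real.sq_sqrt (by linarith)
  refine ENNReal.tsum_le_of_sum_range_le fun n => ?_
  rw [← ENNReal.ofReal_sum_of_nonneg (fun i _ => by positivity)]
  refine ENNReal.ofReal_le_ofReal ?_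
  calc ∑ i ∈ Finset.range n, 1 / ((i : ℝ) ^ 2 + a)
      ≤ ∑ i ∈ Finset.range n, 4 * (1 / (((i : ℝ) + √a) * ((i : ℝ) + √a + 1))) := by
        refine Finset.sum_le_sum fun i _ => ?_
        have hi : (0 : ℝ) ≤ i := Nat.cast_nonneg i
        rw [mul_one_div, div_le_div_iff₀ (by positivity) (by positivity)]
        nlinarith [sq_nonneg ((i : ℝ) - √a)]
    _ ≤ 4 * (1 / √a) := by
        rw [← Finset.mul_sum]
        exact mul_le_mul_of_nonneg_left (sum_range_inv_mul_le (by linarith) n) (by norm_num)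
    _ = 4 / √a := by ring

theorem tsum_int_inv_sq_add_le {a : ℝ} (ha : 1 ≤ a) :
    ∑' x : ℤ, ENNReal.ofReal (1 / ((x : ℝ) ^ 2 + a)) ≤ ENNReal.ofReal (8 / √a) := by
  have h1 := tsum_nat_inv_sq_add_le ha
  have hs : HasSum (fun x : ℤ => ENNReal.ofReal (1 / ((x : ℝ) ^ 2 + a)))
      (∑' x : ℕ, ENNReal.ofReal (1 / (((x : ℤ) : ℝ) ^ 2 + a))
        + ∑' x : ℕ, ENNReal.ofReal (1 / (((-((x : ℤ) + 1) : ℤ) : ℝ) ^ 2 + a))) :=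
    HasSum.of_nat_of_neg_add_one ENNReal.summable.hasSum ENNReal.summable.hasSum
  rw [hs.tsum_eq, show 8 / √a = 4 / √a + 4 / √a by ring, ENNReal.ofReal_add (by positivity)
    (by positivity)]
  refine add_le_add (by simpa using h1) (le_trans (ENNReal.tsum_le_tsum fun x => ?_) h1)
  refine ENNReal.ofReal_le_ofReal ?_
  have hx : (0 : ℝ) ≤ x := Nat.cast_nonneg x
  refine one_div_le_one_div_of_le (by positivity) ?_
  push_cast
  nlinarith

theorem tsum_int_rpow_le {a s : ℝ} (ha : 1 ≤ a) (hs : 1 ≤ s) :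
    ∑' x : ℤ, ENNReal.ofReal (((x : ℝ) ^ 2 + a) ^ (-s))
      ≤ ENNReal.ofReal 8 * ENNReal.ofReal (a ^ (-(s - 1 / 2))) := by
  have ha0 : 0 < a := by linarith
  have h : ∀ x : ℤ, ENNReal.ofReal (((x : ℝ) ^ 2 + a) ^ (-s))
      ≤ ENNReal.ofReal (a ^ (-(s - 1))) * ENNReal.ofReal (1 / ((x : ℝ) ^ 2 + a)) := by
    intro x
    rw [← ENNReal.ofReal_mul (by positivity)]
    refine ENNReal.ofReal_le_ofReal ?_
    have hx : 0 < (x : ℝ) ^ 2 + a := by positivity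
    rw [show -s = -(s - 1) + (-1) by ring, Real.rpow_add hx, Real.rpow_neg_one, one_div]
    refine mul_le_mul_of_nonneg_right ?_ (by positivity)
    exact Real.rpow_le_rpow_of_nonpos ha0 (by nlinarith [sq_nonneg (x : ℝ)]) (by linarith)
  refine (ENNReal.tsum_le_tsum h).trans ?_
  rw [ENNReal.tsum_mul_left]
  refine (mul_le_mul_right (tsum_int_inv_sq_add_le ha) _).trans ?_
  rw [← ENNReal.ofReal_mul (by positivity), ← ENNReal.ofReal_mul (by positivity)]
  refine ENNReal.ofReal_le_ofReal (le_of_eq ?_)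
  rw [show -(s - 1 / 2) = -(s - 1) + -(1 / 2) by ring, Real.rpow_add ha0, Real.rpow_neg ha0.le (1 / 2),
    ← Real.sqrt_eq_rpow]
  ring

theorem tsum_fin_succ {d : ℕ} (f : (Fin (d + 1) → ℤ) → ENNReal) :
    ∑' p, f p = ∑' q : Fin d → ℤ, ∑' x : ℤ, f (Fin.cons x q) := by
  rw [← (Fin.insertNthEquiv (fun _ : Fin (d + 1) => ℤ) 0).tsum_eq, ENNReal.tsum_prod',
    ENNReal.tsum_comm]
  simp [Fin.insertNthEquiv]

/-- One coordinate is summed at a time, each sum lowering the exponent by 1/2; the hypothesis on `s`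
keeps the exponent at least 1 before each summation. -/
theorem tsum_fin_rpow_le (d : ℕ) {a s : ℝ} (ha : 1 ≤ a) (hs : 1 + (d : ℝ) / 2 ≤ s + 1 / 2) :
    ∑' p : Fin d → ℤ, ENNReal.ofReal (((∑ i, (p i : ℝ) ^ 2) + a) ^ (-s))
      ≤ ENNReal.ofReal (8 ^ d) * ENNReal.ofReal (a ^ (-(s - d / 2))) := by
  induction d generalizing s with
  | zero => simp
  | succ d ih =>
    push_cast at hs
    rw [tsum_fin_succ]
    have h : ∀ q : Fin d → ℤ, ∑' x : ℤ, ENNReal.ofReal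
        (((∑ i, ((Fin.cons x q : Fin (d + 1) → ℤ) i : ℝ) ^ 2) + a) ^ (-s))
        ≤ ENNReal.ofReal 8 * ENNReal.ofReal (((∑ i, (q i : ℝ) ^ 2) + a) ^ (-(s - 1 / 2))) := by
      intro q
      have h0 : 0 ≤ ∑ i, (q i : ℝ) ^ 2 := Finset.sum_nonneg fun _ _ => sq_nonneg _
      simp only [Fin.sum_univ_succ, Fin.cons_zero, Fin.cons_succ, add_assoc]
      have hd : (0 : ℝ) ≤ d := Nat.cast_nonneg d
      exact tsum_int_rpow_le (by linarith) (by linarith)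
    refine (ENNReal.tsum_le_tsum h).trans ?_
    rw [ENNReal.tsum_mul_left]
    refine (mul_le_mul_right (ih (s := s - 1 / 2) (by linarith)) _).trans ?_
    rw [← mul_assoc, ← ENNReal.ofReal_mul (by positivity)]
    refine le_of_eq ?_
    congr 2
    · ring
    · push_cast; congr 1; ring

/-- `1 + k² + ‖p‖²`, the inverse of the propagator at the momentum `(k, p)`. -/
def invProp (k : ℝ) (p : Fin 3 → ℤ) : ℝ := (∑ i, (p i : ℝ) ^ 2) + (k ^ 2 + 1)

theorem one_le_invProp (k : ℝ) (p : Fin 3 → ℤ) : 1 ≤ invProp k p := by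
  have h0 : 0 ≤ ∑ i, (p i : ℝ) ^ 2 := Finset.sum_nonneg fun _ _ => sq_nonneg _
  unfold invProp
  nlinarith [sq_nonneg k]

theorem invProp_pos (k : ℝ) (p : Fin 3 → ℤ) : 0 < invProp k p :=
  zero_lt_one.trans_le (one_le_invProp k p)

theorem propagator_insertNth (c : Fin 4) (k : ℤ) (p : Fin 3 → ℤ) :
    propagator (c.insertNth k p : Momentum) = (invProp k p)⁻¹ := by
  unfold propagator invProp
  rw [Fin.sum_univ_succAbove _ c, one_div]
  simp only [Fin.insertNth_apply_same, Fin.insertNth_apply_succAbove]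
  congr 1; ring

theorem propagator_cons (k : ℤ) (p : Fin 3 → ℤ) :
    propagator (Fin.cons k p : Momentum) = (invProp k.natAbs p)⁻¹ := by
  rw [← Fin.insertNth_zero', propagator_insertNth]
  unfold invProp
  rw [Nat.cast_natAbs, Int.cast_abs, sq_abs]

theorem tsum_invProp_rpow_le (k : ℝ) {s : ℝ} (hs : 2 ≤ s) :
    ∑' p : Fin 3 → ℤ, ENNReal.ofReal (invProp k p ^ (-s))
      ≤ ENNReal.ofReal (512 * (k ^ 2 + 1) ^ (-(s - 3 / 2))) := by
  have := tsum_fin_rpow_le 3 (a := k ^ 2 + 1) (s := s) (by nlinarith [sq_nonneg k])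
    (by push_cast; linarith)
  rw [ENNReal.ofReal_mul (by norm_num)]
  convert this using 3
  · rfl
  · norm_num
  · norm_num

theorem tsum_invProp_sq_inv_le (k : ℝ) :
    ∑' p : Fin 3 → ℤ, ENNReal.ofReal ((invProp k p)⁻¹ ^ 2)
      ≤ ENNReal.ofReal (512 / √(k ^ 2 + 1)) := by
  have := tsum_invProp_rpow_le k (s := 2) le_rfl
  convert this using 2
  · funext p
    rw [Real.rpow_neg (invProp_pos k p).le, inv_pow]
    norm_cast
  · rw [Real.sqrt_eq_rpow, div_eq_mul_inv, ← Real.rpow_neg (by positivity)]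
    norm_num

theorem inv_sub_inv_invProp_le (i : ℕ) (p : Fin 3 → ℤ) :
    0 ≤ (invProp i p)⁻¹ - (invProp (i + 1 : ℕ) p)⁻¹ ∧
    (invProp i p)⁻¹ - (invProp (i + 1 : ℕ) p)⁻¹ ≤ (2 * i + 1) * (invProp i p)⁻¹ ^ 2 := by
  have hi := invProp_pos i p
  have hi' := invProp_pos (i + 1 : ℕ) p
  have h : invProp (i + 1 : ℕ) p = invProp i p + (2 * i + 1) := by
    unfold invProp; push_cast; ring
  have hn : (0 : ℝ) ≤ i := Nat.cast_nonneg i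
  have hle : (invProp (i + 1 : ℕ) p)⁻¹ ≤ (invProp i p)⁻¹ :=
    inv_anti₀ hi (by rw [h]; linarith)
  have heq : (invProp i p)⁻¹ - (invProp (i + 1 : ℕ) p)⁻¹
      = (2 * i + 1) * (invProp i p)⁻¹ * (invProp (i + 1 : ℕ) p)⁻¹ := by
    field_simp
    rw [h]; ring
  refine ⟨sub_nonneg.2 hle, ?_⟩
  rw [heq, pow_two, ← mul_assoc]
  exact mul_le_mul_of_nonneg_left hle (by positivity)

theorem two_mul_add_one_le_sqrt (i : ℕ) : (2 * (i : ℝ) + 1) ≤ 3 * √((i : ℝ) ^ 2 + 1) := by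
  have h1 : (i : ℝ) ≤ √((i : ℝ) ^ 2 + 1) := Real.le_sqrt_of_sq_le (by linarith)
  have h2 : (1 : ℝ) ≤ √((i : ℝ) ^ 2 + 1) := Real.one_le_sqrt.2 (by nlinarith [sq_nonneg (i : ℝ)])
  linarith

/-- The difference of propagators is telescoped through the integers from 0 to |k|. Step `i` costs
(2i + 1) ∑ C², at most 3 · 512, because ∑ C² over three dimensions decays like 1/i. Hence linear
growth, with 1536 = 3 · 512. -/
theorem abs_tadpoleComp_le (k : ℤ) : |tadpoleComp k| ≤ 1536 * |(k : ℝ)| := by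
  have h1 : ∀ p : Fin 3 → ℤ, ‖propagator (Fin.cons k p : Momentum)
      - propagator (Fin.cons 0 p : Momentum)‖ₑ ≤ ∑ i ∈ Finset.range k.natAbs,
        ENNReal.ofReal (2 * i + 1) * ENNReal.ofReal ((invProp i p)⁻¹ ^ 2) := by
    intro p
    rw [propagator_cons, propagator_cons, Int.natAbs_zero]
    have ht := Finset.sum_range_sub' (fun i : ℕ => (invProp i p)⁻¹) k.natAbs
    rw [← neg_sub, ← ht, enorm_neg, ← ofReal_norm, Real.norm_of_nonneg
      (Finset.sum_nonneg fun i _ => (inv_sub_inv_invProp_le i p).1), ENNReal.ofReal_sum_of_nonneg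
      (fun i _ => (inv_sub_inv_invProp_le i p).1)]
    refine Finset.sum_le_sum fun i _ => ?_
    rw [← ENNReal.ofReal_mul (by positivity)]
    exact ENNReal.ofReal_le_ofReal (inv_sub_inv_invProp_le i p).2
  have h2 : ‖tadpoleComp k‖ₑ ≤ ENNReal.ofReal (1536 * |(k : ℝ)|) := by
    unfold tadpoleComp
    refine enorm_tsum_le_tsum_enorm.trans ((ENNReal.tsum_le_tsum h1).trans ?_)
    rw [Summable.tsum_finsetSum (fun i _ => ENNReal.summable)]
    have : ∀ i ∈ Finset.range k.natAbs, ∑' p : Fin 3 → ℤ, ENNReal.ofReal (2 * i + 1)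
        * ENNReal.ofReal ((invProp i p)⁻¹ ^ 2) ≤ ENNReal.ofReal 1536 := by
      intro i _
      rw [ENNReal.tsum_mul_left]
      refine (mul_le_mul_right (tsum_invProp_sq_inv_le i) _).trans ?_
      rw [← ENNReal.ofReal_mul (by positivity)]
      refine ENNReal.ofReal_le_ofReal ?_
      have := two_mul_add_one_le_sqrt i
      have h0 : 0 < √((i : ℝ) ^ 2 + 1) := by positivity
      rw [← mul_div_assoc, div_le_iff₀ h0]
      linarith
    refine (Finset.sum_le_sum this).trans ?_
    rw [Finset.sum_const, Finset.card_range, nsmul_eq_mul, mul_comm, ENNReal.ofReal_mul (by norm_num)]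
    refine mul_le_mul_right (le_of_eq ?_) _
    rw [← ENNReal.ofReal_natCast]
    congr 1
    rw [Nat.cast_natAbs, Int.cast_abs]
  rw [← ofReal_norm, Real.norm_eq_abs] at h2
  exact (ENNReal.ofReal_le_ofReal_iff (by positivity)).1 h2

theorem sum_range_div_le (n : ℕ) :
    ∑ i ∈ Finset.range n, (2 * (i : ℝ) + 1) / ((i : ℝ) ^ 2 + 1) ≤ 6 * √n := by
  have h1 : ∀ i : ℕ, (2 * (i : ℝ) + 1) / ((i : ℝ) ^ 2 + 1) ≤ 3 / √((i : ℝ) + 1) := by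
    intro i
    have hi : (0 : ℝ) ≤ i := Nat.cast_nonneg i
    have h2 : √((i : ℝ) + 1) ≤ ((i : ℝ) + 2) / 2 := by
      rw [Real.sqrt_le_left (by positivity)]
      nlinarith [sq_nonneg (i : ℝ)]
    rw [div_le_div_iff₀ (by positivity) (by positivity)]
    nlinarith [sq_nonneg ((i : ℝ) - 1)]
  refine (Finset.sum_le_sum fun i _ => h1 i).trans ?_
  induction n with
  | zero => simp
  | succ n ih =>
    rw [Finset.sum_range_succ]
    push_cast
    have ha : 0 ≤ √(n : ℝ) := Real.sqrt_nonneg _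
    have hb : 0 < √((n : ℝ) + 1) := by positivity
    have ha2 : √(n : ℝ) ^ 2 = n := Real.sq_sqrt (Nat.cast_nonneg n)
    have hb2 : √((n : ℝ) + 1) ^ 2 = n + 1 := Real.sq_sqrt (by positivity)
    have : 3 / √((n : ℝ) + 1) ≤ 6 * √((n : ℝ) + 1) - 6 * √(n : ℝ) := by
      rw [div_le_iff₀ hb]
      nlinarith [sq_nonneg (√((n : ℝ) + 1) - √(n : ℝ))]
    linarith

theorem tadpoleComp_zero : tadpoleComp 0 = 0 := by
  unfold tadpoleComp; simp

theorem sum_abs_sq_le (p : Fin 3 → ℤ) : (∑ i, |(p i : ℝ)|) ^ 2 ≤ 3 * ∑ i, (p i : ℝ) ^ 2 := by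
  have := sq_sum_le_card_mul_sum_sq (s := (Finset.univ : Finset (Fin 3)))
    (f := fun i => |(p i : ℝ)|)
  simpa using this

theorem tsum_invProp_rpow_five_halves_le (k : ℝ) :
    ∑' p : Fin 3 → ℤ, ENNReal.ofReal ((invProp k p)⁻¹ ^ 3 * √(invProp k p))
      ≤ ENNReal.ofReal (512 / (k ^ 2 + 1)) := by
  have := tsum_invProp_rpow_le k (s := 5 / 2) (by norm_num)
  convert this using 2
  · funext p
    have hp := invProp_pos k p
    rw [Real.sqrt_eq_rpow, inv_pow, ← Real.rpow_natCast, ← Real.rpow_neg hp.le, ← Real.rpow_add hp]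
    norm_num
  · rw [div_eq_mul_inv, ← Real.rpow_neg_one]
    norm_num

/-- The inserted tadpole is the sum of a part depending on `k` only, which vanishes at 0, and a part
S independent of the distinguished momentum. The first contributes |k| ∑ C² = O(1), whence 786432 =
1536 · 512. For the second, C² is telescoped and S = O(C^{-1/2}), so step `i` costs O(i) ∑ C^{5/2} =
O(1/i). The resulting harmonic sum is bounded by a square root, which is sufficient: 18874368 = 6144
· 512 · 6. -/
theorem abs_secondComp_le (k : ℤ) :
    |secondComp k| ≤ 786432 + 18874368 * √|(k : ℝ)| := by
  set n := k.natAbs with hn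
  have hnk : (n : ℝ) = |(k : ℝ)| := by rw [hn, Nat.cast_natAbs, Int.cast_abs]
  have h1 : ∀ p : Fin 3 → ℤ, ‖propagator (Fin.cons k p : Momentum) ^ 2
        * amplitudeOne (Fin.cons k p : Momentum)
      - propagator (Fin.cons 0 p : Momentum) ^ 2 * amplitudeOne (Fin.cons 0 p : Momentum)‖ₑ
      ≤ ENNReal.ofReal (1536 * n) * ENNReal.ofReal ((invProp n p)⁻¹ ^ 2)
        + ∑ i ∈ Finset.range n, ENNReal.ofReal (6144 * (2 * i + 1))
          * ENNReal.ofReal ((invProp i p)⁻¹ ^ 3 * √(invProp i p)) := by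
    intro p
    have hA : amplitudeOne (Fin.cons k p : Momentum)
        = tadpoleComp k + ∑ i, tadpoleComp (p i) := by
      simp [amplitudeOne, Fin.sum_univ_succ]
    have hA0 : amplitudeOne (Fin.cons 0 p : Momentum) = ∑ i, tadpoleComp (p i) := by
      simp [amplitudeOne, Fin.sum_univ_succ, tadpoleComp_zero]
    set S := ∑ i, tadpoleComp (p i) with hS
    have hSle : ∀ i : ℕ, |S| ≤ 3072 * √(invProp i p) := by
      intro i
      have e1 : |S| ≤ 1536 * ∑ i, |(p i : ℝ)| := by
        rw [Finset.mul_sum]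
        exact (Finset.abs_sum_le_sum_abs _ _).trans
          (Finset.sum_le_sum fun i _ => abs_tadpoleComp_le _)
      have e2 : ∑ i, |(p i : ℝ)| ≤ 2 * √(invProp i p) := by
        rw [show (2 : ℝ) = √(2 ^ 2) by rw [Real.sqrt_sq (by norm_num)], ← Real.sqrt_mul (by norm_num)]
        refine Real.le_sqrt_of_sq_le ((sum_abs_sq_le p).trans ?_)
        have h0 : 0 ≤ ∑ i, (p i : ℝ) ^ 2 := Finset.sum_nonneg fun _ _ => sq_nonneg _
        unfold invProp
        nlinarith [sq_nonneg (i : ℝ)]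
      linarith
    rw [propagator_cons, propagator_cons, hA, hA0, Int.natAbs_zero, ← hn]
    rw [show (invProp n p)⁻¹ ^ 2 * (tadpoleComp k + S) - (invProp (0 : ℕ) p)⁻¹ ^ 2 * S
      = (invProp n p)⁻¹ ^ 2 * tadpoleComp k
        + -(((invProp (0 : ℕ) p)⁻¹ ^ 2 - (invProp n p)⁻¹ ^ 2) * S) by ring]
    refine (enorm_add_le _ _).trans (add_le_add ?_ ?_)
    · rw [← ENNReal.ofReal_mul (by positivity), ← ofReal_norm]
      refine ENNReal.ofReal_le_ofReal ?_
      rw [norm_mul, Real.norm_of_nonneg (by positivity), mul_comm, hnk]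
      exact mul_le_mul_of_nonneg_right (abs_tadpoleComp_le k) (by positivity)
    · rw [enorm_neg, ← Finset.sum_range_sub' (fun i : ℕ => (invProp i p)⁻¹ ^ 2), Finset.sum_mul]
      refine (enorm_sum_le _ _).trans (Finset.sum_le_sum fun i _ => ?_)
      rw [← ENNReal.ofReal_mul (by positivity), ← ofReal_norm]
      refine ENNReal.ofReal_le_ofReal ?_
      obtain ⟨q1, q2⟩ := inv_sub_inv_invProp_le i p
      have hx := inv_pos.2 (invProp_pos i p)
      have hy := inv_pos.2 (invProp_pos (i + 1 : ℕ) p)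
      set x := (invProp i p)⁻¹
      set y := (invProp (i + 1 : ℕ) p)⁻¹
      have q3 : x ^ 2 - y ^ 2 ≤ 2 * (2 * i + 1) * x ^ 3 := by
        calc x ^ 2 - y ^ 2 = (x - y) * (x + y) := by ring
          _ ≤ ((2 * i + 1) * x ^ 2) * (2 * x) :=
            mul_le_mul q2 (by linarith) (by positivity) (by positivity)
          _ = _ := by ring
      have q4 : 0 ≤ x ^ 2 - y ^ 2 := by nlinarith
      rw [norm_mul, Real.norm_of_nonneg q4, Real.norm_eq_abs]
      calc _ ≤ (2 * (2 * i + 1) * x ^ 3) * (3072 * √(invProp i p)) :=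
            mul_le_mul q3 (hSle i) (abs_nonneg _) (by positivity)
        _ = _ := by ring
  have h2 : ‖secondComp k‖ₑ ≤ ENNReal.ofReal (786432 + 18874368 * √|(k : ℝ)|) := by
    unfold secondComp
    refine enorm_tsum_le_tsum_enorm.trans ((ENNReal.tsum_le_tsum h1).trans ?_)
    rw [ENNReal.tsum_add, Summable.tsum_finsetSum (fun i _ => ENNReal.summable),
      ENNReal.tsum_mul_left, ENNReal.ofReal_add (by norm_num) (by positivity)]
    refine add_le_add ?_ ?_
    · refine (mul_le_mul_right (tsum_invProp_sq_inv_le n) _).trans ?_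
      rw [← ENNReal.ofReal_mul (by positivity)]
      refine ENNReal.ofReal_le_ofReal ?_
      have h0 : 0 < √((n : ℝ) ^ 2 + 1) := by positivity
      have h1 : (n : ℝ) ≤ √((n : ℝ) ^ 2 + 1) := Real.le_sqrt_of_sq_le (by linarith)
      rw [← mul_div_assoc, div_le_iff₀ h0]
      linarith
    · have : ∀ i ∈ Finset.range n, ∑' p : Fin 3 → ℤ, ENNReal.ofReal (6144 * (2 * i + 1))
          * ENNReal.ofReal ((invProp i p)⁻¹ ^ 3 * √(invProp i p))
          ≤ ENNReal.ofReal (3145728 * ((2 * i + 1) / ((i : ℝ) ^ 2 + 1))) := by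
        intro i _
        rw [ENNReal.tsum_mul_left]
        refine (mul_le_mul_right (tsum_invProp_rpow_five_halves_le i) _).trans ?_
        rw [← ENNReal.ofReal_mul (by positivity)]
        refine ENNReal.ofReal_le_ofReal (le_of_eq ?_)
        ring
      refine (Finset.sum_le_sum this).trans ?_
      rw [← ENNReal.ofReal_sum_of_nonneg (fun i _ => by positivity), ← Finset.mul_sum]
      refine ENNReal.ofReal_le_ofReal ?_
      have := sum_range_div_le n
      rw [← hnk]
      linarith
  rw [← ofReal_norm, Real.norm_eq_abs] at h2
  exact (ENNReal.ofReal_le_ofReal_iff (by positivity)).1 h2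

end LatticeSums

end TensorT44
end

noncomputable section

namespace TensorT44

open MeasureTheory ProbabilityTheory Complex

/-! ### Counting momenta, and sums of propagators below a cutoff. -/

section Momenta

theorem one_add_sum_sq_pos (n : Momentum) : 0 < (∑ c, (n c : ℝ) ^ 2) + 1 := by
  have h0 : 0 ≤ ∑ c, (n c : ℝ) ^ 2 := Finset.sum_nonneg fun _ _ => sq_nonneg _
  linarith

theorem propagator_pos (n : Momentum) : 0 < propagator n :=
  one_div_pos.2 (one_add_sum_sq_pos n)

theorem propagator_le_one (n : Momentum) : propagator n ≤ 1 := by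
  have h0 : 0 ≤ ∑ c, (n c : ℝ) ^ 2 := Finset.sum_nonneg fun _ _ => sq_nonneg _
  exact (div_le_one (one_add_sum_sq_pos n)).2 (by linarith)

theorem mem_momenta_iff {M j : ℕ} {n : Momentum} :
    n ∈ momenta M j ↔ 1 ≤ ((M : ℝ) ^ j) ^ 2 * propagator n := by
  rw [mem_momenta, propagator, mul_one_div, one_le_div (one_add_sum_sq_pos n), ← pow_mul,
    mul_comm j 2, add_comm]
  exact_mod_cast Iff.rfl

theorem momenta_mono {M : ℕ} (hM : 1 < M) {i j : ℕ} (h : i ≤ j) : momenta M i ⊆ momenta M j := by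
  intro n hn
  rw [mem_momenta] at hn ⊢
  exact hn.trans (pow_le_pow_right₀ (by exact_mod_cast hM.le) (by omega))

theorem apply_mem_Icc {M j : ℕ} {n : Momentum} (h : n ∈ momenta M j) (c : Fin 4) :
    n c ∈ Finset.Icc (-(M : ℤ) ^ j) ((M : ℤ) ^ j) :=
  Fintype.mem_piFinset.1 (Finset.mem_of_mem_filter n h) c

theorem card_Icc_le {M : ℕ} (hM : 1 < M) (j : ℕ) :
    ((Finset.Icc (-(M : ℤ) ^ j) ((M : ℤ) ^ j)).card : ℝ) ≤ 3 * (M : ℝ) ^ j := by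
  have h1 : (1 : ℝ) ≤ (M : ℝ) ^ j := one_le_pow₀ (by exact_mod_cast hM.le)
  have h2 : ((Finset.Icc (-(M : ℤ) ^ j) ((M : ℤ) ^ j)).card : ℤ) = 2 * (M : ℤ) ^ j + 1 := by
    rw [Int.card_Icc, Int.toNat_of_nonneg]
    · ring
    · have : (0 : ℤ) ≤ (M : ℤ) ^ j := by positivity
      linarith
  have h3 : ((Finset.Icc (-(M : ℤ) ^ j) ((M : ℤ) ^ j)).card : ℝ) = 2 * (M : ℝ) ^ j + 1 := by
    exact_mod_cast h2
  linarith

theorem card_momenta_le {M : ℕ} (hM : 1 < M) (j : ℕ) :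
    ((momenta M j).card : ℝ) ≤ 81 * ((M : ℝ) ^ j) ^ 4 := by
  have h1 : (momenta M j).card ≤ (Finset.Icc (-(M : ℤ) ^ j) ((M : ℤ) ^ j)).card ^ 4 := by
    refine (Finset.card_filter_le _ _).trans ?_
    rw [Fintype.card_piFinset_const]
  calc ((momenta M j).card : ℝ) ≤ ((Finset.Icc (-(M : ℤ) ^ j) ((M : ℤ) ^ j)).card : ℝ) ^ 4 := by
        exact_mod_cast h1
    _ ≤ (3 * (M : ℝ) ^ j) ^ 4 := pow_le_pow_left₀ (Nat.cast_nonneg _) (card_Icc_le hM j) 4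
    _ = _ := by ring

theorem card_momenta_fiber_le {M : ℕ} (hM : 1 < M) (j : ℕ) (c : Fin 4) (l : ℤ) :
    (((momenta M j).filter fun n => n c = l).card : ℝ) ≤ 27 * ((M : ℝ) ^ j) ^ 3 := by
  have h1 : ((momenta M j).filter fun n => n c = l).card
      ≤ (Finset.Icc (-(M : ℤ) ^ j) ((M : ℤ) ^ j)).card ^ 3 := by
    rw [← Fintype.card_piFinset_const]
    refine Finset.card_le_card_of_injOn (fun n => c.removeNth n) ?_ ?_
    · intro n hn
      rw [Finset.mem_coe, Finset.mem_filter] at hn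
      rw [Finset.mem_coe, Fintype.mem_piFinset]
      exact fun i => apply_mem_Icc hn.1 _
    · intro n hn m hm h
      rw [Finset.mem_coe, Finset.mem_filter] at hn hm
      rw [← Fin.insertNth_self_removeNth c n, ← Fin.insertNth_self_removeNth c m, hn.2, hm.2]
      exact congrArg _ h
  calc _ ≤ ((Finset.Icc (-(M : ℤ) ^ j) ((M : ℤ) ^ j)).card : ℝ) ^ 3 := by
        exact_mod_cast h1
    _ ≤ (3 * (M : ℝ) ^ j) ^ 3 := pow_le_pow_left₀ (Nat.cast_nonneg _) (card_Icc_le hM j) 3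
    _ = _ := by ring

/-- Induction step over the scales. The new shell is overcounted by all momenta below the new
cutoff, which costs only a constant because cutoffs grow geometrically. -/
theorem sum_momenta_succ_le {M : ℕ} (hM : 1 < M) (p : Momentum → Prop) [DecidablePred p]
    {g : Momentum → ℝ} {κ G : ℝ} {d e j : ℕ} (hG : 0 ≤ G)
    (hcard : (((momenta M (j + 1)).filter p).card : ℝ) ≤ κ * ((M : ℝ) ^ (j + 1)) ^ d)
    (hg : ∀ n, n ∉ momenta M j → g n * ((M : ℝ) ^ j) ^ e ≤ G) :
    ∑ n ∈ (momenta M (j + 1)).filter p, g n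
      ≤ ∑ n ∈ (momenta M j).filter p, g n
        + κ * ((M : ℝ) ^ (j + 1)) ^ d * (G / ((M : ℝ) ^ j) ^ e) := by
  have hM0 : (0 : ℝ) < M := by exact_mod_cast (by omega : 0 < M)
  have hsub := Finset.filter_subset_filter p (momenta_mono hM (Nat.le_succ j))
  rw [← Finset.sum_sdiff hsub, add_comm]
  refine add_le_add_right ?_ _
  calc _ ≤ ∑ n ∈ (momenta M (j + 1)).filter p \ (momenta M j).filter p,
        (G / ((M : ℝ) ^ j) ^ e) := by
        refine Finset.sum_le_sum fun n hn => ?_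
        rw [Finset.mem_sdiff, Finset.mem_filter, Finset.mem_filter] at hn
        rw [le_div_iff₀ (by positivity)]
        exact hg n fun h => hn.2 ⟨h, hn.1.2⟩
    _ = (((momenta M (j + 1)).filter p \ (momenta M j).filter p).card : ℝ)
        * (G / ((M : ℝ) ^ j) ^ e) := by rw [Finset.sum_const, nsmul_eq_mul]
    _ ≤ _ := by
        refine mul_le_mul_of_nonneg_right (le_trans ?_ hcard) (by positivity)
        exact_mod_cast Finset.card_le_card Finset.sdiff_subset

/-- Power counting with one dimension in excess: shell `j` contributes a multiple of M^j, and as M ≥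
2 the geometric sum is controlled by its last term. -/
theorem sum_momenta_le_mul_pow {M : ℕ} (hM : 1 < M) (p : Momentum → Prop) [DecidablePred p]
    {g : Momentum → ℝ} {κ : ℝ} {e : ℕ} (hκ : 0 ≤ κ) (hg1 : ∀ n, g n ≤ 1)
    (hcard : ∀ j, (((momenta M j).filter p).card : ℝ) ≤ κ * ((M : ℝ) ^ j) ^ (e + 1))
    (hg : ∀ j n, n ∉ momenta M j → g n * ((M : ℝ) ^ j) ^ e ≤ 1) (j : ℕ) :
    ∑ n ∈ (momenta M j).filter p, g n ≤ κ * (1 + (M : ℝ) ^ (e + 1)) * (M : ℝ) ^ j := by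
  have hM2 : (2 : ℝ) ≤ M := by exact_mod_cast hM
  have hM0 : (0 : ℝ) < M := by linarith
  induction j with
  | zero =>
    have h1 := hcard 0
    have h2 : ∑ n ∈ (momenta M 0).filter p, g n ≤ ((momenta M 0).filter p).card := by
      refine (Finset.sum_le_sum fun n _ => hg1 n).trans ?_
      rw [Finset.sum_const, nsmul_eq_mul, mul_one]
    have h3 : (0 : ℝ) ≤ κ * (M : ℝ) ^ (e + 1) := by positivity
    simp only [pow_zero, one_pow, mul_one] at h1 ⊢
    linarith
  | succ j ih =>
    have h1 := sum_momenta_succ_le (G := 1) hM p zero_le_one (hcard (j + 1)) (hg j)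
    have hN : (0 : ℝ) < (M : ℝ) ^ j := by positivity
    have h2 : κ * ((M : ℝ) ^ (j + 1)) ^ (e + 1) * (1 / ((M : ℝ) ^ j) ^ e)
        = κ * (M : ℝ) ^ (e + 1) * (M : ℝ) ^ j := by
      rw [pow_succ (M : ℝ) j, mul_pow, pow_succ ((M : ℝ) ^ j) e]
      field_simp
    rw [h2] at h1
    have h3 : (0 : ℝ) ≤ κ * (1 + (M : ℝ) ^ (e + 1)) * (M : ℝ) ^ j := by positivity
    have h4 : κ * (M : ℝ) ^ (e + 1) * (M : ℝ) ^ j ≤ κ * (1 + (M : ℝ) ^ (e + 1)) * (M : ℝ) ^ j := by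
      gcongr; linarith
    have h5 : κ * (1 + (M : ℝ) ^ (e + 1)) * (M : ℝ) ^ (j + 1)
        = (κ * (1 + (M : ℝ) ^ (e + 1)) * (M : ℝ) ^ j) * M := by ring
    rw [h5]
    nlinarith

/-- Marginal power counting: all shells contribute equally, whence the factor 1 + j. -/
theorem sum_momenta_le_mul_succ {M : ℕ} (hM : 1 < M) (p : Momentum → Prop) [DecidablePred p]
    {g : Momentum → ℝ} {κ : ℝ} {e : ℕ} (hκ : 0 ≤ κ) (hg1 : ∀ n, g n ≤ 1)
    (hcard : ∀ j, (((momenta M j).filter p).card : ℝ) ≤ κ * ((M : ℝ) ^ j) ^ e)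
    (hg : ∀ j n, n ∉ momenta M j → g n * ((M : ℝ) ^ j) ^ e ≤ 1) (j : ℕ) :
    ∑ n ∈ (momenta M j).filter p, g n ≤ κ * (M : ℝ) ^ e * (1 + j) := by
  have hM2 : (2 : ℝ) ≤ M := by exact_mod_cast hM
  have hM0 : (0 : ℝ) < M := by linarith
  induction j with
  | zero =>
    have h1 := hcard 0
    have h2 : ∑ n ∈ (momenta M 0).filter p, g n ≤ ((momenta M 0).filter p).card := by
      refine (Finset.sum_le_sum fun n _ => hg1 n).trans ?_
      rw [Finset.sum_const, nsmul_eq_mul, mul_one]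
    have h3 : (1 : ℝ) ≤ (M : ℝ) ^ e := one_le_pow₀ (by linarith)
    simp only [pow_zero, one_pow, mul_one, Nat.cast_zero, add_zero] at h1 ⊢
    nlinarith
  | succ j ih =>
    have h1 := sum_momenta_succ_le (G := 1) hM p zero_le_one (hcard (j + 1)) (hg j)
    have hN : (0 : ℝ) < (M : ℝ) ^ j := by positivity
    have h2 : κ * ((M : ℝ) ^ (j + 1)) ^ e * (1 / ((M : ℝ) ^ j) ^ e) = κ * (M : ℝ) ^ e := by
      rw [pow_succ (M : ℝ) j, mul_pow]
      field_simp
    rw [h2] at h1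
    push_cast
    linarith

theorem sq_mul_propagator_lt {M j : ℕ} {n : Momentum} (h : n ∉ momenta M j) :
    ((M : ℝ) ^ j) ^ 2 * propagator n < 1 := by
  rwa [mem_momenta_iff, not_le] at h

theorem mul_sqrt_propagator_le {M j : ℕ} {n : Momentum} (h : n ∉ momenta M j) :
    (M : ℝ) ^ j * √(propagator n) ≤ 1 := by
  refine abs_le_of_sq_le_sq' ?_ zero_le_one |>.2
  rw [mul_pow, Real.sq_sqrt (propagator_pos n).le, one_pow]
  exact (sq_mul_propagator_lt h).le

theorem one_le_mul_sqrt_propagator {M j : ℕ} {n : Momentum} (h : n ∈ momenta M j) :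
    1 ≤ (M : ℝ) ^ j * √(propagator n) := by
  refine abs_le_of_sq_le_sq' ?_ (by positivity) |>.2
  rw [mul_pow, Real.sq_sqrt (propagator_pos n).le, one_pow]
  exact mem_momenta_iff.1 h

/-- `C ^ (3 / 2)`. -/
def propThreeHalves (n : Momentum) : ℝ := propagator n * √(propagator n)

theorem propThreeHalves_nonneg (n : Momentum) : 0 ≤ propThreeHalves n :=
  mul_nonneg (propagator_pos n).le (Real.sqrt_nonneg _)

theorem sqrt_propagator_le_one (n : Momentum) : √(propagator n) ≤ 1 :=
  Real.sqrt_le_one.2 (propagator_le_one n)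

theorem sum_propThreeHalves_le {M : ℕ} (hM : 1 < M) (j : ℕ) :
    ∑ n ∈ momenta M j, propThreeHalves n ≤ 81 * (1 + (M : ℝ) ^ 4) * (M : ℝ) ^ j := by
  have := sum_momenta_le_mul_pow hM (fun _ => True) (g := propThreeHalves) (κ := 81) (e := 3)
    (by norm_num) (fun n => mul_le_one₀ (propagator_le_one n) (Real.sqrt_nonneg _)
      (sqrt_propagator_le_one n))
    (fun j => by simpa using card_momenta_le hM j) (fun j n hn => ?_) j
  · simpa using this
  · have h1 := (sq_mul_propagator_lt hn).le
    have h2 := mul_sqrt_propagator_le hn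
    calc _ = (((M : ℝ) ^ j) ^ 2 * propagator n) * ((M : ℝ) ^ j * √(propagator n)) := by
          unfold propThreeHalves; ring
      _ ≤ 1 := mul_le_one₀ h1 (by positivity) h2

theorem sum_propagator_sq_le {M : ℕ} (hM : 1 < M) (j : ℕ) :
    ∑ n ∈ momenta M j, propagator n ^ 2 ≤ 81 * (M : ℝ) ^ 4 * (1 + j) := by
  have := sum_momenta_le_mul_succ hM (fun _ => True) (g := fun n => propagator n ^ 2) (κ := 81)
    (e := 4) (by norm_num) (fun n => pow_le_one₀ (propagator_pos n).le (propagator_le_one n))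
    (fun j => by simpa using card_momenta_le hM j) (fun j n hn => ?_) j
  · simpa using this
  · have h1 := (sq_mul_propagator_lt hn).le
    have h0 := propagator_pos n
    calc _ = (((M : ℝ) ^ j) ^ 2 * propagator n) ^ 2 := by ring
      _ ≤ 1 := pow_le_one₀ (by positivity) h1

theorem sum_fiber_propagator_le {M : ℕ} (hM : 1 < M) (j : ℕ) (c : Fin 4) (l : ℤ) :
    ∑ n ∈ (momenta M j).filter (fun n => n c = l), propagator n
      ≤ 27 * (1 + (M : ℝ) ^ 3) * (M : ℝ) ^ j := by
  refine sum_momenta_le_mul_pow hM (fun n => n c = l) (g := propagator) (κ := 27) (e := 2)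
    (by norm_num) propagator_le_one (fun j => card_momenta_fiber_le hM j c l) (fun j n hn => ?_) j
  rw [mul_comm]
  exact (sq_mul_propagator_lt hn).le

/-- With one colour fixed, C² is summable over the three remaining ones, uniformly in the cutoff. -/
theorem sum_fiber_propagator_sq_le (F : Finset Momentum) (c : Fin 4) (l : ℤ) :
    ∑ n ∈ F.filter (fun n => n c = l), propagator n ^ 2 ≤ 512 := by
  rw [← ENNReal.ofReal_le_ofReal_iff (by norm_num),
    ENNReal.ofReal_sum_of_nonneg (fun n _ => sq_nonneg _)]
  have h1 : ∑ n ∈ F.filter (fun n => n c = l), ENNReal.ofReal (propagator n ^ 2)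
      = ∑ p ∈ (F.filter (fun n => n c = l)).image (fun n => c.removeNth n),
        ENNReal.ofReal ((invProp l p)⁻¹ ^ 2) := by
    rw [Finset.sum_image]
    · refine Finset.sum_congr rfl fun n hn => ?_
      rw [← propagator_insertNth c, ← (Finset.mem_filter.1 hn).2, Fin.insertNth_self_removeNth]
    · intro n hn m hm h
      rw [Finset.mem_coe, Finset.mem_filter] at hn hm
      rw [← Fin.insertNth_self_removeNth c n, ← Fin.insertNth_self_removeNth c m, hn.2, hm.2]
      exact congrArg _ h
  rw [h1]
  refine (ENNReal.sum_le_tsum _).trans ((tsum_invProp_sq_inv_le l).trans ?_)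
  refine ENNReal.ofReal_le_ofReal (div_le_self (by norm_num) ?_)
  exact Real.one_le_sqrt.2 (by nlinarith [sq_nonneg (l : ℝ)])

/-- Two momenta agree away from the colour `c`. -/
def AgreeOff (c : Fin 4) (m n : Momentum) : Prop := ∀ c', c' ≠ c → m c' = n c'

instance (c : Fin 4) (m n : Momentum) : Decidable (AgreeOff c m n) :=
  inferInstanceAs (Decidable (∀ c', c' ≠ c → m c' = n c'))

theorem AgreeOff.symm {c : Fin 4} {m n : Momentum} (h : AgreeOff c m n) : AgreeOff c n m :=
  fun c' hc => (h c' hc).symm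

theorem AgreeOff.eq_of_apply_eq {c : Fin 4} {m m' n : Momentum} (h : AgreeOff c m n)
    (h' : AgreeOff c m' n) (hc : m c = m' c) : m = m' := by
  funext c'
  by_cases e : c' = c
  · rw [e, hc]
  · rw [h c' e, h' c' e]

theorem sum_agree_propagator_le (F : Finset Momentum) (c : Fin 4) (m : Momentum) :
    ∑ n ∈ F.filter (fun n => AgreeOff c m n), propagator n ≤ 8 := by
  rw [← ENNReal.ofReal_le_ofReal_iff (by norm_num),
    ENNReal.ofReal_sum_of_nonneg (fun n _ => (propagator_pos n).le)]
  have h1 : ∑ n ∈ F.filter (fun n => AgreeOff c m n), ENNReal.ofReal (propagator n)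
      ≤ ∑ x ∈ (F.filter (fun n => AgreeOff c m n)).image (fun n : Momentum => (n c : ℤ)),
        ENNReal.ofReal (1 / ((x : ℝ) ^ 2 + 1)) := by
    rw [Finset.sum_image]
    · refine Finset.sum_le_sum fun n hn => ENNReal.ofReal_le_ofReal ?_
      refine one_div_le_one_div_of_le (by positivity) (add_le_add_left ?_ _)
      exact Finset.single_le_sum (f := fun c => (n c : ℝ) ^ 2) (fun i _ => sq_nonneg _)
        (Finset.mem_univ c)
    · intro n hn n' hn' h
      rw [Finset.mem_coe, Finset.mem_filter] at hn hn'
      exact hn.2.symm.eq_of_apply_eq hn'.2.symm h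
  refine h1.trans ((ENNReal.sum_le_tsum _).trans ((tsum_int_inv_sq_add_le le_rfl).trans ?_))
  simp

end Momenta

end TensorT44
end

noncomputable section

namespace TensorT44

open MeasureTheory ProbabilityTheory Complex

/-! ### Weights of quadratic forms in the field: traces and coefficients. -/

section Weights

/-- The trace of the quadratic form with weight `w`. -/
def wTrace (F : Finset Momentum) (w : Momentum → Momentum → ℝ) : ℝ :=
  ∑ c, ∑ m ∈ F, ∑ n ∈ F, if AgreeOff c m n then w m n else 0

/-- The coefficient of `|(σ_c)_{kl}|²` in the quadratic form with weight `w`. -/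
def wCoeff (F : Finset Momentum) (w : Momentum → Momentum → ℝ) (c : Fin 4) (k l : ℤ) : ℝ :=
  ∑ m ∈ F, ∑ n ∈ F, if AgreeOff c m n ∧ m c = k ∧ n c = l then w m n else 0

theorem wTrace_add (F : Finset Momentum) (v w : Momentum → Momentum → ℝ) :
    wTrace F (fun m n => v m n + w m n) = wTrace F v + wTrace F w := by
  simp only [wTrace, ← Finset.sum_add_distrib]
  refine Finset.sum_congr rfl fun c _ => Finset.sum_congr rfl fun m _ =>
    Finset.sum_congr rfl fun n _ => ?_
  split_ifs <;> simp

theorem wTrace_mul (F : Finset Momentum) (a : ℝ) (w : Momentum → Momentum → ℝ) :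
    wTrace F (fun m n => a * w m n) = a * wTrace F w := by
  simp only [wTrace, Finset.mul_sum, mul_ite, mul_zero]

theorem wCoeff_add (F : Finset Momentum) (v w : Momentum → Momentum → ℝ) (c : Fin 4) (k l : ℤ) :
    wCoeff F (fun m n => v m n + w m n) c k l = wCoeff F v c k l + wCoeff F w c k l := by
  simp only [wCoeff, ← Finset.sum_add_distrib]
  refine Finset.sum_congr rfl fun m _ => Finset.sum_congr rfl fun n _ => ?_
  split_ifs <;> simp

theorem wCoeff_mul (F : Finset Momentum) (a : ℝ) (w : Momentum → Momentum → ℝ) (c : Fin 4)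
    (k l : ℤ) : wCoeff F (fun m n => a * w m n) c k l = a * wCoeff F w c k l := by
  simp only [wCoeff, Finset.mul_sum, mul_ite, mul_zero]

/-- Once `n` and the colour are fixed, `m` is determined by a single integer, with at most 3 M^J
values; the four colours give 12. -/
theorem wTrace_le {M : ℕ} (hM : 1 < M) (J : ℕ) {w : Momentum → Momentum → ℝ} {g : Momentum → ℝ}
    (hg : ∀ n ∈ momenta M J, 0 ≤ g n)
    (hw : ∀ m ∈ momenta M J, ∀ n ∈ momenta M J, w m n ≤ g n) :
    wTrace (momenta M J) w ≤ 12 * (M : ℝ) ^ J * ∑ n ∈ momenta M J, g n := by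
  have h : ∀ c : Fin 4, ∑ m ∈ momenta M J, ∑ n ∈ momenta M J,
      (if AgreeOff c m n then w m n else 0) ≤ 3 * (M : ℝ) ^ J * ∑ n ∈ momenta M J, g n := by
    intro c
    rw [Finset.sum_comm, Finset.mul_sum]
    refine Finset.sum_le_sum fun n hn => ?_
    rw [← Finset.sum_filter]
    calc _ ≤ ∑ m ∈ (momenta M J).filter (fun m => AgreeOff c m n), g n :=
          Finset.sum_le_sum fun m hm => hw m (Finset.mem_filter.1 hm).1 n hn
      _ = (((momenta M J).filter (fun m => AgreeOff c m n)).card : ℝ) * g n := by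
          rw [Finset.sum_const, nsmul_eq_mul]
      _ ≤ _ := by
          refine mul_le_mul_of_nonneg_right (le_trans ?_ (card_Icc_le hM J)) (hg n hn)
          refine Nat.cast_le.2 (Finset.card_le_card_of_injOn (fun m => m c) ?_ ?_)
          · intro m hm
            exact apply_mem_Icc (Finset.mem_filter.1 hm).1 c
          · intro m hm m' hm' e
            rw [Finset.mem_coe, Finset.mem_filter] at hm hm'
            exact hm.2.eq_of_apply_eq hm'.2 e
  refine (Finset.sum_le_sum fun c _ => h c).trans (le_of_eq ?_)
  rw [Finset.sum_const, Finset.card_univ, Fintype.card_fin, nsmul_eq_mul]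
  push_cast; ring

/-- Once `n`, the colour and `k` are fixed, at most one `m` is left, so the coefficient is a sum
over `n` in a fibre. -/
theorem wCoeff_le {F : Finset Momentum} {w : Momentum → Momentum → ℝ} {g : Momentum → ℝ}
    (hg : ∀ n ∈ F, 0 ≤ g n) (hw : ∀ m ∈ F, ∀ n ∈ F, w m n ≤ g n) (c : Fin 4) (k l : ℤ) :
    wCoeff F w c k l ≤ ∑ n ∈ F.filter (fun n => n c = l), g n := by
  rw [wCoeff, Finset.sum_comm, Finset.sum_filter]
  refine Finset.sum_le_sum fun n hn => ?_
  by_cases hl : n c = l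
  · rw [if_pos hl]
    rw [← Finset.sum_filter]
    calc _ ≤ ∑ m ∈ F.filter (fun m => AgreeOff c m n ∧ m c = k ∧ n c = l), g n :=
          Finset.sum_le_sum fun m hm => hw m (Finset.mem_filter.1 hm).1 n hn
      _ = ((F.filter (fun m => AgreeOff c m n ∧ m c = k ∧ n c = l)).card : ℝ) * g n := by
          rw [Finset.sum_const, nsmul_eq_mul]
      _ ≤ 1 * g n := by
          refine mul_le_mul_of_nonneg_right ?_ (hg n hn)
          rw [← Nat.cast_one, Nat.cast_le, Finset.card_le_one]
          intro m hm m' hm'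
          rw [Finset.mem_filter] at hm hm'
          exact hm.2.1.eq_of_apply_eq hm'.2.1 (hm.2.2.1.trans hm'.2.2.1.symm)
      _ = g n := one_mul _
  · rw [if_neg hl]
    refine (Finset.sum_eq_zero fun m _ => ?_).le
    rw [if_neg fun h => hl h.2.2]

/-- The momenta below the slice `J`; there are none if `J ≤ 1`, as the interaction with cutoff
`≤ 0` is zero. -/
def prevMomenta (M J : ℕ) : Finset Momentum := if J ≤ 1 then ∅ else momenta M (J - 1)

/-- The momenta of the slice `J`, seen as a property of momenta below the cutoff `J`. -/
def InSlice (M J : ℕ) (n : Momentum) : Prop := n ∉ prevMomenta M J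

instance (M J : ℕ) (n : Momentum) : Decidable (InSlice M J n) :=
  inferInstanceAs (Decidable (n ∉ prevMomenta M J))

theorem prevMomenta_subset {M : ℕ} (hM : 1 < M) (J : ℕ) : prevMomenta M J ⊆ momenta M J := by
  unfold prevMomenta
  split_ifs
  · exact Finset.empty_subset _
  · exact momenta_mono hM (Nat.sub_le J 1)

theorem sq_mul_propagator_le_of_inSlice {M J : ℕ} (hM : 1 < M) {n : Momentum}
    (h : InSlice M J n) : ((M : ℝ) ^ J) ^ 2 * propagator n ≤ (M : ℝ) ^ 2 := by
  have hM1 : (1 : ℝ) ≤ M := by exact_mod_cast hM.le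
  have h0 := propagator_pos n
  unfold InSlice prevMomenta at h
  -- For J ≤ 1 all momenta belong to the slice; then M^J ≤ M and C ≤ 1 suffice.
  split_ifs at h with hJ
  · calc _ ≤ ((M : ℝ) ^ 1) ^ 2 * 1 := by
          gcongr
          exact propagator_le_one n
      _ = _ := by ring
  have h1 := (sq_mul_propagator_lt h).le
  have h2 : (M : ℝ) ^ J ≤ M * (M : ℝ) ^ (J - 1) := by
    rw [← pow_succ']
    exact pow_le_pow_right₀ hM1 (by omega)
  calc _ ≤ (M * (M : ℝ) ^ (J - 1)) ^ 2 * propagator n := by gcongr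
    _ = (M : ℝ) ^ 2 * (((M : ℝ) ^ (J - 1)) ^ 2 * propagator n) := by ring
    _ ≤ (M : ℝ) ^ 2 * 1 := by gcongr
    _ = _ := mul_one _

theorem mul_sqrt_propagator_le_of_inSlice {M J : ℕ} (hM : 1 < M) {n : Momentum}
    (h : InSlice M J n) : (M : ℝ) ^ J * √(propagator n) ≤ M := by
  refine abs_le_of_sq_le_sq' ?_ (Nat.cast_nonneg M) |>.2
  rw [mul_pow, Real.sq_sqrt (propagator_pos n).le]
  exact sq_mul_propagator_le_of_inSlice hM h

/-- Weight of the diagonal matrix elements in the slice. -/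
def wDiag (M J : ℕ) (m n : Momentum) : ℝ :=
  if m = n ∧ InSlice M J m then (((M : ℝ) ^ J) ^ 4)⁻¹ else 0

/-- Weight `C(m) C(n) (C(m)^{1/2} + C(n)^{1/2})`, with `m` in the slice. -/
def wHalf (M J : ℕ) (m n : Momentum) : ℝ :=
  if InSlice M J m then propagator m * propagator n * (√(propagator m) + √(propagator n)) else 0

/-- Weight `C(m) C(n)`, with `m` in the slice. -/
def wOne (M J : ℕ) (m n : Momentum) : ℝ :=
  if InSlice M J m then propagator m * propagator n else 0

/-- Weight `C(m) C(n)²`, with `m` in the slice. -/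
def wTwo (M J : ℕ) (m n : Momentum) : ℝ :=
  if InSlice M J m then propagator m * propagator n ^ 2 else 0

/-- Weight `C(m) C(n)`, with `m` of moderate size. -/
def wLow (K : ℝ) (m n : Momentum) : ℝ :=
  if 1 ≤ K * propagator m then propagator m * propagator n else 0

theorem propagator_le_of_inSlice {M J : ℕ} (hM : 1 < M) {n : Momentum}
    (h : InSlice M J n) : propagator n ≤ (M : ℝ) ^ 2 / ((M : ℝ) ^ J) ^ 2 := by
  have hM0 : (0 : ℝ) < M := by exact_mod_cast (by omega : 0 < M)
  rw [le_div_iff₀ (by positivity), mul_comm]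
  exact sq_mul_propagator_le_of_inSlice hM h

theorem propThreeHalves_le {M J : ℕ} {n : Momentum} (h : n ∈ momenta M J) :
    propThreeHalves n ≤ (M : ℝ) ^ J * propagator n ^ 2 := by
  have h0 := propagator_pos n
  have h1 := one_le_mul_sqrt_propagator h
  have h2 := Real.sq_sqrt h0.le
  have h3 := Real.sqrt_nonneg (propagator n)
  unfold propThreeHalves
  calc propagator n * √(propagator n) ≤ propagator n * √(propagator n) * ((M : ℝ) ^ J * √(propagator n)) :=
        le_mul_of_one_le_right (by positivity) h1
    _ = (M : ℝ) ^ J * propagator n * √(propagator n) ^ 2 := by ring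
    _ = _ := by rw [h2]; ring

theorem propagator_le_mul_threeHalves {M J : ℕ} {n : Momentum} (h : n ∈ momenta M J) :
    propagator n ≤ (M : ℝ) ^ J * propThreeHalves n := by
  have h0 := propagator_pos n
  calc propagator n ≤ propagator n * ((M : ℝ) ^ J * √(propagator n)) :=
        le_mul_of_one_le_right h0.le (one_le_mul_sqrt_propagator h)
    _ = _ := by unfold propThreeHalves; ring

variable {M : ℕ} (hM : 1 < M) (J : ℕ)

/-- Below the cutoff 1 ≤ N C(n)^{1/2}, and in the slice N C(m)^{1/2} ≤ M; therefore C(n) C(m)^{1/2}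
≤ M C(n)^{3/2}. -/
theorem wHalf_le {m n : Momentum} (hM : 1 < M) (hn : n ∈ momenta M J) :
    wHalf M J m n ≤ ((M : ℝ) ^ 2 / ((M : ℝ) ^ J) ^ 2 * (1 + M)) * propThreeHalves n := by
  have hM0 : (0 : ℝ) < M := by exact_mod_cast (by omega : 0 < M)
  have hN : (0 : ℝ) < (M : ℝ) ^ J := by positivity
  have hh := propThreeHalves_nonneg n
  unfold wHalf
  split_ifs with h
  · have h0 := propagator_pos n
    have h0' := propagator_pos m
    have h1 := propagator_le_of_inSlice hM h
    have h2 : propagator n * √(propagator m) ≤ M * propThreeHalves n := by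
      have h3 := mul_sqrt_propagator_le_of_inSlice hM h
      calc _ ≤ ((M : ℝ) ^ J * propThreeHalves n) * √(propagator m) := by
            gcongr; exact propagator_le_mul_threeHalves hn
        _ = ((M : ℝ) ^ J * √(propagator m)) * propThreeHalves n := by ring
        _ ≤ _ := by gcongr
    calc _ = propagator m * (propagator n * √(propagator m) + propThreeHalves n) := by
          unfold propThreeHalves; ring
      _ ≤ ((M : ℝ) ^ 2 / ((M : ℝ) ^ J) ^ 2) * (M * propThreeHalves n + propThreeHalves n) := by
          gcongr
      _ = _ := by ring
  · positivity

theorem wOne_le {m n : Momentum} (hM : 1 < M) :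
    wOne M J m n ≤ ((M : ℝ) ^ 2 / ((M : ℝ) ^ J) ^ 2) * propagator n := by
  have h0 := propagator_pos n
  unfold wOne
  split_ifs with h
  · exact mul_le_mul_of_nonneg_right (propagator_le_of_inSlice hM h) h0.le
  · positivity

theorem wTwo_le {m n : Momentum} (hM : 1 < M) :
    wTwo M J m n ≤ ((M : ℝ) ^ 2 / ((M : ℝ) ^ J) ^ 2) * propagator n ^ 2 := by
  have h0 := propagator_pos n
  unfold wTwo
  split_ifs with h
  · exact mul_le_mul_of_nonneg_right (propagator_le_of_inSlice hM h) (by positivity)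
  · positivity

/-- Power counting: N for the free colour of `m`, N⁻² from C(m) in the slice, N from the sum of
C^{3/2}. The trace is bounded uniformly in the scale. -/
theorem wTrace_half_le (hM : 1 < M) : wTrace (momenta M J) (wHalf M J)
    ≤ 972 * (M : ℝ) ^ 2 * (1 + M) * (1 + (M : ℝ) ^ 4) := by
  have hM0 : (0 : ℝ) < M := by exact_mod_cast (by omega : 0 < M)
  have hN : (0 : ℝ) < (M : ℝ) ^ J := by positivity
  refine (wTrace_le hM J (g := fun n => ((M : ℝ) ^ 2 / ((M : ℝ) ^ J) ^ 2 * (1 + M))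
    * propThreeHalves n) (fun n _ => ?_) (fun m _ n hn => wHalf_le J hM hn)).trans ?_
  · have := propThreeHalves_nonneg n
    positivity
  rw [← Finset.mul_sum]
  calc _ ≤ 12 * (M : ℝ) ^ J * (((M : ℝ) ^ 2 / ((M : ℝ) ^ J) ^ 2 * (1 + M))
        * (81 * (1 + (M : ℝ) ^ 4) * (M : ℝ) ^ J)) := by
        gcongr; exact sum_propThreeHalves_le hM J
    _ = _ := by field_simp; ring

theorem wCoeff_half_le (hM : 1 < M) (c : Fin 4) (k l : ℤ) :
    wCoeff (momenta M J) (wHalf M J) c k l ≤ 512 * (M : ℝ) ^ 2 * (1 + M) * ((M : ℝ) ^ J)⁻¹ := by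
  have hM0 : (0 : ℝ) < M := by exact_mod_cast (by omega : 0 < M)
  have hN : (0 : ℝ) < (M : ℝ) ^ J := by positivity
  refine (wCoeff_le (g := fun n => ((M : ℝ) ^ 2 * (1 + M) * ((M : ℝ) ^ J)⁻¹) * propagator n ^ 2)
    (fun n _ => by positivity) (fun m _ n hn => (wHalf_le J hM hn).trans ?_) c k l).trans ?_
  · calc _ ≤ ((M : ℝ) ^ 2 / ((M : ℝ) ^ J) ^ 2 * (1 + M)) * ((M : ℝ) ^ J * propagator n ^ 2) := by
          gcongr; exact propThreeHalves_le hn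
      _ = _ := by field_simp
  rw [← Finset.mul_sum]
  calc _ ≤ ((M : ℝ) ^ 2 * (1 + M) * ((M : ℝ) ^ J)⁻¹) * 512 := by
        gcongr; exact sum_fiber_propagator_sq_le _ c l
    _ = _ := by ring

theorem wTrace_one_le (hM : 1 < M) : wTrace (momenta M J) (wOne M J)
    ≤ 972 * (M : ℝ) ^ 2 * (1 + (M : ℝ) ^ 4) * (M : ℝ) ^ J := by
  have hM0 : (0 : ℝ) < M := by exact_mod_cast (by omega : 0 < M)
  have hN : (0 : ℝ) < (M : ℝ) ^ J := by positivity
  refine (wTrace_le hM J (g := fun n => ((M : ℝ) ^ 2 / ((M : ℝ) ^ J) ^ 2)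
    * ((M : ℝ) ^ J * propThreeHalves n)) (fun n _ => ?_)
      (fun m _ n hn => (wOne_le J hM).trans ?_)).trans ?_
  · have := propThreeHalves_nonneg n
    positivity
  · gcongr; exact propagator_le_mul_threeHalves hn
  rw [← Finset.mul_sum, ← Finset.mul_sum]
  calc _ ≤ 12 * (M : ℝ) ^ J * (((M : ℝ) ^ 2 / ((M : ℝ) ^ J) ^ 2)
        * ((M : ℝ) ^ J * (81 * (1 + (M : ℝ) ^ 4) * (M : ℝ) ^ J))) := by
        gcongr; exact sum_propThreeHalves_le hM J
    _ = _ := by field_simp; ring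

theorem wCoeff_one_le (hM : 1 < M) (c : Fin 4) (k l : ℤ) :
    wCoeff (momenta M J) (wOne M J) c k l
      ≤ 27 * (M : ℝ) ^ 2 * (1 + (M : ℝ) ^ 3) * ((M : ℝ) ^ J)⁻¹ := by
  have hM0 : (0 : ℝ) < M := by exact_mod_cast (by omega : 0 < M)
  have hN : (0 : ℝ) < (M : ℝ) ^ J := by positivity
  refine (wCoeff_le (g := fun n => ((M : ℝ) ^ 2 / ((M : ℝ) ^ J) ^ 2) * propagator n)
    (fun n _ => mul_nonneg (by positivity) (propagator_pos n).le)
    (fun m _ n hn => wOne_le J hM) c k l).trans ?_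
  rw [← Finset.mul_sum]
  calc _ ≤ ((M : ℝ) ^ 2 / ((M : ℝ) ^ J) ^ 2) * (27 * (1 + (M : ℝ) ^ 3) * (M : ℝ) ^ J) := by
        gcongr; exact sum_fiber_propagator_le hM J c l
    _ = _ := by field_simp

theorem wTrace_two_le (hM : 1 < M) : wTrace (momenta M J) (wTwo M J)
    ≤ 972 * (M : ℝ) ^ 6 * (1 + J) * ((M : ℝ) ^ J)⁻¹ := by
  have hM0 : (0 : ℝ) < M := by exact_mod_cast (by omega : 0 < M)
  have hN : (0 : ℝ) < (M : ℝ) ^ J := by positivity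
  refine (wTrace_le hM J (g := fun n => ((M : ℝ) ^ 2 / ((M : ℝ) ^ J) ^ 2)
    * propagator n ^ 2) (fun n _ => by positivity) (fun m _ n hn => wTwo_le J hM)).trans ?_
  rw [← Finset.mul_sum]
  calc _ ≤ 12 * (M : ℝ) ^ J * (((M : ℝ) ^ 2 / ((M : ℝ) ^ J) ^ 2)
        * (81 * (M : ℝ) ^ 4 * (1 + J))) := by
        gcongr; exact sum_propagator_sq_le hM J
    _ = _ := by field_simp; ring

theorem wCoeff_two_le (hM : 1 < M) (c : Fin 4) (k l : ℤ) :
    wCoeff (momenta M J) (wTwo M J) c k l ≤ 512 * (M : ℝ) ^ 2 * (((M : ℝ) ^ J) ^ 2)⁻¹ := by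
  have hM0 : (0 : ℝ) < M := by exact_mod_cast (by omega : 0 < M)
  have hN : (0 : ℝ) < (M : ℝ) ^ J := by positivity
  refine (wCoeff_le (g := fun n => ((M : ℝ) ^ 2 / ((M : ℝ) ^ J) ^ 2) * propagator n ^ 2)
    (fun n _ => by positivity) (fun m _ n hn => wTwo_le J hM) c k l).trans ?_
  rw [← Finset.mul_sum]
  calc _ ≤ ((M : ℝ) ^ 2 / ((M : ℝ) ^ J) ^ 2) * 512 := by
        gcongr; exact sum_fiber_propagator_sq_le _ c l
    _ = _ := by field_simp

/-- There is no slice here. The sum over `n` along one colour converges, and C(m) ≤ K C(m)² for the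
momenta kept makes the sum over `m` only logarithmic in the cutoff. -/
theorem wTrace_low_le (hM : 1 < M) {K : ℝ} (hK : 0 ≤ K) : wTrace (momenta M J) (wLow K)
    ≤ 2592 * (M : ℝ) ^ 4 * (1 + J) * K := by
  have h : ∀ c : Fin 4, ∑ m ∈ momenta M J, ∑ n ∈ momenta M J,
      (if AgreeOff c m n then wLow K m n else 0)
      ≤ 8 * (K * ∑ m ∈ momenta M J, propagator m ^ 2) := by
    intro c
    rw [Finset.mul_sum, Finset.mul_sum]
    refine Finset.sum_le_sum fun m hm => ?_
    have h0 := propagator_pos m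
    rw [← Finset.sum_filter]
    unfold wLow
    split_ifs with hm
    · rw [← Finset.mul_sum]
      calc _ ≤ (propagator m * (K * propagator m)) * 8 := by
            refine mul_le_mul (le_mul_of_one_le_right h0.le hm) (sum_agree_propagator_le _ c m)
              (Finset.sum_nonneg fun n _ => (propagator_pos n).le) (by positivity)
        _ = _ := by ring
    · rw [Finset.sum_const_zero]; positivity
  refine (Finset.sum_le_sum fun c _ => h c).trans ?_
  rw [Finset.sum_const, Finset.card_univ, Fintype.card_fin, nsmul_eq_mul]
  calc _ ≤ ((4 : ℕ) : ℝ) * (8 * (K * (81 * (M : ℝ) ^ 4 * (1 + J)))) := by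
        gcongr; exact sum_propagator_sq_le hM J
    _ = _ := by push_cast; ring

/-- C(m)C(n) is replaced by half the sum of the squares, and C² is summable at a fixed colour. -/
theorem wCoeff_low_le (F : Finset Momentum) (K : ℝ) (c : Fin 4) (k l : ℤ) :
    wCoeff F (wLow K) c k l ≤ 512 := by
  have h1 : wCoeff F (wLow K) c k l ≤ wCoeff F (fun m n => 1 / 2 * (propagator m ^ 2)) c k l
      + wCoeff F (fun m n => 1 / 2 * (propagator n ^ 2)) c k l := by
    rw [← wCoeff_add]
    refine Finset.sum_le_sum fun m _ => Finset.sum_le_sum fun n _ => ?_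
    split_ifs with h
    · unfold wLow
      split_ifs
      · nlinarith [sq_nonneg (propagator m - propagator n)]
      · positivity
    · exact le_rfl
  have h2 : wCoeff F (fun m n => propagator n ^ 2) c k l ≤ 512 :=
    (wCoeff_le (fun n _ => sq_nonneg _) (fun m _ n _ => le_rfl) c k l).trans
      (sum_fiber_propagator_sq_le F c l)
  have h3 : wCoeff F (fun m n => propagator m ^ 2) c k l ≤ 512 := by
    have e : wCoeff F (fun m n => propagator m ^ 2) c k l
        = wCoeff F (fun m n => propagator n ^ 2) c l k := by
      unfold wCoeff
      rw [Finset.sum_comm]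
      refine Finset.sum_congr rfl fun n _ => Finset.sum_congr rfl fun m _ => ?_
      refine if_congr ⟨fun h => ⟨h.1.symm, h.2.2, h.2.1⟩, fun h => ⟨h.1.symm, h.2.2, h.2.1⟩⟩ rfl rfl
    rw [e]
    exact (wCoeff_le (fun n _ => sq_nonneg _) (fun m _ n _ => le_rfl) c l k).trans
      (sum_fiber_propagator_sq_le F c k)
  rw [wCoeff_mul, wCoeff_mul] at h1
  linarith

theorem wTrace_diag_le (hM : 1 < M) : wTrace (momenta M J) (wDiag M J) ≤ 324 := by
  have hM0 : (0 : ℝ) < M := by exact_mod_cast (by omega : 0 < M)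
  have hN : (0 : ℝ) < (M : ℝ) ^ J := by positivity
  have h : ∀ c : Fin 4, ∑ m ∈ momenta M J, ∑ n ∈ momenta M J,
      (if AgreeOff c m n then wDiag M J m n else 0) ≤ 81 := by
    intro c
    calc _ ≤ ∑ m ∈ momenta M J, ∑ n ∈ momenta M J,
        (if m = n then (((M : ℝ) ^ J) ^ 4)⁻¹ else 0) := by
          refine Finset.sum_le_sum fun m _ => Finset.sum_le_sum fun n _ => ?_
          unfold wDiag
          have : (0 : ℝ) ≤ (((M : ℝ) ^ J) ^ 4)⁻¹ := by positivity
          split_ifs with h1 h2 h3 h3 <;> first | exact le_rfl | exact this | exact absurd h2.1 h3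
      _ = ((momenta M J).card : ℝ) * (((M : ℝ) ^ J) ^ 4)⁻¹ := by
          rw [← nsmul_eq_mul, ← Finset.sum_const]
          refine Finset.sum_congr rfl fun m hm => ?_
          rw [Finset.sum_ite_eq, if_pos hm]
      _ ≤ 81 * ((M : ℝ) ^ J) ^ 4 * (((M : ℝ) ^ J) ^ 4)⁻¹ := by
          gcongr; exact card_momenta_le hM J
      _ = 81 := by field_simp
  refine (Finset.sum_le_sum fun c _ => h c).trans (le_of_eq ?_)
  rw [Finset.sum_const, Finset.card_univ, Fintype.card_fin, nsmul_eq_mul]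
  norm_num

theorem wCoeff_diag_le (hM : 1 < M) (c : Fin 4) (k l : ℤ) :
    wCoeff (momenta M J) (wDiag M J) c k l ≤ 27 * ((M : ℝ) ^ J)⁻¹ := by
  have hM0 : (0 : ℝ) < M := by exact_mod_cast (by omega : 0 < M)
  have hN : (0 : ℝ) < (M : ℝ) ^ J := by positivity
  have h1 : (0 : ℝ) ≤ (((M : ℝ) ^ J) ^ 4)⁻¹ := by positivity
  refine (wCoeff_le (g := fun n => (((M : ℝ) ^ J) ^ 4)⁻¹) (fun n _ => h1)
    (fun m _ n hn => ?_) c k l).trans ?_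
  · unfold wDiag
    split_ifs
    exacts [le_rfl, h1]
  rw [Finset.sum_const, nsmul_eq_mul]
  calc _ ≤ 27 * ((M : ℝ) ^ J) ^ 3 * (((M : ℝ) ^ J) ^ 4)⁻¹ := by
        gcongr; exact card_momenta_fiber_le hM J c l
    _ = _ := by field_simp

end Weights

/-! ### The two combined weights and their dependence on the scale. -/

section Combined

/-- The scale `M ^ (J / 8)`. -/
def etaScale (M J : ℕ) : ℝ := (M : ℝ) ^ ((J : ℝ) / 8)

theorem etaScale_pow (M J : ℕ) : etaScale M J ^ 8 = (M : ℝ) ^ J := by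
  unfold etaScale
  rw [← Real.rpow_natCast, ← Real.rpow_mul (Nat.cast_nonneg M)]
  norm_num

theorem one_le_etaScale {M : ℕ} (hM : 1 < M) (J : ℕ) : 1 ≤ etaScale M J :=
  Real.one_le_rpow (by exact_mod_cast hM.le) (by positivity)

/-- Bernoulli's inequality for (17/16)^J, together with (17/16)⁸ ≤ 2 ≤ M. A logarithmic divergence
is thus paid by one power of η. -/
theorem one_add_le_etaScale {M : ℕ} (hM : 1 < M) (J : ℕ) :
    1 + (J : ℝ) ≤ 16 * etaScale M J := by
  have hM2 : (2 : ℝ) ≤ M := by exact_mod_cast hM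
  have h1 : (17 / 16 : ℝ) ^ J ≤ etaScale M J := by
    refine le_of_pow_le_pow_left₀ (n := 8) (by norm_num) (by linarith [one_le_etaScale hM J]) ?_
    rw [etaScale_pow, ← pow_mul, mul_comm, pow_mul]
    exact pow_le_pow_left₀ (by norm_num) ((by norm_num : (17 / 16 : ℝ) ^ 8 ≤ 2).trans hM2) J
  have h2 := one_add_mul_le_pow (a := (1 / 16 : ℝ)) (by norm_num) J
  norm_num at h2
  linarith

/-- The weight controlling the interaction for typical fields. -/
def wSmall (M J : ℕ) (m n : Momentum) : ℝ :=
  wDiag M J m n + wHalf M J m n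
    + (80 * etaScale M J ^ 5 + 6400 * etaScale M J ^ 6) * wTwo M J m n
    + 6400 * (etaScale M J ^ 6)⁻¹ * wLow (etaScale M J ^ 4) m n

/-- The weight controlling the interaction for all fields. -/
def wLarge (M J : ℕ) (m n : Momentum) : ℝ :=
  wDiag M J m n + wHalf M J m n + wOne M J m n

/-- In `wSmall` the terms with growing coefficients have traces η⁶ · (1 + J) η⁻⁸ and η⁻⁶ · η⁴ (1 +
J), both O(η⁻¹). In `wLarge` only `wOne` has a growing trace, of order N = η⁸. The rate η⁻⁶ of the
coefficients is dictated by `wLow`; the other contributions are O(η⁻⁸). -/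
theorem exists_weight_bounds {M : ℕ} (hM : 1 < M) : ∃ T : ℝ, 0 < T ∧ ∀ J : ℕ,
    wTrace (momenta M J) (wSmall M J) ≤ T ∧
    (∀ c k l, wCoeff (momenta M J) (wSmall M J) c k l ≤ T * (etaScale M J ^ 6)⁻¹) ∧
    wTrace (momenta M J) (wLarge M J) ≤ T * etaScale M J ^ 8 ∧
    (∀ c k l, wCoeff (momenta M J) (wLarge M J) c k l ≤ T * (etaScale M J ^ 6)⁻¹) := by
  have hM0 : (0 : ℝ) < M := by exact_mod_cast (by omega : 0 < M)
  set a := 972 * (M : ℝ) ^ 2 * (1 + M) * (1 + (M : ℝ) ^ 4) with ha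
  set b := 972 * (M : ℝ) ^ 2 * (1 + (M : ℝ) ^ 4) with hb
  set d := 972 * (M : ℝ) ^ 6 with hd
  set f := 2592 * (M : ℝ) ^ 4 with hf
  set a' := 512 * (M : ℝ) ^ 2 * (1 + M) with ha'
  set b' := 27 * (M : ℝ) ^ 2 * (1 + (M : ℝ) ^ 3) with hb'
  set d' := 512 * (M : ℝ) ^ 2 with hd'
  have pa : 0 < a := by positivity
  have pb : 0 < b := by positivity
  have pd : 0 < d := by positivity
  have pf : 0 < f := by positivity
  have pa' : 0 < a' := by positivity
  have pb' : 0 < b' := by positivity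
  have pd' : 0 < d' := by positivity
  refine ⟨324 + a + b + 6480 * 16 * d + 6400 * 16 * f + 27 + a' + b' + 6480 * d' + 6400 * 512,
    by positivity, fun J => ?_⟩
  have hη := one_le_etaScale hM J
  have hJ := one_add_le_etaScale hM J
  have hp := etaScale_pow M J
  set η := etaScale M J with hηdef
  have h0 : 0 < η := by linarith
  have hinv : ((M : ℝ) ^ J)⁻¹ ≤ (η ^ 6)⁻¹ := by
    rw [← hp]; exact inv_anti₀ (by positivity) (pow_le_pow_right₀ hη (by norm_num))
  have h56 : η ^ 5 ≤ η ^ 6 := pow_le_pow_right₀ hη (by norm_num)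
  have hJ0 : (0 : ℝ) ≤ 1 + J := by positivity
  have hi0 : 0 < (η ^ 6)⁻¹ := by positivity
  have hi1 : (η ^ 6)⁻¹ ≤ 1 := inv_le_one_of_one_le₀ (one_le_pow₀ hη)
  have h8 : 1 ≤ η ^ 8 := one_le_pow₀ hη
  have t1 := wTrace_diag_le J hM
  have t2 := wTrace_half_le J hM
  have t3 := wTrace_one_le J hM
  have t4 := wTrace_two_le J hM
  have t5 := wTrace_low_le J hM (K := η ^ 4) (by positivity)
  have s4 : (80 * η ^ 5 + 6400 * η ^ 6) * wTrace (momenta M J) (wTwo M J) ≤ 6480 * 16 * d := by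
    calc _ ≤ (6480 * η ^ 6) * (d * (16 * η) * (η ^ 8)⁻¹) := by
          rw [hp]
          refine mul_le_mul (by linarith) (t4.trans ?_) ?_ (by positivity)
          · gcongr
          · refine Finset.sum_nonneg fun c _ => Finset.sum_nonneg fun m _ =>
              Finset.sum_nonneg fun n _ => ?_
            unfold wTwo
            have := propagator_pos m
            split_ifs <;> positivity
      _ = 6480 * 16 * d * η⁻¹ := by field_simp
      _ ≤ _ := mul_le_of_le_one_right (by positivity) (inv_le_one_of_one_le₀ hη)
  have s5 : 6400 * (η ^ 6)⁻¹ * wTrace (momenta M J) (wLow (η ^ 4)) ≤ 6400 * 16 * f := by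
    calc _ ≤ 6400 * (η ^ 6)⁻¹ * (f * (16 * η) * η ^ 4) := by
          refine mul_le_mul_of_nonneg_left (t5.trans ?_) (by positivity)
          gcongr
      _ = 6400 * 16 * f * η⁻¹ := by field_simp
      _ ≤ _ := mul_le_of_le_one_right (by positivity) (inv_le_one_of_one_le₀ hη)
  have c1 : ∀ c k l, wCoeff (momenta M J) (wDiag M J) c k l ≤ 27 * (η ^ 6)⁻¹ := fun c k l =>
    (wCoeff_diag_le J hM c k l).trans (by gcongr)
  have c2 : ∀ c k l, wCoeff (momenta M J) (wHalf M J) c k l ≤ a' * (η ^ 6)⁻¹ := fun c k l =>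
    (wCoeff_half_le J hM c k l).trans (by gcongr)
  have c3 : ∀ c k l, wCoeff (momenta M J) (wOne M J) c k l ≤ b' * (η ^ 6)⁻¹ := fun c k l =>
    (wCoeff_one_le J hM c k l).trans (by gcongr)
  have c4 : ∀ c k l, (80 * η ^ 5 + 6400 * η ^ 6) * wCoeff (momenta M J) (wTwo M J) c k l
      ≤ 6480 * d' * (η ^ 6)⁻¹ := by
    intro c k l
    calc _ ≤ (80 * η ^ 5 + 6400 * η ^ 6) * (d' * ((η ^ 8) ^ 2)⁻¹) := by
          rw [hp]
          exact mul_le_mul_of_nonneg_left (wCoeff_two_le J hM c k l) (by positivity)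
      _ ≤ (6480 * η ^ 6) * (d' * ((η ^ 8) ^ 2)⁻¹) := by gcongr; linarith
      _ = 6480 * d' * (η ^ 10)⁻¹ := by field_simp
      _ ≤ _ := by
          gcongr
          norm_num
  have c5 : ∀ c k l, 6400 * (η ^ 6)⁻¹ * wCoeff (momenta M J) (wLow (η ^ 4)) c k l
      ≤ 6400 * 512 * (η ^ 6)⁻¹ := by
    intro c k l
    calc _ ≤ 6400 * (η ^ 6)⁻¹ * 512 :=
          mul_le_mul_of_nonneg_left (wCoeff_low_le _ _ c k l) (by positivity)
      _ = _ := by ring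
  refine ⟨?_, fun c k l => ?_, ?_, fun c k l => ?_⟩
  · unfold wSmall
    rw [wTrace_add, wTrace_add, wTrace_add, wTrace_mul, wTrace_mul]
    linarith
  · unfold wSmall
    rw [wCoeff_add, wCoeff_add, wCoeff_add, wCoeff_mul, wCoeff_mul]
    have p1 := c1 c k l
    have p2 := c2 c k l
    have p4 := c4 c k l
    have p5 := c5 c k l
    have : 0 ≤ (324 + a + b + 6480 * 16 * d + 6400 * 16 * f + b') * (η ^ 6)⁻¹ := by positivity
    linarith
  · unfold wLarge
    rw [wTrace_add, wTrace_add]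
    rw [← hp] at t3
    have e1 : 324 ≤ 324 * η ^ 8 := by linarith
    have e2 : a ≤ a * η ^ 8 := le_mul_of_one_le_right pa.le h8
    have : 0 ≤ (6480 * 16 * d + 6400 * 16 * f + 27 + a' + b' + 6480 * d' + 6400 * 512)
      * η ^ 8 := by positivity
    linarith
  · unfold wLarge
    rw [wCoeff_add, wCoeff_add]
    have p1 := c1 c k l
    have p2 := c2 c k l
    have p3 := c3 c k l
    have : 0 ≤ (324 + a + b + 6480 * 16 * d + 6400 * 16 * f + 6480 * d' + 6400 * 512)
      * (η ^ 6)⁻¹ := by positivity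
    linarith

end Combined

end TensorT44
end

noncomputable section

namespace TensorT44

open MeasureTheory ProbabilityTheory Complex

/-! ### The coupling constant in the cardioid. -/

section Coupling

theorem cos_half_arg_pos {g : ℂ} (h : |arg g| < Real.pi) : 0 < Real.cos (arg g / 2) := by
  rw [abs_lt] at h
  exact Real.cos_pos_of_mem_Ioo ⟨by linarith, by linarith⟩

theorem norm_coupling_sq (g : ℂ) : ‖coupling g‖ ^ 2 = ‖g‖ := by
  have h : coupling g ^ 2 = g := by
    unfold coupling
    rw [one_div, ← Nat.cast_two]
    exact cpow_nat_inv_pow g two_ne_zero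
  rw [← norm_pow, h]

theorem coupling_re {g : ℂ} (hg : g ≠ 0) :
    (coupling g).re = ‖coupling g‖ * Real.cos (arg g / 2) := by
  have h : coupling g = exp (log g * (1 / 2)) := by
    unfold coupling
    rw [cpow_def_of_ne_zero hg]
  have h2 : (log g * (1 / 2)).im = arg g / 2 := by
    rw [mul_comm]
    have : ((1 / 2 : ℂ)) = ((1 / 2 : ℝ) : ℂ) := by push_cast; rfl
    rw [this, im_ofReal_mul, log_im]
    ring
  rw [h, exp_re, norm_exp, h2]

/-- Multiplied by the conjugate of λ, the number 1 - iλt has real part Re λ for every real `t`; so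
its modulus is at least Re λ / |λ|, which is the cosine. -/
theorem cos_le_norm_one_sub {g : ℂ} (hg : g ≠ 0) (t : ℝ) :
    Real.cos (arg g / 2) ≤ ‖1 - I * coupling g * t‖ := by
  have hl : 0 < ‖coupling g‖ := by
    have := norm_coupling_sq g
    have h2 : 0 < ‖g‖ := norm_pos_iff.2 hg
    by_contra h3
    have : ‖coupling g‖ = 0 := le_antisymm (not_lt.1 h3) (norm_nonneg _)
    simp_all
  have h1 : ((1 - I * coupling g * t) * (starRingEnd ℂ) (coupling g)).re = (coupling g).re := by
    simp only [sub_mul, one_mul, mul_re, sub_re, mul_im, conj_re, conj_im, I_re, I_im, ofReal_re,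
      ofReal_im]
    ring
  have h2 := (abs_le.1 (abs_re_le_norm ((1 - I * coupling g * t)
    * (starRingEnd ℂ) (coupling g)))).2
  rw [h1, norm_mul, RCLike.norm_conj, coupling_re hg, mul_comm] at h2
  exact le_of_mul_le_mul_right h2 hl

end Coupling

/-! ### The amplitudes compared with powers of the propagator. -/

section Amplitudes

/-- Linear growth of A₁ means O(C^{-1/2}), square root growth of A₂ means O(C^{-1/4}). -/
theorem exists_amplitude_bounds : ∃ k : ℝ, 1 ≤ k ∧
    (∀ n, |amplitudeOne n| * √(propagator n) ≤ k) ∧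
    (∀ n, amplitudeTwo n ^ 2 * √(propagator n) ≤ k ^ 2) := by
  have hX : ∀ n : Momentum, √(propagator n) * √((∑ c, (n c : ℝ) ^ 2) + 1) = 1 := by
    intro n
    have := one_add_sum_sq_pos n
    unfold propagator
    rw [← Real.sqrt_mul (by positivity), one_div, inv_mul_cancel₀ this.ne', Real.sqrt_one]
  have hc : ∀ (n : Momentum) (c : Fin 4), |(n c : ℝ)| ≤ √((∑ c, (n c : ℝ) ^ 2) + 1) := by
    intro n c
    refine Real.abs_le_sqrt ?_
    have := Finset.single_le_sum (f := fun c => (n c : ℝ) ^ 2) (fun i _ => sq_nonneg _)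
      (Finset.mem_univ c)
    linarith
  have h1X : ∀ n : Momentum, 1 ≤ √((∑ c, (n c : ℝ) ^ 2) + 1) := by
    intro n
    refine Real.one_le_sqrt.2 ?_
    have h0 : 0 ≤ ∑ c, (n c : ℝ) ^ 2 := Finset.sum_nonneg fun _ _ => sq_nonneg _
    linarith
  refine ⟨10 ^ 9, by norm_num, fun n => ?_, fun n => ?_⟩
  · have h1 : |amplitudeOne n| ≤ 6144 * √((∑ c, (n c : ℝ) ^ 2) + 1) := by
      calc _ ≤ ∑ c, |tadpoleComp (n c)| := Finset.abs_sum_le_sum_abs _ _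
        _ ≤ ∑ c : Fin 4, 1536 * √((∑ c, (n c : ℝ) ^ 2) + 1) :=
          Finset.sum_le_sum fun c _ => (abs_tadpoleComp_le _).trans (by linarith [hc n c])
        _ = _ := by simp; ring
    calc _ ≤ 6144 * √((∑ c, (n c : ℝ) ^ 2) + 1) * √(propagator n) := by gcongr
      _ = 6144 * (√(propagator n) * √((∑ c, (n c : ℝ) ^ 2) + 1)) := by ring
      _ ≤ _ := by rw [hX]; norm_num
  · set X := √((∑ c, (n c : ℝ) ^ 2) + 1) with hXdef
    have h2 : ∀ c, |secondComp (n c)| ≤ 20000000 * √X := by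
      intro c
      have h3 : √|(n c : ℝ)| ≤ √X := Real.sqrt_le_sqrt (hc n c)
      have h4 : 1 ≤ √X := Real.one_le_sqrt.2 (h1X n)
      have := abs_secondComp_le (n c)
      linarith
    have h5 : |amplitudeTwo n| ≤ 80000000 * √X := by
      calc _ ≤ ∑ c, |secondComp (n c)| := Finset.abs_sum_le_sum_abs _ _
        _ ≤ ∑ c : Fin 4, 20000000 * √X := Finset.sum_le_sum fun c _ => h2 c
        _ = _ := by simp; ring
    have h6 : amplitudeTwo n ^ 2 ≤ 80000000 ^ 2 * X := by
      rw [← sq_abs]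
      refine (pow_le_pow_left₀ (abs_nonneg _) h5 2).trans (le_of_eq ?_)
      rw [mul_pow, Real.sq_sqrt (Real.sqrt_nonneg _)]
    calc _ ≤ 80000000 ^ 2 * X * √(propagator n) := by gcongr
      _ = 80000000 ^ 2 * (√(propagator n) * X) := by ring
      _ ≤ _ := by rw [hX]; norm_num

end Amplitudes

/-! ### Hermitian fields and their quadratic forms. -/

section Fields

/-- The matrices of the field are Hermitian. -/
def IsHermitianField (σ : Field) : Prop := ∀ c k l, σ c l k = (starRingEnd ℂ) (σ c k l)

theorem tensorSum_conj {σ : Field} (h : IsHermitianField σ) (m n : Momentum) :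
    tensorSum σ n m = (starRingEnd ℂ) (tensorSum σ m n) := by
  unfold tensorSum
  rw [map_sum]
  refine Finset.sum_congr rfl fun c _ => ?_
  rw [apply_ite (starRingEnd ℂ), map_zero, ← h c]
  exact if_congr ⟨fun h c' hc => (h c' hc).symm, fun h c' hc => (h c' hc).symm⟩ rfl rfl

theorem norm_tensorSum_comm {σ : Field} (h : IsHermitianField σ) (m n : Momentum) :
    ‖tensorSum σ n m‖ = ‖tensorSum σ m n‖ := by
  rw [tensorSum_conj h, RCLike.norm_conj]

/-- The quadratic form with weight `w` in the matrix elements of `σ`. -/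
def quadForm (F : Finset Momentum) (w : Momentum → Momentum → ℝ) (σ : Field) : ℝ :=
  ∑ m ∈ F, ∑ n ∈ F, w m n * ‖tensorSum σ m n‖ ^ 2

theorem quadForm_add (F : Finset Momentum) (v w : Momentum → Momentum → ℝ) (σ : Field) :
    quadForm F (fun m n => v m n + w m n) σ = quadForm F v σ + quadForm F w σ := by
  simp only [quadForm, ← Finset.sum_add_distrib, add_mul]

theorem quadForm_mul (F : Finset Momentum) (a : ℝ) (w : Momentum → Momentum → ℝ) (σ : Field) :
    quadForm F (fun m n => a * w m n) σ = a * quadForm F w σ := by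
  simp only [quadForm, Finset.mul_sum, mul_assoc]

theorem quadForm_nonneg {F : Finset Momentum} {w : Momentum → Momentum → ℝ}
    (hw : ∀ m n, 0 ≤ w m n) (σ : Field) : 0 ≤ quadForm F w σ :=
  Finset.sum_nonneg fun _ _ => Finset.sum_nonneg fun _ _ => mul_nonneg (hw _ _) (sq_nonneg _)

theorem sum_sum_le_quadForm {F : Finset Momentum} {w : Momentum → Momentum → ℝ} {σ : Field}
    {f : F → F → ℝ} (h : ∀ m n : F, f m n ≤ w m n * ‖tensorSum σ m n‖ ^ 2) :
    ∑ m, ∑ n, f m n ≤ quadForm F w σ := by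
  calc _ ≤ ∑ m : F, ∑ n : F, w m n * ‖tensorSum σ m n‖ ^ 2 :=
        Finset.sum_le_sum fun m _ => Finset.sum_le_sum fun n _ => h m n
    _ = _ := by
        rw [quadForm, ← Finset.sum_coe_sort F]
        exact Finset.sum_congr rfl fun m _ =>
          Finset.sum_coe_sort F fun n => w m n * ‖tensorSum σ m n‖ ^ 2

theorem sum_sum_le_quadForm_swap {F : Finset Momentum} {w : Momentum → Momentum → ℝ} {σ : Field}
    (hσ : IsHermitianField σ) {f : F → F → ℝ}
    (h : ∀ m n : F, f m n ≤ w n m * ‖tensorSum σ m n‖ ^ 2) :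
    ∑ m, ∑ n, f m n ≤ quadForm F w σ := by
  rw [Finset.sum_comm]
  refine sum_sum_le_quadForm fun m n => ?_
  rw [norm_tensorSum_comm hσ]
  exact h n m

theorem hsSq_le_quadForm {F : Finset Momentum} {w : Momentum → Momentum → ℝ} {σ : Field}
    {X : Matrix F F ℂ} (h : ∀ m n : F, ‖X m n‖ ^ 2 ≤ w m n * ‖tensorSum σ m n‖ ^ 2) :
    hsSq X ≤ quadForm F w σ := sum_sum_le_quadForm h

theorem hsSq_le_quadForm_swap {F : Finset Momentum} {w : Momentum → Momentum → ℝ} {σ : Field}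
    (hσ : IsHermitianField σ) {X : Matrix F F ℂ}
    (h : ∀ m n : F, ‖X m n‖ ^ 2 ≤ w n m * ‖tensorSum σ m n‖ ^ 2) :
    hsSq X ≤ quadForm F w σ := sum_sum_le_quadForm_swap hσ h

end Fields

/-! ### The operator norm of σ from those of its four colour blocks. -/

section OperatorNorm

open scoped Matrix.Norms.L2Operator

/-- The block of the matrix `σ_c` with indices in `S`. -/
def colourBlock (S : Finset ℤ) (σ : Field) (c : Fin 4) : Matrix S S ℂ :=
  Matrix.of fun k l => σ c k l

/-- The operator acting as `σ_c` on the colour `c`. -/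
def colourOp (F : Finset Momentum) (σ : Field) (c : Fin 4) : Matrix F F ℂ :=
  Matrix.of fun m n => if ∀ c', c' ≠ c → (m : Momentum) c' = (n : Momentum) c'
    then σ c ((m : Momentum) c) ((n : Momentum) c) else 0

/-- The operator `σ` on the momenta in `F`. -/
def tensorOp (F : Finset Momentum) (σ : Field) : Matrix F F ℂ :=
  Matrix.of fun m n => tensorSum σ m n

theorem sum_norm_colourBlock_le {S : Finset ℤ} {σ : Field} {c : Fin 4} {θ : ℝ}
    (hθ : ‖colourBlock S σ c‖ ≤ θ) (x : ℤ → ℂ) :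
    ∑ k ∈ S, ‖∑ l ∈ S, σ c k l * x l‖ ^ 2 ≤ θ ^ 2 * ∑ l ∈ S, ‖x l‖ ^ 2 := by
  have h := sum_norm_mulVec_sq_le (colourBlock S σ c) (fun l => x l)
  have h2 : ∑ k ∈ S, ‖∑ l ∈ S, σ c k l * x l‖ ^ 2
      = ∑ k, ‖((colourBlock S σ c).mulVec fun l => x l) k‖ ^ 2 := by
    rw [← Finset.sum_coe_sort S]
    refine Finset.sum_congr rfl fun k _ => ?_
    rw [← Finset.sum_coe_sort S]
    rfl
  rw [h2, ← Finset.sum_coe_sort S]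
  refine h.trans ?_
  gcongr

/-- With the other three colours frozen, the operator acts through a compression of the block of
σ_c. As `F` need not be a product set, vectors are extended by zero and the sums are taken over all
frozen colours occurring in `F`. -/
theorem norm_colourOp_le {F : Finset Momentum} {S : Finset ℤ} (hFS : ∀ n ∈ F, ∀ c, n c ∈ S)
    {σ : Field} {c : Fin 4} {θ : ℝ} (hθ : ‖colourBlock S σ c‖ ≤ θ) : ‖colourOp F σ c‖ ≤ θ := by
  classical
  have hθ0 : 0 ≤ θ := (norm_nonneg _).trans hθ
  rw [Matrix.cstar_norm_def]
  refine ContinuousLinearMap.opNorm_le_bound _ hθ0 fun x => ?_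
  refine abs_le_of_sq_le_sq' ?_ (by positivity) |>.2
  rw [mul_pow, EuclideanSpace.norm_sq_eq, EuclideanSpace.norm_sq_eq]
  set X : Momentum → ℂ := fun n => if h : n ∈ F then x ⟨n, h⟩ else 0 with hX
  have hXF : ∀ n : F, X n = x n := fun n => by simp [hX]
  have hX0 : ∀ n, n ∉ F → X n = 0 := fun n hn => by simp [hX, hn]
  have e1 : ∀ m : F, (Matrix.toEuclideanCLM (𝕜 := ℂ) (colourOp F σ c) x) m
      = ∑ l ∈ S, σ c ((m : Momentum) c) l * X (c.insertNth l (c.removeNth (m : Momentum))) := by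
    intro m
    have : (Matrix.toEuclideanCLM (𝕜 := ℂ) (colourOp F σ c) x) m
        = ∑ n : F, colourOp F σ c m n * X n := by
      rw [Matrix.ofLp_toEuclideanCLM]
      simp only [Matrix.mulVec, dotProduct, hXF]
    have h2 : ∑ n : F, colourOp F σ c m n * X n
        = ∑ n ∈ F, (if ∀ c', c' ≠ c → (m : Momentum) c' = n c'
          then σ c ((m : Momentum) c) (n c) else 0) * X n := by
      rw [← Finset.sum_coe_sort F]
      rfl
    rw [this, h2]
    simp only [ite_mul, zero_mul]
    rw [← Finset.sum_filter]
    have hins : ∀ n : Momentum, (∀ c', c' ≠ c → (m : Momentum) c' = n c') →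
        c.insertNth (n c) (c.removeNth (m : Momentum)) = n := by
      intro n hn
      have : c.removeNth (m : Momentum) = c.removeNth n := by
        funext i
        exact hn _ (Fin.succAbove_ne c i)
      rw [this, Fin.insertNth_self_removeNth]
    have himg : ∑ n ∈ F with ∀ c', c' ≠ c → (m : Momentum) c' = n c',
        σ c ((m : Momentum) c) (n c) * X n
        = ∑ l ∈ (F.filter fun n => ∀ c', c' ≠ c → (m : Momentum) c' = n c').image (fun n => n c),
          σ c ((m : Momentum) c) l * X (c.insertNth l (c.removeNth (m : Momentum))) := by
      rw [Finset.sum_image]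
      · refine Finset.sum_congr rfl fun n hn => ?_
        rw [hins n (Finset.mem_filter.1 hn).2]
      · intro n hn n' hn' h
        rw [Finset.mem_coe, Finset.mem_filter] at hn hn'
        have h' : n c = n' c := h
        rw [← hins n hn.2, ← hins n' hn'.2, h']
    rw [himg]
    refine Finset.sum_subset ?_ ?_
    · intro l hl
      obtain ⟨n, hn, rfl⟩ := Finset.mem_image.1 hl
      exact hFS n (Finset.mem_filter.1 hn).1 c
    · intro l _ hl
      rw [hX0, mul_zero]
      intro hmem
      refine hl (Finset.mem_image.2 ⟨_, Finset.mem_filter.2 ⟨hmem, ?_⟩, ?_⟩)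
      · intro c' hc'
        obtain ⟨i, rfl⟩ := Fin.exists_succAbove_eq hc'
        rw [Fin.insertNth_apply_succAbove]
        rfl
      · exact Fin.insertNth_apply_same _ _ _
  simp only [e1]
  rw [Finset.sum_coe_sort F fun m => ‖∑ l ∈ S, σ c (m c) l * X (c.insertNth l (c.removeNth m))‖ ^ 2]
  have hx2 : ∑ n : F, ‖x n‖ ^ 2 = ∑ n ∈ F, ‖X n‖ ^ 2 := by
    rw [← Finset.sum_coe_sort F]
    exact Finset.sum_congr rfl fun n _ => by rw [hXF]
  rw [hx2]
  set R := F.image (fun n => c.removeNth n) with hR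
  have hmaps : ∀ n ∈ F, c.removeNth n ∈ R := fun n hn => Finset.mem_image_of_mem _ hn
  rw [← Finset.sum_fiberwise_of_maps_to hmaps]
  calc _ ≤ ∑ p ∈ R, ∑ k ∈ S, ‖∑ l ∈ S, σ c k l * X (c.insertNth l p)‖ ^ 2 := by
        refine Finset.sum_le_sum fun p _ => ?_
        have hinj : Set.InjOn (fun n : Momentum => n c) (F.filter fun n => c.removeNth n = p) := by
          intro n hn n' hn' h
          rw [Finset.mem_coe, Finset.mem_filter] at hn hn'
          have h' : n c = n' c := h
          rw [← Fin.insertNth_self_removeNth c n, ← Fin.insertNth_self_removeNth c n', hn.2, hn'.2,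
            h']
        calc _ = ∑ k ∈ (F.filter fun n => c.removeNth n = p).image (fun n => n c),
              ‖∑ l ∈ S, σ c k l * X (c.insertNth l p)‖ ^ 2 := by
              rw [Finset.sum_image hinj]
              refine Finset.sum_congr rfl fun n hn => ?_
              rw [(Finset.mem_filter.1 hn).2]
          _ ≤ _ := by
              refine Finset.sum_le_sum_of_subset_of_nonneg ?_ fun _ _ _ => sq_nonneg _
              intro k hk
              obtain ⟨n, hn, rfl⟩ := Finset.mem_image.1 hk
              exact hFS n (Finset.mem_filter.1 hn).1 c
    _ ≤ ∑ p ∈ R, θ ^ 2 * ∑ l ∈ S, ‖X (c.insertNth l p)‖ ^ 2 :=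
        Finset.sum_le_sum fun p _ => sum_norm_colourBlock_le hθ fun l => X (c.insertNth l p)
    _ = θ ^ 2 * ∑ q ∈ R ×ˢ S, ‖X (c.insertNth q.2 q.1)‖ ^ 2 := by
        rw [← Finset.mul_sum, Finset.sum_product]
    _ ≤ θ ^ 2 * ∑ n ∈ F, ‖X n‖ ^ 2 := by
        refine mul_le_mul_of_nonneg_left ?_ (sq_nonneg θ)
        have hinj : Set.InjOn (fun q : (Fin 3 → ℤ) × ℤ => (c.insertNth q.2 q.1 : Momentum))
            (R ×ˢ S : Finset ((Fin 3 → ℤ) × ℤ)) := by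
          intro q _ q' _ h
          have h' : (c.insertNth q.2 q.1 : Momentum) = c.insertNth q'.2 q'.1 := h
          have h1 := congrArg (fun n : Momentum => n c) h'
          have h2 := congrArg (fun n : Momentum => c.removeNth n) h'
          simp only [Fin.insertNth_apply_same, Fin.removeNth_insertNth] at h1 h2
          exact Prod.ext h2 h1
        rw [← Finset.sum_image (f := fun n => ‖X n‖ ^ 2) hinj]
        -- The product set may contain momenta outside `F`, where `X` vanishes.
        rw [Finset.sum_subset (s₁ := F) Finset.subset_union_right fun n _ hn => by
          rw [hX0 n hn, norm_zero, sq, zero_mul]]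
        exact Finset.sum_le_sum_of_subset_of_nonneg Finset.subset_union_left
          fun _ _ _ => sq_nonneg _

theorem norm_tensorOp_le {F : Finset Momentum} {S : Finset ℤ} (hFS : ∀ n ∈ F, ∀ c, n c ∈ S)
    {σ : Field} {θ : ℝ} (hθ : ∀ c, ‖colourBlock S σ c‖ ≤ θ) : ‖tensorOp F σ‖ ≤ 4 * θ := by
  have h : tensorOp F σ = ∑ c, colourOp F σ c := by
    ext m n
    simp [tensorOp, colourOp, tensorSum, Matrix.sum_apply]
  rw [h]
  refine (norm_sum_le _ _).trans ((Finset.sum_le_sum fun c _ => norm_colourOp_le hFS (hθ c)).trans ?_)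
  simp

end OperatorNorm

end TensorT44
end

noncomputable section

namespace TensorT44

open MeasureTheory ProbabilityTheory Complex

/-! ### Hilbert-Schmidt norms and traces of words in C^{1/2}σC^{1/2}. -/

section Sandwich

open scoped Matrix.Norms.L2Operator

/-- The operator `C^{1/2} σ C^{1/2}` on the momenta in `F`. -/
def hermOp (F : Finset Momentum) (σ : Field) : Matrix F F ℂ :=
  Matrix.of fun m n => (√(propagator m) : ℂ) * tensorSum σ m n * (√(propagator n) : ℂ)

/-- The operator `C^{1/2}` on the momenta in `F`. -/
def sqrtPropOp (F : Finset Momentum) : Matrix F F ℂ :=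
  Matrix.diagonal fun n => (√(propagator n) : ℂ)

theorem hermOp_eq (F : Finset Momentum) (σ : Field) :
    hermOp F σ = sqrtPropOp F * tensorOp F σ * sqrtPropOp F := by
  ext m n
  simp [hermOp, sqrtPropOp, tensorOp]

theorem hermOp_isHermitian (F : Finset Momentum) {σ : Field} (hσ : IsHermitianField σ) :
    (hermOp F σ).IsHermitian := by
  ext m n
  rw [Matrix.conjTranspose_apply]
  simp only [hermOp, Matrix.of_apply, RCLike.star_def, map_mul, conj_ofReal]
  rw [tensorSum_conj hσ m n, conj_conj]
  ring

theorem sigmaOp_eq (M : ℕ) (g : ℂ) (j : ℕ) (σ : Field) :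
    sigmaOp M g j σ = (I * coupling g) • hermOp (momenta M j) σ := by
  ext m n
  simp only [sigmaOp, hermOp, Matrix.of_apply, Matrix.smul_apply, smul_eq_mul]
  ring

theorem norm_hermOp_apply (F : Finset Momentum) (σ : Field) (m n : F) :
    ‖hermOp F σ m n‖ = √(propagator m) * √(propagator n) * ‖tensorSum σ m n‖ := by
  simp only [hermOp, Matrix.of_apply, norm_mul, norm_real, Real.norm_eq_abs,
    abs_of_nonneg (Real.sqrt_nonneg _)]
  ring

theorem norm_hermOp_apply_sq (F : Finset Momentum) (σ : Field) (m n : F) :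
    ‖hermOp F σ m n‖ ^ 2 = propagator m * propagator n * ‖tensorSum σ m n‖ ^ 2 := by
  rw [norm_hermOp_apply, mul_pow, mul_pow, Real.sq_sqrt (propagator_pos _).le,
    Real.sq_sqrt (propagator_pos _).le]

variable {F : Finset Momentum} {w : Momentum → Momentum → ℝ} {σ : Field}

theorem hsSq_diag_hermOp_diag_le {x y : F → ℂ}
    (h : ∀ m n : F, ‖x m‖ ^ 2 * ‖y n‖ ^ 2 * (propagator m * propagator n) ≤ w m n) :
    hsSq (Matrix.diagonal x * hermOp F σ * Matrix.diagonal y) ≤ quadForm F w σ := by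
  refine hsSq_le_quadForm fun m n => ?_
  rw [Matrix.mul_diagonal, Matrix.diagonal_mul, norm_mul, norm_mul, mul_pow, mul_pow,
    norm_hermOp_apply_sq]
  calc _ = ‖x m‖ ^ 2 * ‖y n‖ ^ 2 * (propagator m * propagator n) * ‖tensorSum σ m n‖ ^ 2 := by ring
    _ ≤ _ := mul_le_mul_of_nonneg_right (h m n) (sq_nonneg _)

theorem hsSq_diag_hermOp_diag_le_swap (hσ : IsHermitianField σ) {x y : F → ℂ}
    (h : ∀ m n : F, ‖x n‖ ^ 2 * ‖y m‖ ^ 2 * (propagator m * propagator n) ≤ w m n) :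
    hsSq (Matrix.diagonal x * hermOp F σ * Matrix.diagonal y) ≤ quadForm F w σ := by
  refine hsSq_le_quadForm_swap hσ fun m n => ?_
  rw [Matrix.mul_diagonal, Matrix.diagonal_mul, norm_mul, norm_mul, mul_pow, mul_pow,
    norm_hermOp_apply_sq]
  calc _ = ‖x m‖ ^ 2 * ‖y n‖ ^ 2 * (propagator n * propagator m) * ‖tensorSum σ m n‖ ^ 2 := by ring
    _ ≤ _ := mul_le_mul_of_nonneg_right (h n m) (sq_nonneg _)

theorem norm_trace_hermOp_diag_hermOp_le (hσ : IsHermitianField σ) {x y z : F → ℂ} {c : ℝ}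
    (h : ∀ m n : F, ‖x m‖ * ‖y n‖ * ‖z m‖ * (propagator m * propagator n) ≤ c * w m n) :
    ‖(Matrix.diagonal x * hermOp F σ * Matrix.diagonal y * (hermOp F σ * Matrix.diagonal z)).trace‖
      ≤ c * quadForm F w σ := by
  rw [← quadForm_mul]
  refine le_trans ?_ (sum_sum_le_quadForm
    (f := fun m n => ‖x m * hermOp F σ m n * y n * (hermOp F σ n m * z m)‖) fun m n => ?_)
  · simp only [Matrix.trace, Matrix.diag]
    refine (norm_sum_le _ _).trans (Finset.sum_le_sum fun m _ => ?_)
    rw [Matrix.mul_apply]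
    refine (norm_sum_le _ _).trans (Finset.sum_le_sum fun n _ => ?_)
    rw [Matrix.mul_diagonal, Matrix.diagonal_mul, Matrix.mul_diagonal]
  · have h1 : ‖hermOp F σ n m‖ = ‖hermOp F σ m n‖ := by
      rw [norm_hermOp_apply, norm_hermOp_apply, norm_tensorSum_comm hσ]
      ring
    simp only [norm_mul]
    rw [h1]
    calc _ = ‖x m‖ * ‖y n‖ * ‖z m‖ * ‖hermOp F σ m n‖ ^ 2 := by ring
      _ = ‖x m‖ * ‖y n‖ * ‖z m‖ * (propagator m * propagator n) * ‖tensorSum σ m n‖ ^ 2 := by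
        rw [norm_hermOp_apply_sq]; ring
      _ ≤ _ := mul_le_mul_of_nonneg_right (h m n) (sq_nonneg _)

theorem norm_sqrtPropOp_le (F : Finset Momentum) : ‖sqrtPropOp F‖ ≤ 1 := by
  refine l2_opNorm_diagonal_le zero_le_one fun n => ?_
  rw [norm_real, Real.norm_eq_abs, abs_of_nonneg (Real.sqrt_nonneg _)]
  exact sqrt_propagator_le_one _

/-- The middle H is opened as C^{1/2}σC^{1/2}: σ is measured in operator norm, and the two half
propagators join the outer factors, whose weight improves to C(m)C(n)². -/
theorem norm_trace_hermOp_cube_le (hσ : IsHermitianField σ) (hw : ∀ m n, 0 ≤ w m n)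
    {x y y' z : F → ℂ} {t : ℝ} (ht : ‖tensorOp F σ‖ ≤ t)
    (hx : ∀ m n : F, ‖x m‖ ^ 2 * ‖y n‖ ^ 2 * (propagator m * propagator n ^ 2) ≤ w m n)
    (hz : ∀ m n : F, ‖z m‖ ^ 2 * ‖y' n‖ ^ 2 * (propagator m * propagator n ^ 2) ≤ w m n) :
    ‖(Matrix.diagonal x * hermOp F σ * (Matrix.diagonal y * hermOp F σ * Matrix.diagonal y')
      * (hermOp F σ * Matrix.diagonal z)).trace‖ ≤ t * quadForm F w σ := by
  have hq := quadForm_nonneg (F := F) hw σ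
  have hs : ∀ n : F, ‖(√(propagator n) : ℂ)‖ ^ 2 = propagator n := fun n => by
    rw [norm_real, Real.norm_eq_abs, abs_of_nonneg (Real.sqrt_nonneg _),
      Real.sq_sqrt (propagator_pos _).le]
  have h1 : hsSq (Matrix.diagonal x * hermOp F σ
      * Matrix.diagonal fun n => y n * (√(propagator n) : ℂ)) ≤ √(quadForm F w σ) ^ 2 := by
    rw [Real.sq_sqrt hq]
    refine hsSq_diag_hermOp_diag_le fun m n => ?_
    rw [norm_mul, mul_pow, hs]
    exact le_trans (le_of_eq (by ring)) (hx m n)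
  have h2 : hsSq ((Matrix.diagonal fun n => y' n * (√(propagator n) : ℂ)) * hermOp F σ
      * Matrix.diagonal z) ≤ √(quadForm F w σ) ^ 2 := by
    rw [Real.sq_sqrt hq]
    refine hsSq_diag_hermOp_diag_le_swap hσ fun m n => ?_
    rw [norm_mul, mul_pow, hs]
    exact le_trans (le_of_eq (by ring)) (hz m n)
  have h3 := norm_trace_mul_mul_le (Real.sqrt_nonneg _) (Real.sqrt_nonneg _) h1 h2 ht
  rw [mul_assoc t, Real.mul_self_sqrt hq] at h3
  have e1 : (Matrix.diagonal fun n => y n * (√(propagator n) : ℂ))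
      = Matrix.diagonal y * sqrtPropOp F := by
    rw [sqrtPropOp, Matrix.diagonal_mul_diagonal]
  have e2 : (Matrix.diagonal fun n => y' n * (√(propagator n) : ℂ))
      = sqrtPropOp F * Matrix.diagonal y' := by
    rw [sqrtPropOp, Matrix.diagonal_mul_diagonal]
    exact congrArg _ (funext fun n => mul_comm _ _)
  have e3 : Matrix.diagonal x * hermOp F σ * (Matrix.diagonal y * sqrtPropOp F) * tensorOp F σ
        * (sqrtPropOp F * Matrix.diagonal y' * hermOp F σ * Matrix.diagonal z)
      = Matrix.diagonal x * hermOp F σ * (Matrix.diagonal y * hermOp F σ * Matrix.diagonal y')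
        * (hermOp F σ * Matrix.diagonal z) := by
    have e4 : Matrix.diagonal y * hermOp F σ * Matrix.diagonal y'
        = Matrix.diagonal y * (sqrtPropOp F * tensorOp F σ * sqrtPropOp F)
          * Matrix.diagonal y' := by
      rw [← hermOp_eq]
    rw [e4]
    simp only [Matrix.mul_assoc]
  rw [e1, e2, e3] at h3
  exact h3

/-- Hilbert-Schmidt bound of `Q H Y H`: the columns in `p` are estimated by the operator norm of
`Q H`, the other ones gain from the smallness of the propagator. -/
theorem hsSq_hermOp_sq_le (hσ : IsHermitianField σ) {x y : F → ℂ} {p : F → Prop} [DecidablePred p]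
    {v : Momentum → Momentum → ℝ} {t b ε : ℝ} (ht : ‖tensorOp F σ‖ ≤ t) (hb : 0 ≤ b) (hε : 0 ≤ ε)
    (hy : ∀ n, ‖y n‖ ≤ 1) (hxb : ∀ m, ‖x m‖ * √(propagator m) ≤ b)
    (hp : ∀ n, ¬ p n → √(propagator n) ≤ ε)
    (hv0 : ∀ m n, 0 ≤ v m n) (hv : ∀ m n : F, p m → propagator m * propagator n ≤ v m n)
    (hw : ∀ m n : F, ‖x m‖ ^ 2 * (propagator m * propagator n ^ 2) ≤ w m n) :
    hsSq (Matrix.diagonal x * hermOp F σ * Matrix.diagonal y * hermOp F σ)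
      ≤ 2 * ((b * t) ^ 2 * quadForm F v σ) + 2 * ((t * ε) ^ 2 * quadForm F w σ) := by
  have ht0 : 0 ≤ t := (norm_nonneg _).trans ht
  set H := hermOp F σ with hH
  set S := sqrtPropOp F with hS
  set L : Matrix F F ℂ := Matrix.diagonal fun n => if p n then 1 else 0 with hL
  set L' : Matrix F F ℂ := Matrix.diagonal fun n => if p n then 0 else 1 with hL'
  have hLL : L + L' = 1 := by
    rw [hL, hL', Matrix.diagonal_add, ← Matrix.diagonal_one]
    congr 1
    funext n
    split_ifs <;> simp
  have hyn : ‖Matrix.diagonal y‖ ≤ 1 := l2_opNorm_diagonal_le zero_le_one hy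
  have hSn : ‖S‖ ≤ 1 := norm_sqrtPropOp_le F
  -- On the columns in `p` the left factor is taken in operator norm. On the others the last H is
  -- opened, and the half propagator next to `L'` gives the factor ε, the other one improving the
  -- weight of the left factor.
  have e : Matrix.diagonal x * H * Matrix.diagonal y * H
      = Matrix.diagonal x * H * Matrix.diagonal y * (1 * H * L)
        + Matrix.diagonal x * H * (Matrix.diagonal y * S) * (tensorOp F σ * (S * L')) := by
    have e1 : (Matrix.diagonal y * S) * (tensorOp F σ * (S * L')) = Matrix.diagonal y * H * L' := by
      rw [hH, hermOp_eq]
      simp only [mul_assoc, hS]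
    calc _ = Matrix.diagonal x * H * Matrix.diagonal y * H * (L + L') := by rw [hLL, mul_one]
      _ = _ := by
        rw [mul_add, mul_assoc (Matrix.diagonal x * H) (Matrix.diagonal y * S), e1]
        simp only [mul_assoc, one_mul]
  rw [e]
  refine (hsSq_add_le _ _).trans ?_
  have i1 : hsSq (Matrix.diagonal x * H * Matrix.diagonal y * (1 * H * L))
      ≤ (b * t) ^ 2 * quadForm F v σ := by
    refine (hsSq_mul_le _ _).trans ?_
    have n1 : ‖Matrix.diagonal x * H * Matrix.diagonal y‖ ≤ b * t := by
      have : Matrix.diagonal x * H * Matrix.diagonal y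
          = (Matrix.diagonal x * S) * tensorOp F σ * (S * Matrix.diagonal y) := by
        rw [hH, hermOp_eq]
        simp only [mul_assoc, hS]
      rw [this]
      have n2 : ‖Matrix.diagonal x * S‖ ≤ b := by
        rw [hS, sqrtPropOp, Matrix.diagonal_mul_diagonal]
        refine l2_opNorm_diagonal_le hb fun m => ?_
        rw [norm_mul, norm_real, Real.norm_eq_abs, abs_of_nonneg (Real.sqrt_nonneg _)]
        exact hxb m
      have n3 : ‖S * Matrix.diagonal y‖ ≤ 1 :=
        (norm_mul_le _ _).trans (mul_le_one₀ hSn (norm_nonneg _) hyn)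
      calc _ ≤ ‖Matrix.diagonal x * S‖ * ‖tensorOp F σ‖ * ‖S * Matrix.diagonal y‖ :=
            (norm_mul_le _ _).trans (mul_le_mul_of_nonneg_right (norm_mul_le _ _) (norm_nonneg _))
        _ ≤ b * t * 1 := by gcongr
        _ = _ := mul_one _
    have h2 : hsSq (1 * H * L) ≤ quadForm F v σ := by
      rw [← Matrix.diagonal_one]
      refine hsSq_diag_hermOp_diag_le_swap hσ fun m n => ?_
      by_cases hm : p m
      · simpa [hm] using hv m n hm
      · simpa [hm] using hv0 m n
    gcongr
    exact hsSq_nonneg _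
  have i2 : hsSq (Matrix.diagonal x * H * (Matrix.diagonal y * S) * (tensorOp F σ * (S * L')))
      ≤ (t * ε) ^ 2 * quadForm F w σ := by
    refine (hsSq_mul_le' _ _).trans ?_
    rw [mul_comm]
    have n1 : ‖tensorOp F σ * (S * L')‖ ≤ t * ε := by
      refine (norm_mul_le _ _).trans (mul_le_mul ht ?_ (norm_nonneg _) ht0)
      rw [hS, sqrtPropOp, hL', Matrix.diagonal_mul_diagonal]
      refine l2_opNorm_diagonal_le hε fun n => ?_
      split_ifs with h
      · simpa using hε
      · rw [mul_one, norm_real, Real.norm_eq_abs, abs_of_nonneg (Real.sqrt_nonneg _)]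
        exact hp n h
    have h2 : hsSq (Matrix.diagonal x * H * (Matrix.diagonal y * S)) ≤ quadForm F w σ := by
      rw [hS, sqrtPropOp, Matrix.diagonal_mul_diagonal]
      refine hsSq_diag_hermOp_diag_le fun m n => ?_
      rw [norm_mul, norm_real, Real.norm_eq_abs, abs_of_nonneg (Real.sqrt_nonneg _), mul_pow,
        Real.sq_sqrt (propagator_pos _).le]
      refine le_trans ?_ (hw m n)
      have h3 : ‖y n‖ ^ 2 ≤ 1 := pow_le_one₀ (norm_nonneg _) (hy n)
      have h4 := (propagator_pos (m : Momentum)).le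
      have h5 := (propagator_pos (n : Momentum)).le
      calc _ = ‖x m‖ ^ 2 * (propagator m * propagator n ^ 2) * ‖y n‖ ^ 2 := by ring
        _ ≤ ‖x m‖ ^ 2 * (propagator m * propagator n ^ 2) * 1 := by gcongr
        _ = _ := mul_one _
    gcongr
    exact hsSq_nonneg _
  linarith

end Sandwich

end TensorT44
end

noncomputable section

namespace TensorT44

open MeasureTheory ProbabilityTheory Complex

/-! ### Diagonal operators and resolvents in a small cardioid. -/

section Regime

open scoped Matrix.Norms.L2Operator

/-- Diagonal entries of `D₁`. -/
def entryOne (g : ℂ) (n : Momentum) : ℂ := I * coupling g * shiftOne g n * (propagator n : ℂ)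

/-- Diagonal entries of `D₂`. -/
def entryTwo (g : ℂ) (n : Momentum) : ℂ := I * coupling g * shiftTwo g n * (propagator n : ℂ)

/-- Diagonal entries of `D₁ + D₂`. -/
def entrySum (g : ℂ) (n : Momentum) : ℂ := entryOne g n + entryTwo g n

/-- The operator `Σ + D₁ + D₂` on the momenta in `F`. -/
def fullOp (g : ℂ) (F : Finset Momentum) (σ : Field) : Matrix F F ℂ :=
  (I * coupling g) • hermOp F σ + Matrix.diagonal fun n : F => entrySum g n

theorem uOp_eq (M : ℕ) (g : ℂ) (j : ℕ) (σ : Field) :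
    uOp M g j σ = fullOp g (momenta M j) σ := by
  rw [uOp, sigmaOp_eq, fullOp, dOne, dTwo, add_assoc, Matrix.diagonal_add]
  rfl

/-- Coupling constants in a small cardioid, `k` being a bound of the amplitudes. -/
structure SmallCoupling (M : ℕ) (k ρ : ℝ) (g : ℂ) : Prop where
  one_lt : 1 < M
  ne : g ≠ 0
  arg_lt : |arg g| < Real.pi
  norm_lt : ‖g‖ < ρ * Real.cos (arg g / 2) ^ 2
  one_le : 1 ≤ k
  ampOne : ∀ n, |amplitudeOne n| * √(propagator n) ≤ k
  ampTwo : ∀ n, amplitudeTwo n ^ 2 * √(propagator n) ≤ k ^ 2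
  small : 4 * k * M * ρ ≤ 1

namespace SmallCoupling

variable {M : ℕ} {k ρ : ℝ} {g : ℂ}

theorem cos_pos (h : SmallCoupling M k ρ g) : 0 < Real.cos (arg g / 2) :=
  cos_half_arg_pos h.arg_lt

theorem one_le_M (h : SmallCoupling M k ρ g) : (1 : ℝ) ≤ M := by exact_mod_cast h.one_lt.le

theorem normSq_lt (h : SmallCoupling M k ρ g) :
    ‖coupling g‖ ^ 2 < ρ * Real.cos (arg g / 2) ^ 2 := by
  rw [norm_coupling_sq]
  exact h.norm_lt

theorem rho_pos (h : SmallCoupling M k ρ g) : 0 < ρ := by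
  have h1 := (sq_nonneg ‖coupling g‖).trans_lt h.normSq_lt
  have h2 := h.cos_pos
  exact pos_of_mul_pos_left h1 (by positivity)

theorem kRho_le (h : SmallCoupling M k ρ g) : 4 * k * ρ ≤ 1 := by
  have h1 := h.one_le_M
  have h2 := h.rho_pos
  have h3 := h.one_le
  have h4 := h.small
  have : 4 * k * ρ * 1 ≤ 4 * k * ρ * M := by gcongr
  linarith

theorem rho_le (h : SmallCoupling M k ρ g) : ρ ≤ 1 / 4 := by
  have h2 := h.rho_pos
  have : 4 * 1 * ρ ≤ 4 * k * ρ := by gcongr; exact h.one_le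
  linarith [h.kRho_le]

theorem normSq_le (h : SmallCoupling M k ρ g) : ‖coupling g‖ ^ 2 ≤ ρ := by
  have h1 := h.normSq_lt.le
  have h2 : Real.cos (arg g / 2) ^ 2 ≤ 1 := Real.cos_sq_le_one _
  calc _ ≤ _ := h1
    _ ≤ ρ * 1 := by gcongr; exact h.rho_pos.le
    _ = ρ := mul_one _

theorem norm_le_one (h : SmallCoupling M k ρ g) : ‖coupling g‖ ≤ 1 := by
  refine abs_le_of_sq_le_sq' ?_ zero_le_one |>.2
  linarith [h.normSq_le, h.rho_le]

theorem norm_pow_le (h : SmallCoupling M k ρ g) {i : ℕ} (hi : 2 ≤ i) :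
    ‖coupling g‖ ^ i ≤ ‖coupling g‖ ^ 2 :=
  pow_le_pow_of_le_one (norm_nonneg _) h.norm_le_one hi

/-- The shape of the cardioid enters here: |λ|² compensates two resolvents with a factor ρ to spare.
-/
theorem resolvent_sq_mul_le (h : SmallCoupling M k ρ g) :
    (2 / Real.cos (arg g / 2)) ^ 2 * ‖coupling g‖ ^ 2 ≤ 4 * ρ := by
  have h1 := h.cos_pos
  rw [div_pow, div_mul_eq_mul_div, div_le_iff₀ (by positivity)]
  linarith [h.normSq_lt.le]

theorem one_le_resolvent (h : SmallCoupling M k ρ g) : 1 ≤ 2 / Real.cos (arg g / 2) := by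
  rw [le_div_iff₀ h.cos_pos]
  linarith [Real.cos_le_one (arg g / 2)]

theorem norm_entryOne_le (h : SmallCoupling M k ρ g) (n : Momentum) :
    ‖entryOne g n‖ ≤ k * ‖coupling g‖ ^ 2 * √(propagator n) := by
  have h0 := propagator_pos n
  have h1 := h.ampOne n
  have h2 := Real.mul_self_sqrt h0.le
  unfold entryOne shiftOne
  simp only [norm_mul, norm_I, norm_real, Real.norm_eq_abs, one_mul]
  rw [abs_of_pos h0]
  nth_rewrite 1 [← h2]
  calc _ = ‖coupling g‖ ^ 2 * (|amplitudeOne n| * √(propagator n)) * √(propagator n) := by ring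
    _ ≤ ‖coupling g‖ ^ 2 * k * √(propagator n) := by gcongr
    _ = _ := by ring

theorem norm_entryTwo_sq_le (h : SmallCoupling M k ρ g) (n : Momentum) :
    ‖entryTwo g n‖ ^ 2 ≤ (k * ‖coupling g‖ ^ 4) ^ 2 * (propagator n * √(propagator n)) := by
  have h0 := propagator_pos n
  have h1 := h.ampTwo n
  have h2 := Real.mul_self_sqrt h0.le
  unfold entryTwo shiftTwo
  simp only [norm_mul, norm_I, norm_real, Real.norm_eq_abs, one_mul, norm_neg, norm_pow]
  rw [abs_of_pos h0]
  calc _ = (‖coupling g‖ ^ 4) ^ 2 * propagator n * (|amplitudeTwo n| ^ 2 * propagator n) := by ring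
    _ = (‖coupling g‖ ^ 4) ^ 2 * propagator n * ((amplitudeTwo n ^ 2 * √(propagator n))
          * √(propagator n)) := by rw [sq_abs, mul_assoc (amplitudeTwo n ^ 2), h2]
    _ ≤ (‖coupling g‖ ^ 4) ^ 2 * propagator n * (k ^ 2 * √(propagator n)) := by gcongr
    _ = _ := by ring

theorem norm_entryTwo_le (h : SmallCoupling M k ρ g) (n : Momentum) :
    ‖entryTwo g n‖ ≤ k * ‖coupling g‖ ^ 4 * √(propagator n) := by
  have h0 := propagator_pos n
  have h1 := h.one_le
  refine abs_le_of_sq_le_sq' ?_ (by positivity) |>.2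
  refine (h.norm_entryTwo_sq_le n).trans ?_
  rw [mul_pow _ (√(propagator n)), Real.sq_sqrt h0.le]
  have := mul_le_of_le_one_right h0.le (sqrt_propagator_le_one n)
  gcongr

theorem norm_entrySum_le (h : SmallCoupling M k ρ g) (n : Momentum) :
    ‖entrySum g n‖ ≤ 2 * k * ‖coupling g‖ ^ 2 * √(propagator n) := by
  have h1 := h.one_le
  have h3 : k * ‖coupling g‖ ^ 4 * √(propagator n) ≤ k * ‖coupling g‖ ^ 2 * √(propagator n) := by
    have := h.norm_pow_le (i := 4) (by norm_num)
    gcongr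
  unfold entrySum
  linarith [norm_add_le (entryOne g n) (entryTwo g n), h.norm_entryOne_le n, h.norm_entryTwo_le n]

/-- The part of the vacuum terms which is not cancelled by the counterterms. -/
theorem norm_vacuum_rest_le (h : SmallCoupling M k ρ g) (n : Momentum) :
    ‖(1 / 4 : ℂ) * entryOne g n ^ 4 - entryOne g n * entryTwo g n ^ 2 - entryTwo g n ^ 3 / 3‖
      ≤ 3 * k ^ 4 * ‖coupling g‖ ^ 2 * propagator n ^ 2 := by
  have h0 := propagator_pos n
  have hk := h.one_le
  have h1 := h.norm_entryOne_le n
  have h2 := h.norm_entryTwo_sq_le n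
  have h3 := h.norm_entryTwo_le n
  set s := √(propagator n) with hs
  have hs2 : s ^ 2 = propagator n := Real.sq_sqrt h0.le
  have hs0 : 0 ≤ s := Real.sqrt_nonneg _
  set L := ‖coupling g‖ with hL
  have hL0 : 0 ≤ L := norm_nonneg _
  have hk3 : k ^ 3 ≤ k ^ 4 := pow_le_pow_right₀ hk (by norm_num)
  rw [← hs2] at h2 ⊢
  -- All three terms are O(C²), the borderline that sums to O(1) in a slice: D₁ is O(C^{1/2}) and D₂
  -- is O(C^{3/4}).
  have t1 : ‖(1 / 4 : ℂ) * entryOne g n ^ 4‖ ≤ k ^ 4 * L ^ 2 * s ^ 4 := by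
    rw [norm_mul, norm_pow]
    have e : ‖(1 / 4 : ℂ)‖ = 1 / 4 := by norm_num
    calc _ ≤ 1 / 4 * (k * L ^ 2 * s) ^ 4 := by rw [e]; gcongr
      _ = 1 / 4 * k ^ 4 * L ^ 8 * s ^ 4 := by ring
      _ ≤ 1 * k ^ 4 * L ^ 2 * s ^ 4 := by
        have := h.norm_pow_le (i := 8) (by norm_num)
        gcongr
        norm_num
      _ = _ := by ring
  have t2 : ‖entryOne g n * entryTwo g n ^ 2‖ ≤ k ^ 4 * L ^ 2 * s ^ 4 := by
    rw [norm_mul, norm_pow]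
    calc _ ≤ (k * L ^ 2 * s) * ((k * L ^ 4) ^ 2 * (s ^ 2 * s)) := by gcongr
      _ = k ^ 3 * L ^ 10 * s ^ 4 := by ring
      _ ≤ k ^ 4 * L ^ 2 * s ^ 4 := by
        have := h.norm_pow_le (i := 10) (by norm_num)
        gcongr
  have t3 : ‖entryTwo g n ^ 3 / 3‖ ≤ k ^ 4 * L ^ 2 * s ^ 4 := by
    rw [norm_div, norm_pow]
    have e : ‖(3 : ℂ)‖ = 3 := by norm_num
    calc _ ≤ ‖entryTwo g n‖ ^ 3 := by
          rw [e]; exact div_le_self (by positivity) (by norm_num)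
      _ = ‖entryTwo g n‖ * ‖entryTwo g n‖ ^ 2 := by ring
      _ ≤ (k * L ^ 4 * s) * ((k * L ^ 4) ^ 2 * (s ^ 2 * s)) := by gcongr
      _ = k ^ 3 * L ^ 12 * s ^ 4 := by ring
      _ ≤ k ^ 4 * L ^ 2 * s ^ 4 := by
        have := h.norm_pow_le (i := 12) (by norm_num)
        gcongr
  refine (norm_sub_le _ _).trans ?_
  have := norm_sub_le ((1 / 4 : ℂ) * entryOne g n ^ 4) (entryOne g n * entryTwo g n ^ 2)
  calc _ ≤ k ^ 4 * L ^ 2 * s ^ 4 + k ^ 4 * L ^ 2 * s ^ 4 + k ^ 4 * L ^ 2 * s ^ 4 := by linarith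
    _ = _ := by ring

/-- With `x` equal to one this concerns U, and with `x` the indicator of the lower momenta it
concerns PUP. The diagonal part is a small perturbation of the Hermitian part, as 2k|λ|² ≤ 2kρ cos²
≤ cos / 2. -/
theorem resolvent_bound (h : SmallCoupling M k ρ g) (F : Finset Momentum) {σ : Field}
    (hσ : IsHermitianField σ) {x : F → ℂ} (hx : ∀ n, star (x n) = x n) (hx1 : ∀ n, ‖x n‖ ≤ 1)
    {s : ℝ} (hs : s ∈ Set.Icc (0 : ℝ) 1) :
    IsUnit (1 - (s : ℂ) • (Matrix.diagonal x * fullOp g F σ * Matrix.diagonal x)) ∧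
    ‖(1 - (s : ℂ) • (Matrix.diagonal x * fullOp g F σ * Matrix.diagonal x))⁻¹‖
      ≤ 2 / Real.cos (arg g / 2) := by
  have hH : (Matrix.diagonal x * hermOp F σ * Matrix.diagonal x).IsHermitian := by
    have hd : (Matrix.diagonal x).conjTranspose = Matrix.diagonal x := by
      rw [Matrix.diagonal_conjTranspose]
      exact congrArg _ (funext hx)
    have := Matrix.isHermitian_mul_mul_conjTranspose (Matrix.diagonal x) (hermOp_isHermitian F hσ)
    rwa [hd] at this
  have hxn : ‖Matrix.diagonal x‖ ≤ 1 := l2_opNorm_diagonal_le zero_le_one hx1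
  have hE : ‖(s : ℂ) • (Matrix.diagonal x * (Matrix.diagonal fun n : F => entrySum g n)
      * Matrix.diagonal x)‖ ≤ Real.cos (arg g / 2) / 2 := by
    have hc := h.cos_pos
    have hc1 := Real.cos_le_one (arg g / 2)
    have hk := h.one_le
    have h1 : ‖(Matrix.diagonal fun n : F => entrySum g n)‖ ≤ Real.cos (arg g / 2) / 2 := by
      refine l2_opNorm_diagonal_le (by linarith) fun n => (h.norm_entrySum_le n).trans ?_
      calc _ ≤ 2 * k * (ρ * Real.cos (arg g / 2) ^ 2) * 1 := by
            have := h.normSq_lt.le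
            have h3 := sqrt_propagator_le_one (n : Momentum)
            have h4 := h.rho_pos
            gcongr
        _ = (4 * k * ρ) * (Real.cos (arg g / 2) * Real.cos (arg g / 2)) / 2 := by ring
        _ ≤ 1 * (1 * Real.cos (arg g / 2)) / 2 := by
            have := h.kRho_le
            gcongr
        _ = _ := by ring
    rw [norm_smul, norm_real, Real.norm_eq_abs, abs_of_nonneg hs.1]
    calc _ ≤ 1 * (1 * (Real.cos (arg g / 2) / 2) * 1) := by
          have h5 := norm_mul_le (Matrix.diagonal x * (Matrix.diagonal fun n : F => entrySum g n))
            (Matrix.diagonal x)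
          have h6 := norm_mul_le (Matrix.diagonal x) (Matrix.diagonal fun n : F => entrySum g n)
          refine mul_le_mul hs.2 (h5.trans (mul_le_mul (h6.trans ?_) hxn (norm_nonneg _)
            (by linarith))) (norm_nonneg _) zero_le_one
          exact mul_le_mul hxn h1 (norm_nonneg _) zero_le_one
      _ = _ := by ring
  have := norm_resolvent_le hH (μ := I * coupling g * s) h.cos_pos (fun t => ?_) hE
  · have e : (s : ℂ) • (Matrix.diagonal x * fullOp g F σ * Matrix.diagonal x)
        = (I * coupling g * s) • (Matrix.diagonal x * hermOp F σ * Matrix.diagonal x)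
          + (s : ℂ) • (Matrix.diagonal x * (Matrix.diagonal fun n : F => entrySum g n)
            * Matrix.diagonal x) := by
      rw [fullOp, Matrix.mul_add, Matrix.add_mul, smul_add, Matrix.mul_smul, Matrix.smul_mul, smul_smul,
        mul_comm (s : ℂ)]
    rw [e]
    exact this
  · have := cos_le_norm_one_sub h.ne (s * t)
    rwa [ofReal_mul, ← mul_assoc] at this

theorem isUnit_one_sub (h : SmallCoupling M k ρ g) (F : Finset Momentum) {σ : Field}
    (hσ : IsHermitianField σ) {s : ℝ} (hs : s ∈ Set.Icc (0 : ℝ) 1) :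
    IsUnit (1 - (s : ℂ) • fullOp g F σ) ∧
    ‖(1 - (s : ℂ) • fullOp g F σ)⁻¹‖
      ≤ 2 / Real.cos (arg g / 2) := by
  have := h.resolvent_bound F hσ (x := fun _ => 1) (fun _ => star_one _) (fun _ => by simp) hs
  rw [show (Matrix.diagonal fun _ : F => (1 : ℂ)) = 1 from Matrix.diagonal_one, one_mul,
    mul_one] at this
  exact this

end SmallCoupling

end Regime

end TensorT44
end

noncomputable section

namespace TensorT44

open MeasureTheory ProbabilityTheory Complex

/-! ### The slice as a difference of operators on a common space. -/

section Decomposition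

open scoped Matrix.Norms.L2Operator

/-- Matrix elements of `Σ`. -/
def sigmaEntry (g : ℂ) (σ : Field) (m n : Momentum) : ℂ :=
  I * coupling g * (√(propagator m) : ℂ) * tensorSum σ m n * (√(propagator n) : ℂ)

/-- Diagonal entries of the vacuum counterterms. -/
def vacuumEntry (g : ℂ) (n : Momentum) : ℂ :=
  1 / 3 * entryOne g n ^ 3 + entryOne g n ^ 2 * entryTwo g n + 1 / 4 * entryOne g n ^ 4

/-- The summands of `Tr (D₁ Σ²)`. -/
def counterEntry (g : ℂ) (σ : Field) (m n : Momentum) : ℂ :=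
  entryOne g m * (sigmaEntry g σ m n * sigmaEntry g σ n m)

/-- The higher order interaction with momenta in `F`. -/
def interactionOn (g : ℂ) (F : Finset Momentum) (σ : Field) : ℂ :=
  traceLogThree (fullOp g F σ) + ∑ m ∈ F, ∑ n ∈ F, counterEntry g σ m n + ∑ n ∈ F, vacuumEntry g n

theorem interactionOn_empty (g : ℂ) (σ : Field) : interactionOn g ∅ σ = 0 := by
  unfold interactionOn traceLogThree
  simp [Matrix.trace]

theorem interactionLe_of_ne_zero (M : ℕ) (g : ℂ) {j : ℕ} (hj : j ≠ 0) (σ : Field) :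
    interactionLe M g j σ = interactionOn g (momenta M j) σ := by
  rw [interactionLe, if_neg hj, interactionOn, uOp_eq]
  have h1 : (dOne M g j * sigmaOp M g j σ ^ 2).trace
      = ∑ m ∈ momenta M j, ∑ n ∈ momenta M j, counterEntry g σ m n := by
    rw [← Finset.sum_coe_sort (momenta M j)]
    unfold Matrix.trace
    refine Finset.sum_congr rfl fun m _ => ?_
    rw [Matrix.diag_apply, dOne, Matrix.diagonal_mul, pow_two, Matrix.mul_apply, Finset.mul_sum,
      ← Finset.sum_coe_sort (momenta M j)]
    rfl
  have h2 : vacuumTerm M g j = ∑ n ∈ momenta M j, vacuumEntry g n := by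
    rw [← Finset.sum_coe_sort (momenta M j), vacuumTerm, dOne, dTwo]
    unfold Matrix.trace
    refine Finset.sum_congr rfl fun n _ => ?_
    simp only [Matrix.diagonal_pow, Matrix.diagonal_mul_diagonal, Matrix.diag_apply,
      Matrix.add_apply, Matrix.smul_apply, Matrix.diagonal_apply_eq, smul_eq_mul, Pi.pow_apply]
    rfl
  rw [h1, h2]

theorem interactionSlice_eq_sub (M : ℕ) (g : ℂ) {J : ℕ} (hJ : 1 ≤ J) (σ : Field) :
    interactionSlice M g J σ
      = interactionOn g (momenta M J) σ - interactionOn g (prevMomenta M J) σ := by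
  rw [interactionSlice, interactionLe_of_ne_zero M g (by omega)]
  unfold prevMomenta
  split_ifs with h
  · rw [interactionOn_empty, interactionLe, if_pos (by omega)]
  · rw [interactionLe_of_ne_zero M g (by omega)]

/-- The projection on the momenta below the slice. -/
def prevProj (M J : ℕ) : Matrix (momenta M J) (momenta M J) ℂ :=
  Matrix.diagonal fun n => if InSlice M J n then 0 else 1

/-- The projection on the momenta in the slice. -/
def sliceProj (M J : ℕ) : Matrix (momenta M J) (momenta M J) ℂ :=
  Matrix.diagonal fun n => if InSlice M J n then 1 else 0

theorem prevProj_mul_self (M J : ℕ) : prevProj M J * prevProj M J = prevProj M J := by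
  rw [prevProj, Matrix.diagonal_mul_diagonal]
  refine congrArg _ (funext fun n => ?_)
  split_ifs <;> simp

theorem one_sub_prevProj (M J : ℕ) : 1 - prevProj M J = sliceProj M J := by
  rw [prevProj, sliceProj, ← Matrix.diagonal_one, Matrix.diagonal_sub]
  refine congrArg _ (funext fun n => ?_)
  split_ifs <;> simp

variable {M : ℕ} {k ρ : ℝ} {g : ℂ}

/-- Replaces the operator with the lower cutoff by a compression of the one with the upper cutoff,
so that the algebra of resolvent pairs applies. -/
theorem SmallCoupling.traceLogThree_prev (h : SmallCoupling M k ρ g) (J : ℕ) {σ : Field}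
    (hσ : IsHermitianField σ) :
    traceLogThree (prevProj M J * fullOp g (momenta M J) σ * prevProj M J)
      = traceLogThree (fullOp g (prevMomenta M J) σ) := by
  have hsub := prevMomenta_subset h.one_lt J
  refine traceLogThree_embed (fun n => ⟨n, hsub n.2⟩) (fun a b hab => ?_) _ _ (fun a b => ?_)
    (fun i j hi => ?_) (fun i j hj => ?_) fun s hs => (h.isUnit_one_sub _ hσ hs).1
  · exact Subtype.ext (congrArg (fun x : momenta M J => (x : Momentum)) hab)
  · have h1 : ∀ a : prevMomenta M J, ¬ InSlice M J a := fun a ha => ha a.2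
    rw [prevProj, Matrix.mul_diagonal, Matrix.diagonal_mul, if_neg (h1 a), if_neg (h1 b), one_mul,
      mul_one]
    unfold fullOp
    rw [Matrix.add_apply, Matrix.add_apply, Matrix.diagonal_apply, Matrix.diagonal_apply]
    have h2 : ((⟨a, hsub a.2⟩ : momenta M J) = ⟨b, hsub b.2⟩) ↔ a = b := by
      rw [Subtype.mk.injEq, Subtype.ext_iff]
    simp only [h2]
    rfl
  · have h1 : InSlice M J i := fun hmem => hi ⟨⟨i, hmem⟩, rfl⟩
    rw [prevProj, Matrix.mul_diagonal, Matrix.diagonal_mul, if_pos h1, zero_mul, zero_mul]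
  · have h1 : InSlice M J j := fun hmem => hj ⟨⟨j, hmem⟩, rfl⟩
    rw [prevProj, Matrix.mul_diagonal, if_pos h1, mul_zero]

theorem sum_sub_sum_prev (hM : 1 < M) (J : ℕ) (f : Momentum → ℂ) :
    ∑ n ∈ momenta M J, f n - ∑ n ∈ prevMomenta M J, f n
      = ∑ n ∈ momenta M J, if InSlice M J n then f n else 0 := by
  rw [← Finset.sum_filter, sub_eq_iff_eq_add', ← Finset.sum_sdiff (prevMomenta_subset hM J),
    add_comm]
  congr 1
  refine Finset.sum_congr ?_ fun _ _ => rfl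
  ext n
  rw [Finset.mem_sdiff, Finset.mem_filter]
  rfl

theorem sum_sum_sub_sum_sum_prev (hM : 1 < M) (J : ℕ) (f : Momentum → Momentum → ℂ) :
    ∑ m ∈ momenta M J, ∑ n ∈ momenta M J, f m n - ∑ m ∈ prevMomenta M J, ∑ n ∈ prevMomenta M J, f m n
      = ∑ m ∈ momenta M J, ∑ n ∈ momenta M J,
        if InSlice M J m ∨ InSlice M J n then f m n else 0 := by
  have h1 := fun m => sum_sub_sum_prev hM J (f m)
  have h2 := sum_sub_sum_prev hM J fun m => ∑ n ∈ prevMomenta M J, f m n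
  have h3 : ∀ m, ∑ n ∈ momenta M J, f m n = ∑ n ∈ prevMomenta M J, f m n
      + ∑ n ∈ momenta M J, if InSlice M J n then f m n else 0 := fun m => by rw [← h1]; ring
  have h4 : ∑ m ∈ momenta M J, ∑ n ∈ momenta M J, f m n
      = ∑ m ∈ momenta M J, ∑ n ∈ prevMomenta M J, f m n
        + ∑ m ∈ momenta M J, ∑ n ∈ momenta M J, if InSlice M J n then f m n else 0 := by
    rw [← Finset.sum_add_distrib]
    exact Finset.sum_congr rfl fun m _ => h3 m
  rw [h4, add_sub_right_comm, h2, ← Finset.sum_add_distrib]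
  refine Finset.sum_congr rfl fun m _ => ?_
  by_cases hm : InSlice M J m
  · rw [if_pos hm, ← h3 m]
    exact Finset.sum_congr rfl fun n _ => (if_pos (Or.inl hm)).symm
  · rw [if_neg hm, zero_add]
    refine Finset.sum_congr rfl fun n _ => ?_
    by_cases hn : InSlice M J n
    · rw [if_pos hn, if_pos (Or.inr hn)]
    · rw [if_neg hn, if_neg (not_or.2 ⟨hm, hn⟩)]

/-- The slice part of Tr(D₁ + D₂)³/3 is added to the logarithms and removed from the counterterms.
Its first terms are D₁³/3 + D₁²D₂, so the counterterms reduce to quantities bounded in each slice.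
-/
theorem SmallCoupling.interactionSlice_eq (h : SmallCoupling M k ρ g) {J : ℕ} (hJ : 1 ≤ J)
    {σ : Field} (hσ : IsHermitianField σ) :
    interactionSlice M g J σ
      = (traceLogThree (fullOp g (momenta M J) σ)
          - traceLogThree (prevProj M J * fullOp g (momenta M J) σ * prevProj M J)
          + (∑ n ∈ momenta M J, if InSlice M J n then entrySum g n ^ 3 else 0) / 3)
        + (∑ m ∈ momenta M J, ∑ n ∈ momenta M J,
          if InSlice M J m ∨ InSlice M J n then counterEntry g σ m n else 0)
        + ∑ n ∈ momenta M J, if InSlice M J n then (1 / 4 : ℂ) * entryOne g n ^ 4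
          - entryOne g n * entryTwo g n ^ 2 - entryTwo g n ^ 3 / 3 else 0 := by
  have h1 : ∑ n ∈ momenta M J, (if InSlice M J n then (1 / 4 : ℂ) * entryOne g n ^ 4
          - entryOne g n * entryTwo g n ^ 2 - entryTwo g n ^ 3 / 3 else 0)
      = (∑ n ∈ momenta M J, if InSlice M J n then vacuumEntry g n else 0)
        - (∑ n ∈ momenta M J, if InSlice M J n then entrySum g n ^ 3 else 0) / 3 := by
    rw [Finset.sum_div, ← Finset.sum_sub_distrib]
    refine Finset.sum_congr rfl fun n _ => ?_
    split_ifs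
    · unfold vacuumEntry entrySum
      ring
    · simp
  rw [h1, interactionSlice_eq_sub M g hJ, h.traceLogThree_prev J hσ,
    ← sum_sum_sub_sum_sum_prev h.one_lt, ← sum_sub_sum_prev h.one_lt J (vacuumEntry g),
    interactionOn, interactionOn]
  ring

end Decomposition

end TensorT44
end

noncomputable section

namespace TensorT44

open MeasureTheory ProbabilityTheory Complex

/-! ### Relations between the weights. -/

section WeightOrder

theorem wDiag_nonneg (M J : ℕ) (m n : Momentum) : 0 ≤ wDiag M J m n := by
  unfold wDiag
  split_ifs <;> positivity

theorem wHalf_nonneg (M J : ℕ) (m n : Momentum) : 0 ≤ wHalf M J m n := by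
  have h1 := propagator_pos m
  have h2 := propagator_pos n
  unfold wHalf
  split_ifs <;> positivity

theorem wOne_nonneg (M J : ℕ) (m n : Momentum) : 0 ≤ wOne M J m n := by
  have h1 := propagator_pos m
  have h2 := propagator_pos n
  unfold wOne
  split_ifs <;> positivity

theorem wTwo_nonneg (M J : ℕ) (m n : Momentum) : 0 ≤ wTwo M J m n := by
  have h1 := propagator_pos m
  have h2 := propagator_pos n
  unfold wTwo
  split_ifs <;> positivity

theorem wLow_nonneg (K : ℝ) (m n : Momentum) : 0 ≤ wLow K m n := by
  have h1 := propagator_pos m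
  have h2 := propagator_pos n
  unfold wLow
  split_ifs <;> positivity

theorem quadForm_wSmall (M J : ℕ) (F : Finset Momentum) (σ : Field) :
    quadForm F (wSmall M J) σ = quadForm F (wDiag M J) σ + quadForm F (wHalf M J) σ
      + (80 * etaScale M J ^ 5 + 6400 * etaScale M J ^ 6) * quadForm F (wTwo M J) σ
      + 6400 * (etaScale M J ^ 6)⁻¹ * quadForm F (wLow (etaScale M J ^ 4)) σ := by
  rw [← quadForm_mul, ← quadForm_mul, ← quadForm_add, ← quadForm_add, ← quadForm_add]
  rfl

theorem quadForm_wLarge (M J : ℕ) (F : Finset Momentum) (σ : Field) :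
    quadForm F (wLarge M J) σ = quadForm F (wDiag M J) σ + quadForm F (wHalf M J) σ
      + quadForm F (wOne M J) σ := by
  rw [← quadForm_add, ← quadForm_add]
  rfl

theorem quadForm_wOne_le (M J : ℕ) (σ : Field) :
    quadForm (momenta M J) (wOne M J) σ
      ≤ (M : ℝ) ^ J * quadForm (momenta M J) (wHalf M J) σ := by
  rw [← quadForm_mul]
  refine Finset.sum_le_sum fun m hm => Finset.sum_le_sum fun n _ =>
    mul_le_mul_of_nonneg_right ?_ (sq_nonneg _)
  have h1 := propagator_pos m
  have h2 := propagator_pos n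
  have h3 := one_le_mul_sqrt_propagator hm
  unfold wOne wHalf
  by_cases hm' : InSlice M J m
  · simp only [if_pos hm']
    calc _ = propagator m * propagator n * 1 := (mul_one _).symm
      _ ≤ propagator m * propagator n * ((M : ℝ) ^ J * √(propagator m)) := by gcongr
      _ ≤ propagator m * propagator n * ((M : ℝ) ^ J * (√(propagator m) + √(propagator n))) := by
        gcongr
        exact le_add_of_nonneg_right (Real.sqrt_nonneg _)
      _ = _ := by ring
  · simp only [if_neg hm', mul_zero, le_refl]

end WeightOrder

/-! ### The terms of a slice that contain no resolvent. -/

section SliceBounds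

open scoped Matrix.Norms.L2Operator

variable {M : ℕ} {k ρ : ℝ} {g : ℂ} {J : ℕ} {σ : Field}

theorem norm_sliceIndicator_le (M J : ℕ) (n : Momentum) :
    ‖(if InSlice M J n then 1 else 0 : ℂ)‖ ≤ 1 := by
  split_ifs <;> simp

theorem norm_prevIndicator_le (M J : ℕ) (n : Momentum) :
    ‖(if InSlice M J n then 0 else 1 : ℂ)‖ ≤ 1 := by
  split_ifs <;> simp

theorem hsSq_sliceProj_le (hM : 1 < M) (J : ℕ) : hsSq (sliceProj M J) ≤ (9 * ((M : ℝ) ^ J) ^ 2) ^ 2 := by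
  have h1 : hsSq (sliceProj M J) ≤ ((momenta M J).card : ℝ) := by
    unfold hsSq
    calc _ ≤ ∑ m : momenta M J, (1 : ℝ) := by
          refine Finset.sum_le_sum fun m _ => ?_
          rw [Finset.sum_eq_single m]
          · rw [sliceProj, Matrix.diagonal_apply_eq]
            exact pow_le_one₀ (norm_nonneg _) (norm_sliceIndicator_le M J m)
          · intro n _ hn
            rw [sliceProj, Matrix.diagonal_apply_ne _ hn.symm]
            simp
          · intro hm
            exact absurd (Finset.mem_univ m) hm
      _ = _ := by rw [Finset.sum_const, nsmul_eq_mul, mul_one, Finset.card_univ, Fintype.card_coe]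
  refine h1.trans ((card_momenta_le hM J).trans (le_of_eq (by ring)))

theorem sum_slice_le (hM : 1 < M) (J : ℕ) {f : Momentum → ℝ} {c : ℝ} (hc : 0 ≤ c)
    (hf : ∀ n ∈ momenta M J, f n ≤ c * (((M : ℝ) ^ J) ^ 4)⁻¹) :
    ∑ n ∈ momenta M J, f n ≤ 81 * c := by
  have hM0 : (0 : ℝ) < M := by exact_mod_cast (by omega : 0 < M)
  calc _ ≤ ∑ n ∈ momenta M J, c * (((M : ℝ) ^ J) ^ 4)⁻¹ := Finset.sum_le_sum hf
    _ = ((momenta M J).card : ℝ) * (c * (((M : ℝ) ^ J) ^ 4)⁻¹) := by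
      rw [Finset.sum_const, nsmul_eq_mul]
    _ ≤ (81 * ((M : ℝ) ^ J) ^ 4) * (c * (((M : ℝ) ^ J) ^ 4)⁻¹) := by
      have := card_momenta_le hM J
      gcongr
    _ = _ := by field_simp

/-- The trace is linear in the diagonal entries of σ. By 2|σ_nn| ≤ 1 + |σ_nn|² it becomes a constant
plus a quadratic form; the weight N⁻⁴ matches the at most 81 N⁴ momenta. -/
theorem norm_trace_diag_hermOp_le (hM : 1 < M) (J : ℕ) (σ : Field) {x y : momenta M J → ℂ} {c : ℝ}
    (hc : 0 ≤ c) (h : ∀ n : momenta M J, ‖x n‖ * ‖y n‖ * propagator n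
      ≤ if InSlice M J n then 2 * c * (((M : ℝ) ^ J) ^ 4)⁻¹ else 0) :
    ‖(Matrix.diagonal x * hermOp (momenta M J) σ * Matrix.diagonal y).trace‖
      ≤ c * (81 + quadForm (momenta M J) (wDiag M J) σ) := by
  have h1 : ‖(Matrix.diagonal x * hermOp (momenta M J) σ * Matrix.diagonal y).trace‖
      ≤ ∑ n : momenta M J, ((if InSlice M J n then c * (((M : ℝ) ^ J) ^ 4)⁻¹ else 0)
        + c * (wDiag M J n n * ‖tensorSum σ n n‖ ^ 2)) := by
    unfold Matrix.trace
    refine (norm_sum_le _ _).trans (Finset.sum_le_sum fun n _ => ?_)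
    rw [Matrix.diag_apply, Matrix.mul_diagonal, Matrix.diagonal_mul, norm_mul, norm_mul,
      norm_hermOp_apply, Real.mul_self_sqrt (propagator_pos _).le]
    have h2 := mul_le_mul_of_nonneg_right (h n) (norm_nonneg (tensorSum σ n n))
    refine le_trans (le_of_eq (by ring)) (h2.trans ?_)
    unfold wDiag
    by_cases hn : InSlice M J n
    · rw [if_pos hn, if_pos hn, if_pos ⟨rfl, hn⟩]
      have h3 : 2 * ‖tensorSum σ n n‖ ≤ 1 + ‖tensorSum σ n n‖ ^ 2 := by
        nlinarith [sq_nonneg (‖tensorSum σ n n‖ - 1)]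
      have h4 : 0 ≤ c * (((M : ℝ) ^ J) ^ 4)⁻¹ := by positivity
      nlinarith
    · rw [if_neg hn, if_neg hn, if_neg fun h => hn h.2]
      simp
  refine h1.trans ?_
  rw [Finset.sum_add_distrib, ← Finset.mul_sum, mul_add, mul_comm c 81]
  refine add_le_add ?_ (mul_le_mul_of_nonneg_left ?_ hc)
  · rw [Finset.sum_coe_sort (momenta M J)
      fun n => if InSlice M J n then c * (((M : ℝ) ^ J) ^ 4)⁻¹ else 0]
    refine sum_slice_le hM J hc fun n _ => ?_
    split_ifs
    · exact le_rfl
    · positivity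
  · rw [Finset.sum_coe_sort (momenta M J) fun n => wDiag M J n n * ‖tensorSum σ n n‖ ^ 2]
    refine Finset.sum_le_sum fun m hm => ?_
    exact Finset.single_le_sum (f := fun n => wDiag M J m n * ‖tensorSum σ m n‖ ^ 2)
      (fun n _ => mul_nonneg (wDiag_nonneg M J m n) (sq_nonneg _)) hm

namespace SmallCoupling

theorem norm_sigmaEntry (g : ℂ) (σ : Field) (m n : Momentum) :
    ‖sigmaEntry g σ m n‖
      = ‖coupling g‖ * (√(propagator m) * √(propagator n) * ‖tensorSum σ m n‖) := by
  unfold sigmaEntry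
  simp only [norm_mul, norm_I, norm_real, Real.norm_eq_abs, abs_of_nonneg (Real.sqrt_nonneg _)]
  ring

/-- The counterterm is bounded alone, without cancellation against the logarithm: D₁ = O(C^{1/2})
already makes it a form with the weight `wHalf`, of bounded trace. Symmetrizing the condition that
`m` or `n` is in the slice produces the sum of square roots in that weight. -/
theorem norm_counter_le (h : SmallCoupling M k ρ g) (hσ : IsHermitianField σ) (J : ℕ) :
    ‖∑ m ∈ momenta M J, ∑ n ∈ momenta M J,
          if InSlice M J m ∨ InSlice M J n then counterEntry g σ m n else 0‖
      ≤ k * ‖coupling g‖ ^ 4 * quadForm (momenta M J) (wHalf M J) σ := by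
  set κ := k * ‖coupling g‖ ^ 4 with hκ
  have hκ0 : 0 ≤ κ := mul_nonneg (zero_le_one.trans h.one_le) (by positivity)
  set t : Momentum → Momentum → ℝ := fun m n =>
    κ * (√(propagator m) * propagator m * propagator n * ‖tensorSum σ m n‖ ^ 2) with ht
  have ht0 : ∀ m n, 0 ≤ t m n := fun m n => by
    have := propagator_pos m
    have := propagator_pos n
    positivity
  have hce : ∀ m n, ‖counterEntry g σ m n‖ ≤ t m n := by
    intro m n
    have h1 := propagator_pos m
    have h2 := propagator_pos n
    unfold counterEntry
    rw [norm_mul, norm_mul, norm_sigmaEntry, norm_sigmaEntry, norm_tensorSum_comm hσ m n]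
    calc _ ≤ k * ‖coupling g‖ ^ 2 * √(propagator m)
          * (‖coupling g‖ * (√(propagator m) * √(propagator n) * ‖tensorSum σ m n‖)
            * (‖coupling g‖ * (√(propagator n) * √(propagator m) * ‖tensorSum σ m n‖))) := by
          have := h.norm_entryOne_le m
          gcongr
      _ = κ * (√(propagator m) * √(propagator m) ^ 2 * √(propagator n) ^ 2
            * ‖tensorSum σ m n‖ ^ 2) := by rw [hκ]; ring
      _ = _ := by rw [Real.sq_sqrt h1.le, Real.sq_sqrt h2.le]
  calc _ ≤ ∑ m ∈ momenta M J, ∑ n ∈ momenta M J, ((if InSlice M J m then t m n else 0)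
          + (if InSlice M J n then t m n else 0)) := by
        refine (norm_sum_le _ _).trans (Finset.sum_le_sum fun m _ => ?_)
        refine (norm_sum_le _ _).trans (Finset.sum_le_sum fun n _ => ?_)
        have h1 := hce m n
        have h2 := ht0 m n
        by_cases hm : InSlice M J m <;> by_cases hn : InSlice M J n <;> simp [hm, hn] <;> linarith
    _ = ∑ m ∈ momenta M J, ∑ n ∈ momenta M J, ((if InSlice M J m then t m n else 0)
          + (if InSlice M J m then t n m else 0)) := by
        simp only [Finset.sum_add_distrib]
        congr 1
        rw [Finset.sum_comm]
    _ = _ := by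
        rw [← quadForm_mul]
        refine Finset.sum_congr rfl fun m _ => Finset.sum_congr rfl fun n _ => ?_
        unfold wHalf
        by_cases hm : InSlice M J m
        · simp only [if_pos hm, ht]
          rw [norm_tensorSum_comm hσ m n]
          ring
        · simp only [if_neg hm, mul_zero, zero_mul, add_zero]

theorem norm_vacuum_le (h : SmallCoupling M k ρ g) (J : ℕ) :
    ‖∑ n ∈ momenta M J, if InSlice M J n then (1 / 4 : ℂ) * entryOne g n ^ 4
          - entryOne g n * entryTwo g n ^ 2 - entryTwo g n ^ 3 / 3 else 0‖
      ≤ 243 * (k ^ 4 * M ^ 4) * ‖coupling g‖ ^ 2 := by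
  have hk := h.one_le
  have hM := h.one_le_M
  refine (norm_sum_le _ _).trans ((sum_slice_le h.one_lt J
    (c := 3 * (k ^ 4 * M ^ 4) * ‖coupling g‖ ^ 2) (by positivity) fun n _ => ?_).trans
      (le_of_eq (by ring)))
  split_ifs with hn
  · refine (h.norm_vacuum_rest_le n).trans ?_
    have h1 := propagator_le_of_inSlice h.one_lt hn
    have h2 := (propagator_pos n).le
    calc _ ≤ 3 * k ^ 4 * ‖coupling g‖ ^ 2 * ((M : ℝ) ^ 2 / ((M : ℝ) ^ J) ^ 2) ^ 2 := by gcongr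
      _ = _ := by rw [div_pow, div_eq_mul_inv]; ring
  · rw [norm_zero]
    positivity

end SmallCoupling

end SliceBounds

end TensorT44
end

noncomputable section

namespace TensorT44

open MeasureTheory ProbabilityTheory Complex

/-! ### Reduction to the term cubic in the field, and the bound for all fields. -/

section PathwiseBounds

open scoped Matrix.Norms.L2Operator

variable {M : ℕ} {k ρ : ℝ} {g : ℂ} {J : ℕ} {σ : Field}

/-- The part of `D₁ + D₂` in the slice. -/
def sliceDiag (M : ℕ) (g : ℂ) (J : ℕ) : Matrix (momenta M J) (momenta M J) ℂ :=
  Matrix.diagonal fun n => if InSlice M J n then entrySum g n else 0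

theorem sliceProj_mul_fullOp (M : ℕ) (g : ℂ) (J : ℕ) (σ : Field) :
    sliceProj M J * fullOp g (momenta M J) σ
      = (I * coupling g) • (sliceProj M J * hermOp (momenta M J) σ) + sliceDiag M g J := by
  rw [fullOp, mul_add, mul_smul_comm, sliceProj, Matrix.diagonal_mul_diagonal, sliceDiag]
  refine congrArg _ (congrArg _ (funext fun n => ?_))
  split_ifs <;> simp

theorem fullOp_mul_sliceProj (M : ℕ) (g : ℂ) (J : ℕ) (σ : Field) :
    fullOp g (momenta M J) σ * sliceProj M J
      = (I * coupling g) • (hermOp (momenta M J) σ * sliceProj M J) + sliceDiag M g J := by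
  rw [fullOp, add_mul, smul_mul_assoc, sliceProj, Matrix.diagonal_mul_diagonal, sliceDiag]
  refine congrArg _ (congrArg _ (funext fun n => ?_))
  split_ifs <;> simp

theorem sliceProj_mul_sliceDiag (M : ℕ) (g : ℂ) (J : ℕ) :
    sliceProj M J * sliceDiag M g J = sliceDiag M g J := by
  rw [sliceProj, sliceDiag, Matrix.diagonal_mul_diagonal]
  refine congrArg _ (funext fun n => ?_)
  split_ifs <;> simp

theorem sliceDiag_mul_sliceProj (M : ℕ) (g : ℂ) (J : ℕ) :
    sliceDiag M g J * sliceProj M J = sliceDiag M g J := by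
  rw [sliceProj, sliceDiag, Matrix.diagonal_mul_diagonal]
  refine congrArg _ (funext fun n => ?_)
  split_ifs <;> simp

theorem trace_sliceDiag_cube (M : ℕ) (g : ℂ) (J : ℕ) :
    (sliceDiag M g J * sliceDiag M g J * sliceDiag M g J).trace
      = ∑ n ∈ momenta M J, if InSlice M J n then entrySum g n ^ 3 else 0 := by
  rw [← Finset.sum_coe_sort (momenta M J), sliceDiag, Matrix.diagonal_mul_diagonal,
    Matrix.diagonal_mul_diagonal, Matrix.trace_diagonal]
  refine Finset.sum_congr rfl fun n _ => ?_
  split_ifs <;> ring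

theorem norm_I_mul_coupling (g : ℂ) : ‖I * coupling g‖ = ‖coupling g‖ := by
  rw [norm_mul, norm_I, one_mul]

/-- The resolvents are absorbed by r²L² ≤ 4ρ. The loss N in q1 ≤ N qh is made up by the factor N⁻¹
of the diagonal part, and its fourth power balances (N²)². -/
theorem slice_arith {k M ρ L N r qd qh q1 : ℝ} (hk : 1 ≤ k) (hM : 1 ≤ M) (hN : 1 ≤ N) (hρ : 0 < ρ)
    (hrL : r ^ 2 * L ^ 2 ≤ 4 * ρ) (hL0 : 0 ≤ L) (hL1 : L ≤ 1) (hLρ : L ^ 2 ≤ ρ) (hqd0 : 0 ≤ qd)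
    (hqh0 : 0 ≤ qh) (hq10 : 0 ≤ q1) (hq1h : q1 ≤ N * qh) :
    3 * (2 * (k ^ 2 * M ^ 4) * L ^ 2 * (81 + qd))
      + r ^ 2 * (12 * (2 * k * M * L ^ 2 * N⁻¹) * (L * √q1) ^ 2
        + 6 * (2 * k * M * L ^ 2 * N⁻¹) ^ 4 * (9 * N ^ 2) ^ 2)
      + k * L ^ 4 * qh + 243 * (k ^ 4 * M ^ 4) * L ^ 2
      ≤ 40000 * (k ^ 4 * M ^ 4) * ρ * (1 + qd + qh) := by
  have hk24 : k ^ 2 ≤ k ^ 4 := pow_le_pow_right₀ hk (by norm_num)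
  have hk14 : k ≤ k ^ 4 := le_self_pow₀ hk (by norm_num)
  have hM14 : M ≤ M ^ 4 := le_self_pow₀ hM (by norm_num)
  have hM04 : 1 ≤ M ^ 4 := one_le_pow₀ hM
  have hL2 : L ^ 2 ≤ 1 := pow_le_one₀ hL0 hL1
  set K := k ^ 4 * M ^ 4 with hK
  have hK0 : 0 ≤ K := by positivity
  have b1 : 3 * (2 * (k ^ 2 * M ^ 4) * L ^ 2 * (81 + qd)) ≤ 6 * K * ρ * (81 + qd) := by
    calc _ = 6 * (k ^ 2 * M ^ 4) * L ^ 2 * (81 + qd) := by ring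
      _ ≤ _ := by rw [hK]; gcongr
  have b2 : r ^ 2 * (12 * (2 * k * M * L ^ 2 * N⁻¹) * (L * √q1) ^ 2) ≤ 96 * K * ρ * qh := by
    rw [mul_pow, Real.sq_sqrt hq10]
    calc _ = 24 * (k * M) * N⁻¹ * (L ^ 2) * (r ^ 2 * L ^ 2) * q1 := by ring
      _ ≤ 24 * K * N⁻¹ * 1 * (4 * ρ) * (N * qh) := by
        have : k * M ≤ K := by rw [hK]; gcongr
        gcongr
      _ = _ := by field_simp; ring
  have b3 : r ^ 2 * (6 * (2 * k * M * L ^ 2 * N⁻¹) ^ 4 * (9 * N ^ 2) ^ 2) ≤ 31104 * K * ρ := by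
    calc _ = 7776 * K * L ^ 6 * (r ^ 2 * L ^ 2) := by rw [hK]; field_simp; ring
      _ ≤ 7776 * K * 1 * (4 * ρ) := by
        have h2 : L ^ 6 ≤ 1 := pow_le_one₀ hL0 hL1
        gcongr
      _ = _ := by ring
  have b4 : k * L ^ 4 * qh ≤ K * ρ * qh := by
    have : k ≤ K := by
      rw [hK]
      calc k = k * 1 := (mul_one k).symm
        _ ≤ _ := by gcongr
    have h4 : L ^ 4 ≤ L ^ 2 := pow_le_pow_of_le_one hL0 hL1 (by norm_num)
    have h5 := h4.trans hLρ
    gcongr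
  have b5 : 243 * K * L ^ 2 ≤ 243 * K * ρ := by gcongr
  have hKρ : 0 ≤ K * ρ := by positivity
  have d1 : 0 ≤ K * ρ * qd := by positivity
  have d2 : 0 ≤ K * ρ * qh := by positivity
  rw [mul_add (r ^ 2)]
  linarith

namespace SmallCoupling

theorem norm_sliceEntry_le (h : SmallCoupling M k ρ g) (J : ℕ) (n : Momentum) :
    ‖(if InSlice M J n then entrySum g n else 0)‖
      ≤ 2 * k * M * ‖coupling g‖ ^ 2 * ((M : ℝ) ^ J)⁻¹ := by
  have hk := h.one_le
  have hM := h.one_le_M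
  have hN : 0 < (M : ℝ) ^ J := by positivity
  split_ifs with hn
  · refine (h.norm_entrySum_le n).trans ?_
    have h1 : √(propagator n) ≤ M * ((M : ℝ) ^ J)⁻¹ := by
      rw [← div_eq_mul_inv, le_div_iff₀ hN, mul_comm]
      exact mul_sqrt_propagator_le_of_inSlice h.one_lt hn
    calc _ ≤ 2 * k * ‖coupling g‖ ^ 2 * (M * ((M : ℝ) ^ J)⁻¹) := by gcongr
      _ = _ := by ring
  · rw [norm_zero]
    positivity

theorem norm_sliceDiag_le (h : SmallCoupling M k ρ g) (J : ℕ) :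
    ‖sliceDiag M g J‖ ≤ 2 * k * M * ‖coupling g‖ ^ 2 * ((M : ℝ) ^ J)⁻¹ := by
  have hk := h.one_le
  have hM := h.one_le_M
  exact l2_opNorm_diagonal_le (by positivity) fun n => h.norm_sliceEntry_le J n

theorem hsSq_slice_hermOp_le (M J : ℕ) (σ : Field) :
    hsSq (sliceProj M J * hermOp (momenta M J) σ) ≤ quadForm (momenta M J) (wOne M J) σ := by
  rw [← mul_one (sliceProj M J * _), ← Matrix.diagonal_one]
  refine hsSq_diag_hermOp_diag_le fun m n => ?_
  unfold wOne
  split_ifs <;> simp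

theorem hsSq_hermOp_slice_le (M J : ℕ) (hσ : IsHermitianField σ) :
    hsSq (hermOp (momenta M J) σ * sliceProj M J) ≤ quadForm (momenta M J) (wOne M J) σ := by
  rw [← one_mul (hermOp _ _), ← Matrix.diagonal_one]
  refine hsSq_diag_hermOp_diag_le_swap hσ fun m n => ?_
  unfold wOne
  split_ifs <;> simp

theorem hsSq_smul_le {ι : Type*} [Fintype ι] [DecidableEq ι] {X : Matrix ι ι ℂ} {q : ℝ} (g : ℂ) (hX : hsSq X ≤ q) :
    hsSq ((I * coupling g) • X) ≤ (‖coupling g‖ * √q) ^ 2 := by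
  rw [hsSq_smul, norm_I_mul_coupling, mul_pow, Real.sq_sqrt ((hsSq_nonneg X).trans hX)]
  exact mul_le_mul_of_nonneg_left hX (sq_nonneg _)

/-- Two diagonal slice entries O(N⁻¹) and one slice propagator O(N⁻²) give the weight N⁻⁴ required
by `norm_trace_diag_hermOp_le`. -/
theorem norm_trace_slice_diag_le (h : SmallCoupling M k ρ g) (J : ℕ) (σ : Field)
    {x y : momenta M J → ℂ} (hxy : ∀ n, ‖x n‖ * ‖y n‖
      = ‖(if InSlice M J n then entrySum g n else 0)‖ ^ 2) :
    ‖((I * coupling g) • (Matrix.diagonal x * hermOp (momenta M J) σ * Matrix.diagonal y)).trace‖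
      ≤ 2 * (k ^ 2 * M ^ 4) * ‖coupling g‖ ^ 2
        * (81 + quadForm (momenta M J) (wDiag M J) σ) := by
  have hk := h.one_le
  have hM := h.one_le_M
  have hqd0 : 0 ≤ quadForm (momenta M J) (wDiag M J) σ := quadForm_nonneg (wDiag_nonneg M J) σ
  rw [Matrix.trace_smul, smul_eq_mul, norm_mul, norm_I_mul_coupling]
  have h1 := norm_trace_diag_hermOp_le h.one_lt J σ (x := x) (y := y)
    (c := 2 * (k ^ 2 * M ^ 4) * ‖coupling g‖ ^ 4) (by positivity) fun n => ?_
  · calc _ ≤ ‖coupling g‖ * (2 * (k ^ 2 * M ^ 4) * ‖coupling g‖ ^ 4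
          * (81 + quadForm (momenta M J) (wDiag M J) σ)) := by gcongr
      _ = 2 * (k ^ 2 * M ^ 4) * ‖coupling g‖ ^ 5
          * (81 + quadForm (momenta M J) (wDiag M J) σ) := by ring
      _ ≤ _ := by
        have := h.norm_pow_le (i := 5) (by norm_num)
        gcongr
  · rw [hxy]
    by_cases hn : InSlice M J n
    · have h2 := h.norm_sliceEntry_le J n
      have h3 := propagator_le_of_inSlice h.one_lt hn
      have h4 := (propagator_pos (n : Momentum)).le
      simp only [if_pos hn] at h2 ⊢
      calc _ ≤ (2 * k * M * ‖coupling g‖ ^ 2 * ((M : ℝ) ^ J)⁻¹) ^ 2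
            * ((M : ℝ) ^ 2 / ((M : ℝ) ^ J) ^ 2) := by gcongr
        _ = _ := by rw [div_eq_mul_inv]; field_simp
    · simp only [if_neg hn, norm_zero]
      simp

theorem norm_trace_slice_one_le (h : SmallCoupling M k ρ g) (J : ℕ) (σ : Field) :
    ‖(sliceDiag M g J * sliceDiag M g J
      * ((I * coupling g) • (hermOp (momenta M J) σ * sliceProj M J))).trace‖
      ≤ 2 * (k ^ 2 * M ^ 4) * ‖coupling g‖ ^ 2
        * (81 + quadForm (momenta M J) (wDiag M J) σ) := by
  rw [mul_smul_comm, sliceDiag, Matrix.diagonal_mul_diagonal, ← mul_assoc]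
  refine h.norm_trace_slice_diag_le J σ fun n => ?_
  split_ifs <;> simp [sq]

theorem norm_trace_slice_two_le (h : SmallCoupling M k ρ g) (J : ℕ) (σ : Field) :
    ‖((I * coupling g) • (sliceProj M J * hermOp (momenta M J) σ)
      * (sliceDiag M g J * sliceDiag M g J)).trace‖
      ≤ 2 * (k ^ 2 * M ^ 4) * ‖coupling g‖ ^ 2
        * (81 + quadForm (momenta M J) (wDiag M J) σ) := by
  rw [smul_mul_assoc, sliceDiag, Matrix.diagonal_mul_diagonal]
  refine h.norm_trace_slice_diag_le J σ fun n => ?_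
  split_ifs <;> simp [sq]

theorem norm_trace_slice_three_le (h : SmallCoupling M k ρ g) (J : ℕ) (σ : Field) :
    ‖(sliceDiag M g J * ((I * coupling g) • (sliceProj M J * hermOp (momenta M J) σ))
      * sliceDiag M g J).trace‖
      ≤ 2 * (k ^ 2 * M ^ 4) * ‖coupling g‖ ^ 2
        * (81 + quadForm (momenta M J) (wDiag M J) σ) := by
  rw [mul_smul_comm, smul_mul_assoc, ← mul_assoc, sliceDiag_mul_sliceProj]
  exact h.norm_trace_slice_diag_le J σ fun n => (sq _).symm

theorem sliceBound_le_one (h : SmallCoupling M k ρ g) (J : ℕ) :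
    2 * k * M * ‖coupling g‖ ^ 2 * ((M : ℝ) ^ J)⁻¹ ≤ 1 := by
  have hk := h.one_le
  have hM := h.one_le_M
  have hρ := h.rho_pos
  have h1 := h.normSq_le
  have h2 := h.small
  have hNinv : ((M : ℝ) ^ J)⁻¹ ≤ 1 := inv_le_one_of_one_le₀ (one_le_pow₀ hM)
  calc _ ≤ 2 * k * M * ρ * 1 := by gcongr
    _ ≤ 1 := by
      have : 0 ≤ k * M * ρ := by positivity
      linarith

/-- The trace of the logarithm is reduced to its leading part, cubic in the field. -/
theorem norm_traceLogThree_slice_le (h : SmallCoupling M k ρ g) (J : ℕ)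
    (hσ : IsHermitianField σ) {b l δ : ℝ}
    (hl : l = 2 * (k ^ 2 * M ^ 4) * ‖coupling g‖ ^ 2
        * (81 + quadForm (momenta M J) (wDiag M J) σ))
    (hδ : δ = 2 * k * M * ‖coupling g‖ ^ 2 * ((M : ℝ) ^ J)⁻¹)
    (hb : ∀ s ∈ Set.Icc (0 : ℝ) 1, ∀ R R',
      ResolventPair (fullOp g (momenta M J) σ) (prevProj M J) (sliceProj M J) R R' (s : ℂ) →
      ‖R‖ ≤ 2 / Real.cos (arg g / 2) → ‖R'‖ ≤ 2 / Real.cos (arg g / 2) →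
      ‖(s : ℂ) ^ 2 * ((I * coupling g) • (sliceProj M J * hermOp (momenta M J) σ)
        * ResolventPair.core (fullOp g (momenta M J) σ) (prevProj M J) R R'
        * ((I * coupling g) • (hermOp (momenta M J) σ * sliceProj M J))).trace‖ ≤ b) :
    ‖traceLogThree (fullOp g (momenta M J) σ)
        - traceLogThree (prevProj M J * fullOp g (momenta M J) σ * prevProj M J)
        + (∑ n ∈ momenta M J, if InSlice M J n then entrySum g n ^ 3 else 0) / 3‖
      ≤ b + (3 * l + (2 / Real.cos (arg g / 2)) ^ 2
        * (12 * δ * (‖coupling g‖ * √(quadForm (momenta M J) (wOne M J) σ)) ^ 2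
          + 6 * δ ^ 4 * (9 * ((M : ℝ) ^ J) ^ 2) ^ 2)) := by
  have hk := h.one_le
  have hM := h.one_le_M
  have hδ0 : 0 ≤ δ := by rw [hδ]; positivity
  have hl0 : 0 ≤ l := by
    have hqd0 : 0 ≤ quadForm (momenta M J) (wDiag M J) σ := quadForm_nonneg (wDiag_nonneg M J) σ
    rw [hl]; positivity
  have hPn : ‖prevProj M J‖ ≤ 1 :=
    l2_opNorm_diagonal_le zero_le_one fun n => norm_prevIndicator_le M J n
  have hx : ∀ n : momenta M J, star (if InSlice M J n then 0 else 1 : ℂ)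
      = if InSlice M J n then 0 else 1 := fun n => by
    split_ifs <;> simp
  refine norm_traceLogThree_sub_le (prevProj_mul_self M J)
    (fun s hs => (h.isUnit_one_sub _ hσ hs).1)
    (fun s hs => (h.resolvent_bound _ hσ hx (fun n => norm_prevIndicator_le M J n) hs).1)
    fun s hs => ?_
  have hu := h.isUnit_one_sub (momenta M J) hσ hs
  have hu' := h.resolvent_bound (momenta M J) hσ hx (fun n => norm_prevIndicator_le M J n) hs
  have hpair := ResolventPair.of_isUnit (prevProj_mul_self M J) hu.1 hu'.1
  rw [one_sub_prevProj] at hpair ⊢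
  have hs1 : ‖(s : ℂ)‖ ≤ 1 := by
    rw [norm_real, Real.norm_eq_abs, abs_of_nonneg hs.1]
    exact hs.2
  have h1 := hb s hs _ _ hpair hu.2 hu'.2
  have h2 := ResolventPair.norm_trace_split_le hpair (sliceProj_mul_fullOp M g J σ)
    (fullOp_mul_sliceProj M g J σ) (sliceProj_mul_sliceDiag M g J)
    (sliceDiag_mul_sliceProj M g J) h.one_le_resolvent hδ0
    (hδ.trans_le (h.sliceBound_le_one J)) (mul_nonneg (norm_nonneg _) (Real.sqrt_nonneg _))
    (mul_nonneg (by norm_num) (sq_nonneg _)) hs1 hPn hu.2 hu'.2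
    ((h.norm_sliceDiag_le J).trans hδ.ge) (hsSq_smul_le g (hsSq_slice_hermOp_le M J σ))
    (hsSq_smul_le g (hsSq_hermOp_slice_le M J hσ)) (hsSq_sliceProj_le h.one_lt J)
    ((h.norm_trace_slice_one_le J σ).trans hl.ge) ((h.norm_trace_slice_two_le J σ).trans hl.ge)
    ((h.norm_trace_slice_three_le J σ).trans hl.ge)
  rw [trace_sliceDiag_cube] at h2
  rw [sliceProj_mul_fullOp, fullOp_mul_sliceProj, ← mul_sub, norm_mul]
  rw [norm_mul] at h1
  have hs2 : ‖(s : ℂ) ^ 2‖ ≤ 1 := by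
    rw [norm_pow]
    exact pow_le_one₀ (norm_nonneg _) hs1
  refine (mul_le_mul_of_nonneg_left h2 (norm_nonneg _)).trans ?_
  -- The factor s² is kept in the term with the field at both ends, where `norm_trace_core_le`
  -- consumes it, and is bounded by 1 elsewhere.
  rw [add_assoc, mul_add]
  exact add_le_add h1 (mul_le_of_le_one_left (by positivity) hs2)

/-- Reduction of the interaction to its leading part, cubic in the field. -/
theorem norm_interactionSlice_le_of_core (h : SmallCoupling M k ρ g) (hJ : 1 ≤ J)
    (hσ : IsHermitianField σ) {b : ℝ}
    (hb : ∀ s ∈ Set.Icc (0 : ℝ) 1, ∀ R R',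
      ResolventPair (fullOp g (momenta M J) σ) (prevProj M J) (sliceProj M J) R R' (s : ℂ) →
      ‖R‖ ≤ 2 / Real.cos (arg g / 2) → ‖R'‖ ≤ 2 / Real.cos (arg g / 2) →
      ‖(s : ℂ) ^ 2 * ((I * coupling g) • (sliceProj M J * hermOp (momenta M J) σ)
        * ResolventPair.core (fullOp g (momenta M J) σ) (prevProj M J) R R'
        * ((I * coupling g) • (hermOp (momenta M J) σ * sliceProj M J))).trace‖ ≤ b) :
    ‖interactionSlice M g J σ‖ ≤ b + 40000 * (k ^ 4 * M ^ 4) * ρ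
      * (1 + quadForm (momenta M J) (wDiag M J) σ + quadForm (momenta M J) (wHalf M J) σ) := by
  have hmain := h.norm_traceLogThree_slice_le J hσ rfl rfl hb
  have c1 := h.norm_counter_le hσ J
  have c2 := h.norm_vacuum_le J
  have hqd0 : 0 ≤ quadForm (momenta M J) (wDiag M J) σ := quadForm_nonneg (wDiag_nonneg M J) σ
  have hqh0 : 0 ≤ quadForm (momenta M J) (wHalf M J) σ := quadForm_nonneg (wHalf_nonneg M J) σ
  have hq10 : 0 ≤ quadForm (momenta M J) (wOne M J) σ := quadForm_nonneg (wOne_nonneg M J) σ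
  have hq1h := quadForm_wOne_le M J σ
  rw [h.interactionSlice_eq hJ hσ]
  refine (norm_add_le _ _).trans ((add_le_add ((norm_add_le _ _).trans
    (add_le_add hmain c1)) c2).trans ?_)
  have := slice_arith h.one_le h.one_le_M (one_le_pow₀ h.one_le_M : 1 ≤ (M : ℝ) ^ J) h.rho_pos
    h.resolvent_sq_mul_le (norm_nonneg _) h.norm_le_one h.normSq_le hqd0 hqh0 hq10 hq1h
  linarith

/-- The core is estimated by resolvents only, which needs no information on the field; the price is
the weight `wOne`, whose trace may be of order N. -/
theorem norm_interactionSlice_le_large (h : SmallCoupling M k ρ g) (hJ : 1 ≤ J)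
    (hσ : IsHermitianField σ) :
    ‖interactionSlice M g J σ‖ ≤ 50000 * (k ^ 4 * M ^ 4) * ρ
      * (1 + quadForm (momenta M J) (wLarge M J) σ) := by
  have hk := h.one_le
  have hM := h.one_le_M
  have hρ := h.rho_pos
  have hq10 : 0 ≤ quadForm (momenta M J) (wOne M J) σ := quadForm_nonneg (wOne_nonneg M J) σ
  have hqd0 : 0 ≤ quadForm (momenta M J) (wDiag M J) σ := quadForm_nonneg (wDiag_nonneg M J) σ
  have hqh0 : 0 ≤ quadForm (momenta M J) (wHalf M J) σ := quadForm_nonneg (wHalf_nonneg M J) σ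
  have hPn : ‖prevProj M J‖ ≤ 1 :=
    l2_opNorm_diagonal_le zero_le_one fun n => norm_prevIndicator_le M J n
  have hK : 1 ≤ k ^ 4 * (M : ℝ) ^ 4 := one_le_mul_of_one_le_of_one_le (one_le_pow₀ hk)
    (one_le_pow₀ hM)
  have key := h.norm_interactionSlice_le_of_core hJ hσ
    (b := 24 * ρ * quadForm (momenta M J) (wOne M J) σ) fun s hs R R' hp hR hR' => ?_
  · rw [quadForm_wLarge]
    generalize quadForm (momenta M J) (wOne M J) σ = q1 at *
    generalize quadForm (momenta M J) (wDiag M J) σ = qd at *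
    generalize quadForm (momenta M J) (wHalf M J) σ = qh at *
    set K := k ^ 4 * (M : ℝ) ^ 4
    have e1 : 24 * ρ * q1 ≤ 50000 * K * ρ * q1 := by
      have : 24 * 1 * (ρ * q1) ≤ 50000 * K * (ρ * q1) := by gcongr; norm_num
      linarith
    have e2 : 40000 * K * ρ * (1 + qd + qh) ≤ 50000 * K * ρ * (1 + qd + qh) := by
      gcongr; norm_num
    linarith
  · have hs1 : ‖(s : ℂ)‖ ≤ 1 := by
      rw [norm_real, Real.norm_eq_abs, abs_of_nonneg hs.1]
      exact hs.2
    refine (hp.norm_trace_core_le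
      (a := ‖coupling g‖ * √(quadForm (momenta M J) (wOne M J) σ)) h.one_le_resolvent
      (mul_nonneg (norm_nonneg _) (Real.sqrt_nonneg _)) hs1 hPn hR hR'
      (hsSq_smul_le g (hsSq_slice_hermOp_le M J σ))
      (hsSq_smul_le g (hsSq_hermOp_slice_le M J hσ))).trans ?_
    have hr := h.resolvent_sq_mul_le
    clear hp hR hR' hPn
    rw [mul_pow, Real.sq_sqrt hq10]
    generalize quadForm (momenta M J) (wOne M J) σ = q1 at *
    calc _ = 6 * ((2 / Real.cos (arg g / 2)) ^ 2 * ‖coupling g‖ ^ 2) * q1 := by ring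
      _ ≤ 6 * (4 * ρ) * q1 := by gcongr
      _ = _ := by ring

end SmallCoupling

end PathwiseBounds

end TensorT44
end

noncomputable section

namespace TensorT44

open MeasureTheory ProbabilityTheory Complex

/-! ### The bound for fields of moderate operator norm. -/

section SmallFields

open scoped Matrix.Norms.L2Operator

variable {M : ℕ} {k ρ : ℝ} {g : ℂ} {J : ℕ} {σ : Field}

/-- `hsSq_hermOp_sq_le` with columns separated at C(n) = η⁻⁴. With t = 320 η⁵, b = M η⁻⁸ and ε =
η⁻², the factors (bt)² and (tε)² are of order η⁻⁶ and η⁶, the coefficients of `wLow` and `wTwo` in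
`wSmall`; 2 · 320² = 32 · 6400. -/
theorem hsSq_slice_hermOp_mul_hermOp_le (hM : 1 < M) (J : ℕ) (hσ : IsHermitianField σ)
    (ht : ‖tensorOp (momenta M J) σ‖ ≤ 320 * etaScale M J ^ 5) {y : momenta M J → ℂ}
    (hy : ∀ n, ‖y n‖ ≤ 1) :
    hsSq (sliceProj M J * hermOp (momenta M J) σ * Matrix.diagonal y * hermOp (momenta M J) σ)
      ≤ 32 * M ^ 2 * quadForm (momenta M J) (wSmall M J) σ := by
  have hη := one_le_etaScale hM J
  have hη0 : 0 < etaScale M J := by linarith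
  have hM1 : (1 : ℝ) ≤ M := by exact_mod_cast hM.le
  have hp := etaScale_pow M J
  have h1 := hsSq_hermOp_sq_le (F := momenta M J) hσ
    (x := fun n => if InSlice M J n then 1 else 0)
    (y := y) (p := fun n => 1 ≤ etaScale M J ^ 4 * propagator n) (v := wLow (etaScale M J ^ 4))
    (w := wTwo M J) (b := M * (etaScale M J ^ 8)⁻¹) (ε := (etaScale M J ^ 2)⁻¹) ht (by positivity)
    (by positivity) hy (fun m => ?_) (fun n hn => ?_) (wLow_nonneg _) (fun m n hm => ?_)
    (fun m n => ?_)
  · have hqd := quadForm_nonneg (F := momenta M J) (wDiag_nonneg M J) σ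
    have hqh := quadForm_nonneg (F := momenta M J) (wHalf_nonneg M J) σ
    have hq2 := quadForm_nonneg (F := momenta M J) (wTwo_nonneg M J) σ
    have hql := quadForm_nonneg (F := momenta M J) (wLow_nonneg (etaScale M J ^ 4)) σ
    refine h1.trans ?_
    rw [quadForm_wSmall]
    clear h1
    generalize quadForm (momenta M J) (wDiag M J) σ = qd at *
    generalize quadForm (momenta M J) (wHalf M J) σ = qh at *
    generalize quadForm (momenta M J) (wTwo M J) σ = q2 at *
    generalize quadForm (momenta M J) (wLow (etaScale M J ^ 4)) σ = ql at *
    generalize etaScale M J = η at *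
    clear ht
    have e1 : (M * (η ^ 8)⁻¹ * (320 * η ^ 5)) ^ 2 * ql = 16 * M ^ 2 * (6400 * (η ^ 6)⁻¹ * ql) := by
      field_simp; ring
    have e2 : (320 * η ^ 5 * (η ^ 2)⁻¹) ^ 2 * q2 = 16 * 1 * (6400 * η ^ 6 * q2) := by
      field_simp; ring
    rw [e1, e2]
    have e3 : (16 : ℝ) * 1 * (6400 * η ^ 6 * q2) ≤ 16 * (M : ℝ) ^ 2 * (6400 * η ^ 6 * q2) := by
      have : (1 : ℝ) ≤ (M : ℝ) ^ 2 := one_le_pow₀ hM1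
      gcongr
    have e4 : 0 ≤ (M : ℝ) ^ 2 * (qd + qh + 80 * η ^ 5 * q2) := by positivity
    linarith
  · rw [hp]
    split_ifs with hm
    · rw [norm_one, one_mul, ← div_eq_mul_inv, le_div_iff₀ (by positivity), mul_comm]
      exact mul_sqrt_propagator_le_of_inSlice hM hm
    · rw [norm_zero, zero_mul]
      positivity
  · rw [not_le] at hn
    refine Real.sqrt_le_iff.2 ⟨by positivity, ?_⟩
    rw [inv_pow, ← pow_mul, ← one_div, le_div_iff₀ (by positivity), mul_comm]
    exact hn.le
  · unfold wLow
    rw [if_pos hm]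
  · unfold wTwo
    split_ifs <;> simp

theorem hsSq_hermOp_mul_hermOp_slice_le (hM : 1 < M) (J : ℕ) (hσ : IsHermitianField σ)
    (ht : ‖tensorOp (momenta M J) σ‖ ≤ 320 * etaScale M J ^ 5) {y : momenta M J → ℂ}
    (hy : ∀ n, ‖y n‖ ≤ 1) :
    hsSq (hermOp (momenta M J) σ * Matrix.diagonal y * (hermOp (momenta M J) σ * sliceProj M J))
      ≤ 32 * M ^ 2 * quadForm (momenta M J) (wSmall M J) σ := by
  have hH : (hermOp (momenta M J) σ).conjTranspose = hermOp (momenta M J) σ :=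
    hermOp_isHermitian _ hσ
  have hQ : (sliceProj M J).conjTranspose = sliceProj M J := by
    rw [sliceProj, Matrix.diagonal_conjTranspose]
    refine congrArg _ (funext fun n => ?_)
    rw [Pi.star_apply]
    split_ifs <;> simp
  rw [← hsSq_conjTranspose]
  have e : (hermOp (momenta M J) σ * Matrix.diagonal y
        * (hermOp (momenta M J) σ * sliceProj M J)).conjTranspose
      = sliceProj M J * hermOp (momenta M J) σ * Matrix.diagonal (star y)
        * hermOp (momenta M J) σ := by
    rw [Matrix.conjTranspose_mul, Matrix.conjTranspose_mul, Matrix.conjTranspose_mul, hH, hQ,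
      Matrix.diagonal_conjTranspose, mul_assoc, mul_assoc, mul_assoc]
  rw [e]
  exact hsSq_slice_hermOp_mul_hermOp_le hM J hσ ht fun n => by
    rw [Pi.star_apply, norm_star]
    exact hy n

namespace SmallCoupling

theorem norm_entrySum_sq_le (h : SmallCoupling M k ρ g) (n : Momentum) :
    ‖entrySum g n‖ ^ 2 ≤ 4 * k ^ 2 * ‖coupling g‖ ^ 4 * √(propagator n) := by
  have h1 := pow_le_pow_left₀ (norm_nonneg _) (h.norm_entrySum_le n) 2
  refine h1.trans ?_
  have h2 : √(propagator n) ^ 2 ≤ √(propagator n) := by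
    rw [sq]
    exact mul_le_of_le_one_left (Real.sqrt_nonneg _) (sqrt_propagator_le_one n)
  calc _ = 4 * k ^ 2 * ‖coupling g‖ ^ 4 * √(propagator n) ^ 2 := by ring
    _ ≤ _ := by gcongr

theorem mul_sqrt_le_wHalf (M J : ℕ) {a e s : ℝ} (m n : Momentum)
    (ha : InSlice M J m → a ≤ 1) (ha0 : 0 ≤ a) (haz : ¬ InSlice M J m → a = 0)
    (hs : 0 ≤ s) (he : e ≤ s * √(propagator n)) :
    a * e * (propagator m * propagator n) ≤ s * wHalf M J m n := by
  have h1 := propagator_pos m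
  have h2 := propagator_pos n
  unfold wHalf
  by_cases hm : InSlice M J m
  · rw [if_pos hm]
    calc _ ≤ 1 * (s * √(propagator n)) * (propagator m * propagator n) := by
          have := ha hm
          gcongr ?_ * _
          calc a * e ≤ a * (s * √(propagator n)) := by gcongr
            _ ≤ _ := by gcongr
      _ = s * (propagator m * propagator n * (0 + √(propagator n))) := by ring
      _ ≤ _ := by
        gcongr
        exact Real.sqrt_nonneg _
  · rw [if_neg hm, haz hm]
    simp

theorem hsSq_slice_hermOp_mul_fullOp_le (h : SmallCoupling M k ρ g) (J : ℕ)
    (hσ : IsHermitianField σ) (ht : ‖tensorOp (momenta M J) σ‖ ≤ 320 * etaScale M J ^ 5)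
    {y : momenta M J → ℂ} (hy : ∀ n, ‖y n‖ ≤ 1) :
    hsSq ((I * coupling g) • (sliceProj M J * hermOp (momenta M J) σ) * Matrix.diagonal y
        * fullOp g (momenta M J) σ)
      ≤ 2 * (‖coupling g‖ ^ 4 * (32 * M ^ 2 * quadForm (momenta M J) (wSmall M J) σ))
        + 2 * (‖coupling g‖ ^ 2 * (4 * k ^ 2 * ‖coupling g‖ ^ 4
          * quadForm (momenta M J) (wHalf M J) σ)) := by
  have e : (I * coupling g) • (sliceProj M J * hermOp (momenta M J) σ) * Matrix.diagonal y
        * fullOp g (momenta M J) σ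
      = (I * coupling g) ^ 2 • (sliceProj M J * hermOp (momenta M J) σ * Matrix.diagonal y
          * hermOp (momenta M J) σ)
        + (I * coupling g) • (sliceProj M J * hermOp (momenta M J) σ
          * Matrix.diagonal fun n => y n * entrySum g n) := by
    rw [fullOp, mul_add, smul_mul_assoc, smul_mul_assoc, mul_smul_comm, smul_smul, sq,
      smul_mul_assoc, mul_assoc _ (Matrix.diagonal y) (Matrix.diagonal _),
      Matrix.diagonal_mul_diagonal]
  rw [e]
  refine (hsSq_add_le _ _).trans (add_le_add (mul_le_mul_of_nonneg_left ?_ zero_le_two)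
    (mul_le_mul_of_nonneg_left ?_ zero_le_two))
  · rw [hsSq_smul, norm_pow, norm_I_mul_coupling, ← pow_mul]
    exact mul_le_mul_of_nonneg_left (hsSq_slice_hermOp_mul_hermOp_le h.one_lt J hσ ht hy)
      (by positivity)
  · rw [hsSq_smul, norm_I_mul_coupling, ← quadForm_mul]
    refine mul_le_mul_of_nonneg_left (hsSq_diag_hermOp_diag_le fun m n => ?_) (by positivity)
    have hn : ‖y n * entrySum g n‖ ^ 2 ≤ 4 * k ^ 2 * ‖coupling g‖ ^ 4 * √(propagator n) := by
      rw [norm_mul, mul_pow]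
      exact (mul_le_of_le_one_left (sq_nonneg _) (pow_le_one₀ (norm_nonneg _) (hy n))).trans
        (h.norm_entrySum_sq_le n)
    refine mul_sqrt_le_wHalf M J m n (fun hm => ?_) (sq_nonneg _) (fun hm => ?_) (by positivity) hn
    · simp [hm]
    · simp [hm]

theorem hsSq_fullOp_mul_hermOp_slice_le (h : SmallCoupling M k ρ g) (J : ℕ)
    (hσ : IsHermitianField σ) (ht : ‖tensorOp (momenta M J) σ‖ ≤ 320 * etaScale M J ^ 5)
    {y : momenta M J → ℂ} (hy : ∀ n, ‖y n‖ ≤ 1) :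
    hsSq (fullOp g (momenta M J) σ * Matrix.diagonal y
        * ((I * coupling g) • (hermOp (momenta M J) σ * sliceProj M J)))
      ≤ 2 * (‖coupling g‖ ^ 4 * (32 * M ^ 2 * quadForm (momenta M J) (wSmall M J) σ))
        + 2 * (‖coupling g‖ ^ 2 * (4 * k ^ 2 * ‖coupling g‖ ^ 4
          * quadForm (momenta M J) (wHalf M J) σ)) := by
  have e : fullOp g (momenta M J) σ * Matrix.diagonal y
        * ((I * coupling g) • (hermOp (momenta M J) σ * sliceProj M J))
      = (I * coupling g) ^ 2 • (hermOp (momenta M J) σ * Matrix.diagonal y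
          * (hermOp (momenta M J) σ * sliceProj M J))
        + (I * coupling g) • ((Matrix.diagonal fun n : momenta M J => entrySum g n * y n)
          * hermOp (momenta M J) σ * sliceProj M J) := by
    rw [fullOp, add_mul, add_mul, smul_mul_assoc, smul_mul_assoc, mul_smul_comm, smul_smul, sq,
      Matrix.diagonal_mul_diagonal, mul_smul_comm, mul_assoc (Matrix.diagonal _) (hermOp _ _)]
  rw [e]
  refine (hsSq_add_le _ _).trans (add_le_add (mul_le_mul_of_nonneg_left ?_ zero_le_two)
    (mul_le_mul_of_nonneg_left ?_ zero_le_two))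
  · rw [hsSq_smul, norm_pow, norm_I_mul_coupling, ← pow_mul]
    exact mul_le_mul_of_nonneg_left (hsSq_hermOp_mul_hermOp_slice_le h.one_lt J hσ ht hy)
      (by positivity)
  · rw [hsSq_smul, norm_I_mul_coupling, ← quadForm_mul]
    refine mul_le_mul_of_nonneg_left (hsSq_diag_hermOp_diag_le_swap hσ fun m n => ?_)
      (by positivity)
    have hn : ‖entrySum g n * y n‖ ^ 2 ≤ 4 * k ^ 2 * ‖coupling g‖ ^ 4 * √(propagator n) := by
      rw [norm_mul, mul_pow]
      exact (mul_le_of_le_one_right (sq_nonneg _) (pow_le_one₀ (norm_nonneg _) (hy n))).trans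
        (h.norm_entrySum_sq_le n)
    rw [mul_comm (‖entrySum g n * y n‖ ^ 2)]
    refine mul_sqrt_le_wHalf M J m n (fun hm => ?_) (sq_nonneg _) (fun hm => ?_) (by positivity) hn
    · simp [hm]
    · simp [hm]

/-- The cubic trace costs ‖σ‖ and the weight `wTwo`; the trace with a diagonal insertion O(C^{1/2})
costs `wHalf`. Choosing `y` and `y'` to be one or the indicator of the lower momenta covers U, UP
and PUP at once. -/
theorem norm_trace_first_order_le (h : SmallCoupling M k ρ g) (J : ℕ)
    (hσ : IsHermitianField σ) (ht : ‖tensorOp (momenta M J) σ‖ ≤ 320 * etaScale M J ^ 5)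
    {y y' : momenta M J → ℂ} (hy : ∀ n, ‖y n‖ ≤ 1) (hy' : ∀ n, ‖y' n‖ ≤ 1) :
    ‖((I * coupling g) • (sliceProj M J * hermOp (momenta M J) σ)
        * (Matrix.diagonal y * fullOp g (momenta M J) σ * Matrix.diagonal y')
        * ((I * coupling g) • (hermOp (momenta M J) σ * sliceProj M J))).trace‖
      ≤ ‖coupling g‖ ^ 3 * (320 * etaScale M J ^ 5 * quadForm (momenta M J) (wTwo M J) σ)
        + ‖coupling g‖ ^ 2 * (2 * k * ‖coupling g‖ ^ 2
          * quadForm (momenta M J) (wHalf M J) σ) := by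
  have hk := h.one_le
  have e : (I * coupling g) • (sliceProj M J * hermOp (momenta M J) σ)
        * (Matrix.diagonal y * fullOp g (momenta M J) σ * Matrix.diagonal y')
        * ((I * coupling g) • (hermOp (momenta M J) σ * sliceProj M J))
      = (I * coupling g) ^ 3 • (sliceProj M J * hermOp (momenta M J) σ
          * (Matrix.diagonal y * hermOp (momenta M J) σ * Matrix.diagonal y')
          * (hermOp (momenta M J) σ * sliceProj M J))
        + (I * coupling g) ^ 2 • (sliceProj M J * hermOp (momenta M J) σ
          * (Matrix.diagonal fun n : momenta M J => y n * entrySum g n * y' n)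
          * (hermOp (momenta M J) σ * sliceProj M J)) := by
    rw [fullOp, mul_add, add_mul, Matrix.diagonal_mul_diagonal, Matrix.diagonal_mul_diagonal,
      mul_add, add_mul]
    simp only [smul_mul_assoc, mul_smul_comm, smul_smul]
    congr 2
    · ring
    · ring
  rw [e, Matrix.trace_add, Matrix.trace_smul, Matrix.trace_smul, smul_eq_mul, smul_eq_mul]
  refine (norm_add_le _ _).trans (add_le_add ?_ ?_)
  · rw [norm_mul, norm_pow, norm_I_mul_coupling]
    refine mul_le_mul_of_nonneg_left ?_ (by positivity)
    refine norm_trace_hermOp_cube_le hσ (wTwo_nonneg M J) ht (fun m n => ?_) (fun m n => ?_)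
    · have h1 : ‖y n‖ ^ 2 ≤ 1 := pow_le_one₀ (norm_nonneg _) (hy n)
      have h2 := propagator_pos (m : Momentum)
      have h3 := propagator_pos (n : Momentum)
      unfold wTwo
      split_ifs
      · rw [norm_one, one_pow, one_mul]
        exact mul_le_of_le_one_left (by positivity) h1
      · simp
    · have h1 : ‖y' n‖ ^ 2 ≤ 1 := pow_le_one₀ (norm_nonneg _) (hy' n)
      have h2 := propagator_pos (m : Momentum)
      have h3 := propagator_pos (n : Momentum)
      unfold wTwo
      split_ifs
      · rw [norm_one, one_pow, one_mul]
        exact mul_le_of_le_one_left (by positivity) h1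
      · simp
  · rw [norm_mul, norm_pow, norm_I_mul_coupling]
    refine mul_le_mul_of_nonneg_left ?_ (by positivity)
    refine norm_trace_hermOp_diag_hermOp_le hσ fun m n => ?_
    have h1 : ‖y n * entrySum g n * y' n‖ ≤ 2 * k * ‖coupling g‖ ^ 2 * √(propagator n) := by
      rw [norm_mul, norm_mul]
      calc _ ≤ 1 * ‖entrySum g n‖ * 1 := by
            have := hy n
            have := hy' n
            gcongr
        _ = ‖entrySum g n‖ := by ring
        _ ≤ _ := h.norm_entrySum_le n
    rw [mul_right_comm ‖_‖ ‖y n * entrySum g n * y' n‖]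
    refine mul_sqrt_le_wHalf M J m n (fun hm => ?_) (by positivity) (fun hm => ?_) (by positivity)
      h1
    · simp [hm]
    · simp [hm]

/-- The coefficient 80 η⁵ in `wSmall` accounts for the cubic trace, 320 η⁵ being four times as much;
the remaining constants are absorbed in the gap between 40000 and 50000. -/
theorem small_arith {k M ρ L r η qd qh q2 ql : ℝ} (hk : 1 ≤ k) (hM : 1 ≤ M) (hρ : 0 < ρ)
    (hrL : r ^ 2 * L ^ 2 ≤ 4 * ρ) (hL0 : 0 ≤ L) (hL1 : L ≤ 1) (hLρ : L ^ 2 ≤ ρ) (hη : 1 ≤ η)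
    (hqd : 0 ≤ qd) (hqh : 0 ≤ qh) (hq2 : 0 ≤ q2) (hql : 0 ≤ ql) {q : ℝ}
    (hq : q = qd + qh + (80 * η ^ 5 + 6400 * η ^ 6) * q2 + 6400 * (η ^ 6)⁻¹ * ql) :
    3 * (L ^ 3 * (320 * η ^ 5 * q2) + L ^ 2 * (2 * k * L ^ 2 * qh))
      + 6 * r ^ 2 * (2 * (L ^ 4 * (32 * M ^ 2 * q)) + 2 * (L ^ 2 * (4 * k ^ 2 * L ^ 4 * qh)))
      + 40000 * (k ^ 4 * M ^ 4) * ρ * (1 + qd + qh)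
      ≤ 50000 * (k ^ 4 * M ^ 4) * ρ * (1 + q) := by
  set K := k ^ 4 * M ^ 4 with hK
  have hη0 : 0 < η := by linarith
  have hq0 : 0 ≤ q := by rw [hq]; positivity
  have t1 : 320 * η ^ 5 * q2 ≤ 4 * q := by
    have : 0 ≤ qd + qh + 6400 * η ^ 6 * q2 + 6400 * (η ^ 6)⁻¹ * ql := by positivity
    rw [hq]; linarith
  have t2 : qd + qh ≤ q := by
    have : 0 ≤ (80 * η ^ 5 + 6400 * η ^ 6) * q2 + 6400 * (η ^ 6)⁻¹ * ql := by positivity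
    rw [hq]; linarith
  have t3 : qh ≤ q := by linarith
  have hkK : k ≤ K := by
    calc k = k * 1 := (mul_one k).symm
      _ ≤ k ^ 4 * M ^ 4 := by
        have := le_self_pow₀ hk (show 4 ≠ 0 by norm_num)
        have := one_le_pow₀ hM (n := 4)
        gcongr
  have hk2K : k ^ 2 ≤ K := by
    calc k ^ 2 = k ^ 2 * 1 := (mul_one _).symm
      _ ≤ k ^ 4 * M ^ 4 := by
        have := pow_le_pow_right₀ hk (show 2 ≤ 4 by norm_num)
        have := one_le_pow₀ hM (n := 4)
        gcongr
  have hM2K : M ^ 2 ≤ K := by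
    calc M ^ 2 = 1 * M ^ 2 := (one_mul _).symm
      _ ≤ k ^ 4 * M ^ 4 := by
        have := pow_le_pow_right₀ hM (show 2 ≤ 4 by norm_num)
        have := one_le_pow₀ hk (n := 4)
        gcongr
  have hK1 : 1 ≤ K := hk.trans hkK
  have hK0 : 0 ≤ K := by linarith
  have p3 : L ^ 3 ≤ ρ := (pow_le_pow_of_le_one hL0 hL1 (by norm_num)).trans hLρ
  have p2 : L ^ 2 ≤ 1 := pow_le_one₀ hL0 hL1
  have p4 : L ^ 4 ≤ 1 := pow_le_one₀ hL0 hL1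
  have s1 : L ^ 3 * (320 * η ^ 5 * q2) ≤ 4 * (K * ρ * q) := by
    calc _ ≤ ρ * (4 * q) := by gcongr
      _ = 4 * (1 * ρ * q) := by ring
      _ ≤ _ := by gcongr
  have s2 : L ^ 2 * (2 * k * L ^ 2 * qh) ≤ 2 * (K * ρ * q) := by
    calc _ ≤ ρ * (2 * K * 1 * q) := by gcongr
      _ = _ := by ring
  have s3 : 6 * r ^ 2 * (2 * (L ^ 4 * (32 * M ^ 2 * q)) + 2 * (L ^ 2 * (4 * k ^ 2 * L ^ 4 * qh)))
      ≤ 1728 * (K * ρ * q) := by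
    calc _ = (r ^ 2 * L ^ 2) * (384 * L ^ 2 * M ^ 2 * q + 48 * k ^ 2 * L ^ 4 * qh) := by ring
      _ ≤ (4 * ρ) * (384 * 1 * K * q + 48 * K * 1 * q) := by gcongr
      _ = _ := by ring
  have s4 : 40000 * K * ρ * (1 + qd + qh) ≤ 40000 * K * ρ * (1 + q) := by
    gcongr 40000 * K * ρ * ?_
    linarith
  have s5 : 0 ≤ K * ρ := by positivity
  have s6 : 0 ≤ K * ρ * q := by positivity
  linarith

theorem norm_interactionSlice_le_small (h : SmallCoupling M k ρ g) (hJ : 1 ≤ J)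
    (hσ : IsHermitianField σ) (ht : ‖tensorOp (momenta M J) σ‖ ≤ 320 * etaScale M J ^ 5) :
    ‖interactionSlice M g J σ‖ ≤ 50000 * (k ^ 4 * M ^ 4) * ρ
      * (1 + quadForm (momenta M J) (wSmall M J) σ) := by
  have hη := one_le_etaScale h.one_lt J
  have hqd := quadForm_nonneg (F := momenta M J) (wDiag_nonneg M J) σ
  have hqh := quadForm_nonneg (F := momenta M J) (wHalf_nonneg M J) σ
  have hq2 := quadForm_nonneg (F := momenta M J) (wTwo_nonneg M J) σ
  have hql := quadForm_nonneg (F := momenta M J) (wLow_nonneg (etaScale M J ^ 4)) σ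
  have harith := small_arith h.one_le h.one_le_M h.rho_pos h.resolvent_sq_mul_le (norm_nonneg _)
    h.norm_le_one h.normSq_le hη hqd hqh hq2 hql (quadForm_wSmall M J (momenta M J) σ)
  have hPn : ‖prevProj M J‖ ≤ 1 :=
    l2_opNorm_diagonal_le zero_le_one fun n => norm_prevIndicator_le M J n
  refine le_trans (h.norm_interactionSlice_le_of_core hJ hσ fun s hs R R' hp hR hR' => ?_) harith
  have hs1 : ‖(s : ℂ)‖ ≤ 1 := by
    rw [norm_real, Real.norm_eq_abs, abs_of_nonneg hs.1]
    exact hs.2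
  have hs2 : ‖(s : ℂ) ^ 2‖ ≤ 1 := by
    rw [norm_pow]
    exact pow_le_one₀ (norm_nonneg _) hs1
  have hone : ∀ n : momenta M J, ‖(1 : ℂ)‖ ≤ 1 := fun _ => norm_one.le
  have hprev : ∀ n : momenta M J, ‖(if InSlice M J n then 0 else 1 : ℂ)‖ ≤ 1 :=
    fun n => norm_prevIndicator_le M J n
  have a1 := h.hsSq_slice_hermOp_mul_fullOp_le J hσ ht hone
  have a2 := h.hsSq_slice_hermOp_mul_fullOp_le J hσ ht hprev
  have b1 := h.hsSq_fullOp_mul_hermOp_slice_le J hσ ht hone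
  have b2 := h.hsSq_fullOp_mul_hermOp_slice_le J hσ ht hprev
  have f1 := h.norm_trace_first_order_le J hσ ht hprev hprev
  have f2 := h.norm_trace_first_order_le J hσ ht hone hprev
  have f3 := h.norm_trace_first_order_le J hσ ht hone hone
  rw [Matrix.diagonal_one] at a1 b1 f2 f3
  rw [mul_one] at a1 b1
  rw [one_mul] at f2 f3
  rw [mul_one] at f3
  change hsSq (_ * prevProj M J * _) ≤ _ at a2
  change hsSq (_ * prevProj M J * _) ≤ _ at b2
  change ‖(_ * (prevProj M J * _ * prevProj M J) * _).trace‖ ≤ _ at f1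
  change ‖(_ * (_ * prevProj M J) * _).trace‖ ≤ _ at f2
  generalize (I * coupling g) • (sliceProj M J * hermOp (momenta M J) σ) = A at *
  generalize (I * coupling g) • (hermOp (momenta M J) σ * sliceProj M J) = B at *
  rw [norm_mul]
  have hx0 : 0 ≤ 2 * (‖coupling g‖ ^ 4 * (32 * M ^ 2 * quadForm (momenta M J) (wSmall M J) σ))
        + 2 * (‖coupling g‖ ^ 2 * (4 * k ^ 2 * ‖coupling g‖ ^ 4
          * quadForm (momenta M J) (wHalf M J) σ)) := (hsSq_nonneg _).trans a1
  refine (mul_le_of_le_one_left (norm_nonneg _) hs2).trans ?_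
  rw [← Real.sq_sqrt hx0] at a1 a2 b1 b2
  have key := hp.norm_trace_core_le' h.one_le_resolvent (Real.sqrt_nonneg _) hs1 hPn hR hR' a1 a2
    b1 b2
  rw [Real.sq_sqrt hx0] at key
  refine key.trans (add_le_add ?_ le_rfl)
  rw [mul_add, mul_add, add_mul, add_mul, Matrix.trace_add, Matrix.trace_add]
  refine norm_add₃_le.trans ((add_le_add (add_le_add f1 f2) f3).trans (le_of_eq ?_))
  generalize quadForm (momenta M J) (wTwo M J) σ = q2
  generalize quadForm (momenta M J) (wHalf M J) σ = qh
  ring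

end SmallCoupling

end SmallFields

end TensorT44
end

noncomputable section

namespace TensorT44

open MeasureTheory ProbabilityTheory Complex

/-! ### Exponential moments of independent Gaussian coordinates. -/

section GaussianIntegrals

/-- The tilted density is a multiple of the Gaussian one of variance 1/(1 - 2a), so the integral is
(1 - 2a)^{-1/2}; this is at most exp(2a) because (1 + 4a)(1 - 2a) ≥ 1 for 0 ≤ a ≤ 1/4. -/
theorem lintegral_exp_sq_gaussianReal_le {a : ℝ} (ha : 0 ≤ a) (ha' : a ≤ 1 / 4) :
    ∫⁻ x, ENNReal.ofReal (Real.exp (a * x ^ 2)) ∂gaussianReal 0 1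
      ≤ ENNReal.ofReal (Real.exp (2 * a)) := by
  set b : NNReal := ⟨1 - 2 * a, by linarith⟩ with hb
  have hb0 : (0 : ℝ) < b := by
    change 0 < 1 - 2 * a
    linarith
  have hv : b⁻¹ ≠ 0 := inv_ne_zero (fun h => hb0.ne' (by rw [h]; rfl))
  have hpt : ∀ x, ENNReal.ofReal (Real.exp (a * x ^ 2)) * gaussianPDF 0 1 x
      = ENNReal.ofReal ((√b)⁻¹) * gaussianPDF 0 b⁻¹ x := by
    intro x
    rw [gaussianPDF, gaussianPDF, ← ENNReal.ofReal_mul (Real.exp_pos _).le,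
      ← ENNReal.ofReal_mul (by positivity), gaussianPDFReal, gaussianPDFReal]
    congr 1
    have e1 : Real.exp (a * x ^ 2) * Real.exp (-(x - 0) ^ 2 / (2 * ((1 : NNReal) : ℝ)))
        = Real.exp (-(x - 0) ^ 2 / (2 * ((b⁻¹ : NNReal) : ℝ))) := by
      rw [← Real.exp_add]
      congr 1
      rw [NNReal.coe_inv]
      change a * x ^ 2 + -(x - 0) ^ 2 / (2 * 1) = -(x - 0) ^ 2 / (2 * (1 - 2 * a)⁻¹)
      have : 1 - 2 * a ≠ 0 := hb0.ne'
      field_simp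
      ring
    have e2 : (√(2 * Real.pi * ((1 : NNReal) : ℝ)))⁻¹
        = (√b)⁻¹ * (√(2 * Real.pi * ((b⁻¹ : NNReal) : ℝ)))⁻¹ := by
      rw [← mul_inv, ← Real.sqrt_mul hb0.le, NNReal.coe_inv]
      congr 2
      have := hb0.ne'
      field_simp
      simp
    rw [mul_left_comm, e1, e2, mul_assoc]
  rw [gaussianReal_of_var_ne_zero _ one_ne_zero,
    lintegral_withDensity_eq_lintegral_mul _ (measurable_gaussianPDF 0 1)
      (by fun_prop)]
  simp only [Pi.mul_apply]
  have h1 : ∫⁻ x, gaussianPDF 0 1 x * ENNReal.ofReal (Real.exp (a * x ^ 2))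
      = ENNReal.ofReal ((√b)⁻¹) := by
    simp only [mul_comm (gaussianPDF 0 1 _), hpt]
    rw [lintegral_const_mul _ (measurable_gaussianPDF 0 _), lintegral_gaussianPDF_eq_one _ hv,
      mul_one]
  rw [h1]
  refine ENNReal.ofReal_le_ofReal ?_
  have h2 : Real.exp (-(4 * a)) ≤ b := by
    change Real.exp (-(4 * a)) ≤ 1 - 2 * a
    rw [Real.exp_neg]
    refine inv_le_of_inv_le₀ hb0 ?_
    have h3 := Real.add_one_le_exp (4 * a)
    refine le_trans ?_ h3
    rw [inv_le_iff_one_le_mul₀ (show 0 < 1 - 2 * a from hb0)]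
    nlinarith
  rw [show 2 * a = -(-(4 * a) / 2) by ring, Real.exp_neg]
  refine inv_anti₀ (Real.exp_pos _) ?_
  rw [Real.exp_half]
  exact Real.sqrt_le_sqrt h2

theorem lintegral_exp_mul_gaussianReal (b : ℝ) :
    ∫⁻ x, ENNReal.ofReal (Real.exp (b * x)) ∂gaussianReal 0 1
      = ENNReal.ofReal (Real.exp (b ^ 2 / 2)) := by
  rw [← ofReal_integral_eq_lintegral_ofReal (integrable_exp_mul_gaussianReal b)
    (Filter.Eventually.of_forall fun x => (Real.exp_pos _).le)]
  congr 1
  have := congrFun (mgf_fun_id_gaussianReal (μ := 0) (v := 1)) b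
  rw [mgf] at this
  simpa using this

variable {ι : Type*}

theorem lintegral_prod_infinitePi (s : Finset ι) {f : ι → ℝ → ENNReal}
    (hf : ∀ i, Measurable (f i)) :
    ∫⁻ x, ∏ i ∈ s, f i (x i) ∂Measure.infinitePi (fun _ : ι => gaussianReal 0 1)
      = ∏ i ∈ s, ∫⁻ y, f i y ∂gaussianReal 0 1 := by
  rw [lintegral_prod_eq_prod_lintegral_of_indepFun s (fun i (x : ι → ℝ) => f i (x i))
    (iIndepFun_infinitePi hf) fun i => (hf i).comp (measurable_pi_apply i)]
  refine Finset.prod_congr rfl fun i _ => ?_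
  exact (measurePreserving_eval_infinitePi (fun _ : ι => gaussianReal 0 1) i).lintegral_comp (hf i)

theorem ofReal_exp_sum (s : Finset ι) (f : ι → ℝ) :
    ENNReal.ofReal (Real.exp (∑ i ∈ s, f i)) = ∏ i ∈ s, ENNReal.ofReal (Real.exp (f i)) := by
  rw [Real.exp_sum, ENNReal.ofReal_prod_of_nonneg fun i _ => (Real.exp_pos _).le]

theorem lintegral_exp_sum_sq_le (s : Finset ι) {a : ι → ℝ} (ha : ∀ i, 0 ≤ a i)
    (ha' : ∀ i, a i ≤ 1 / 4) :
    ∫⁻ x, ENNReal.ofReal (Real.exp (∑ i ∈ s, a i * x i ^ 2))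
        ∂Measure.infinitePi (fun _ : ι => gaussianReal 0 1)
      ≤ ENNReal.ofReal (Real.exp (2 * ∑ i ∈ s, a i)) := by
  simp only [ofReal_exp_sum, Finset.mul_sum]
  rw [lintegral_prod_infinitePi s (f := fun i y => ENNReal.ofReal (Real.exp (a i * y ^ 2)))
    fun i => by fun_prop]
  exact Finset.prod_le_prod' fun i _ => lintegral_exp_sq_gaussianReal_le (ha i) (ha' i)

theorem lintegral_exp_sum_mul (s : Finset ι) (b : ι → ℝ) :
    ∫⁻ x, ENNReal.ofReal (Real.exp (∑ i ∈ s, b i * x i))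
        ∂Measure.infinitePi (fun _ : ι => gaussianReal 0 1)
      = ENNReal.ofReal (Real.exp ((∑ i ∈ s, b i ^ 2) / 2)) := by
  simp only [ofReal_exp_sum, Finset.sum_div]
  rw [lintegral_prod_infinitePi s (f := fun i y => ENNReal.ofReal (Real.exp (b i * y)))
    fun i => by fun_prop]
  exact Finset.prod_congr rfl fun i _ => lintegral_exp_mul_gaussianReal (b i)

end GaussianIntegrals

/-! ### Hermitian fields in real coordinates. -/

section HermitianFields

/-- Coordinates of a quadruple of Hermitian matrices. -/
abbrev Coord : Type := Fin 4 × ℤ × ℤ → ℝ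

/-- The quadruple of Hermitian matrices with the real coordinates `x`. -/
def hermField (x : Coord) : Field :=
  fun c m n =>
    if m = n then (x (c, m, m) : ℂ)
    else if m < n then ((x (c, m, n) : ℂ) + I * (x (c, n, m) : ℂ)) / (√2 : ℂ)
    else ((x (c, n, m) : ℂ) - I * (x (c, m, n) : ℂ)) / (√2 : ℂ)

theorem replica_eq {B : Type*} (ξ : Fin 4 × ℤ × ℤ → EuclideanSpace ℝ B) (a : B) :
    replica ξ a = hermField fun i => ξ i a := rfl

theorem hermField_isHermitian (x : Coord) : IsHermitianField (hermField x) := by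
  intro c k l
  unfold hermField
  rcases lt_trichotomy k l with h | h | h
  · rw [if_neg h.ne', if_neg h.not_gt, if_neg h.ne, if_pos h]
    simp only [map_div₀, map_add, map_mul, conj_ofReal, conj_I]
    ring
  · subst h
    simp
  · rw [if_neg h.ne, if_pos h, if_neg h.ne', if_neg h.not_gt]
    simp only [map_div₀, map_sub, map_mul, conj_ofReal, conj_I]
    ring

theorem norm_hermField_sq_le (x : Coord) (c : Fin 4) (k l : ℤ) :
    ‖hermField x c k l‖ ^ 2 ≤ x (c, k, l) ^ 2 + x (c, l, k) ^ 2 := by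
  have h2 : ‖(√2 : ℂ)‖ ^ 2 = 2 := by
    rw [norm_real, Real.norm_eq_abs, sq_abs, Real.sq_sqrt zero_le_two]
  unfold hermField
  split_ifs with h1 h3
  · subst h1
    rw [norm_real, Real.norm_eq_abs, sq_abs]
    nlinarith [sq_nonneg (x (c, k, k))]
  · rw [norm_div, div_pow, h2, Complex.sq_norm, Complex.normSq_apply]
    simp only [add_re, add_im, mul_re, mul_im, I_re, I_im, ofReal_re, ofReal_im]
    nlinarith [sq_nonneg (x (c, k, l)), sq_nonneg (x (c, l, k))]
  · rw [norm_div, div_pow, h2, Complex.sq_norm, Complex.normSq_apply]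
    simp only [sub_re, sub_im, mul_re, mul_im, I_re, I_im, ofReal_re, ofReal_im]
    nlinarith [sq_nonneg (x (c, k, l)), sq_nonneg (x (c, l, k))]

theorem norm_tensorSum_sq_le (σ : Field) (m n : Momentum) :
    ‖tensorSum σ m n‖ ^ 2
      ≤ 4 * ∑ c, if AgreeOff c m n then ‖σ c (m c) (n c)‖ ^ 2 else 0 := by
  unfold tensorSum
  have h1 := norm_sum_le (Finset.univ : Finset (Fin 4))
    fun c => if ∀ c', c' ≠ c → m c' = n c' then σ c (m c) (n c) else 0
  have h2 := pow_le_pow_left₀ (norm_nonneg _) h1 2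
  refine h2.trans ((sq_sum_le_card_mul_sum_sq).trans ?_)
  rw [Finset.card_univ, Fintype.card_fin]
  push_cast
  refine mul_le_mul_of_nonneg_left (Finset.sum_le_sum fun c _ => ?_) (by norm_num)
  by_cases h : AgreeOff c m n
  · have h' : ∀ c', c' ≠ c → m c' = n c' := h
    rw [if_pos h, if_pos h']
  · have h' : ¬ ∀ c', c' ≠ c → m c' = n c' := h
    rw [if_neg h, if_neg h', norm_zero]
    norm_num

theorem sum_wCoeff_mul {F : Finset Momentum} {S : Finset ℤ} (hFS : ∀ n ∈ F, ∀ c, n c ∈ S)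
    (w : Momentum → Momentum → ℝ) (c : Fin 4) (h : ℤ → ℤ → ℝ) :
    ∑ k ∈ S, ∑ l ∈ S, wCoeff F w c k l * h k l
      = ∑ m ∈ F, ∑ n ∈ F, if AgreeOff c m n then w m n * h (m c) (n c) else 0 := by
  simp only [wCoeff, Finset.sum_mul]
  have e1 : ∀ k, ∑ l ∈ S, ∑ m ∈ F, ∑ n ∈ F,
      (if AgreeOff c m n ∧ m c = k ∧ n c = l then w m n else 0) * h k l
      = ∑ m ∈ F, ∑ n ∈ F, ∑ l ∈ S,
        (if AgreeOff c m n ∧ m c = k ∧ n c = l then w m n else 0) * h k l := by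
    intro k
    rw [Finset.sum_comm]
    exact Finset.sum_congr rfl fun m _ => Finset.sum_comm
  simp only [e1]
  rw [Finset.sum_comm]
  refine Finset.sum_congr rfl fun m hm => ?_
  rw [Finset.sum_comm]
  refine Finset.sum_congr rfl fun n hn => ?_
  rw [Finset.sum_eq_single (m c)]
  · rw [Finset.sum_eq_single (n c)]
    · by_cases hA : AgreeOff c m n
      · rw [if_pos hA, if_pos ⟨hA, rfl, rfl⟩]
      · rw [if_neg hA, if_neg fun h => hA h.1, zero_mul]
    · intro l _ hl
      rw [if_neg fun h => hl h.2.2.symm, zero_mul]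
    · intro h
      exact absurd (hFS n hn c) h
  · intro k _ hk
    refine Finset.sum_eq_zero fun l _ => ?_
    rw [if_neg fun h => hk h.2.1.symm, zero_mul]
  · intro h
    exact absurd (hFS m hm c) h

/-- The coefficient of the square of a coordinate in the bound of the quadratic form. -/
def coordCoeff (F : Finset Momentum) (w : Momentum → Momentum → ℝ) (i : Fin 4 × ℤ × ℤ) : ℝ :=
  4 * (wCoeff F w i.1 i.2.1 i.2.2 + wCoeff F w i.1 i.2.2 i.2.1)

theorem sum_coordCoeff {F : Finset Momentum} {S : Finset ℤ} (hFS : ∀ n ∈ F, ∀ c, n c ∈ S)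
    (w : Momentum → Momentum → ℝ) :
    ∑ i ∈ Finset.univ ×ˢ S ×ˢ S, coordCoeff F w i = 8 * wTrace F w := by
  have h1 : ∀ c, ∑ k ∈ S, ∑ l ∈ S, wCoeff F w c k l
      = ∑ m ∈ F, ∑ n ∈ F, if AgreeOff c m n then w m n else 0 := by
    intro c
    simpa using sum_wCoeff_mul hFS w c fun _ _ => 1
  have h2 : ∀ c, ∑ k ∈ S, ∑ l ∈ S, wCoeff F w c l k
      = ∑ m ∈ F, ∑ n ∈ F, if AgreeOff c m n then w m n else 0 := by
    intro c
    rw [Finset.sum_comm, h1]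
  rw [Finset.sum_product]
  simp only [Finset.sum_product, coordCoeff, ← Finset.mul_sum, Finset.sum_add_distrib, h1, h2,
    wTrace]
  ring

/-- Cauchy-Schwarz over the four colours gives the factor 4, and |σ_kl|² is bounded by the squares
of its two coordinates, whence the symmetrized coefficients. The dominating form is diagonal in
independent coordinates. -/
theorem quadForm_hermField_le {F : Finset Momentum} {S : Finset ℤ}
    (hFS : ∀ n ∈ F, ∀ c, n c ∈ S) {w : Momentum → Momentum → ℝ} (hw : ∀ m n, 0 ≤ w m n)
    (x : Coord) :
    quadForm F w (hermField x) ≤ ∑ i ∈ Finset.univ ×ˢ S ×ˢ S, coordCoeff F w i * x i ^ 2 := by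
  have h1 : quadForm F w (hermField x) ≤ ∑ m ∈ F, ∑ n ∈ F, 4 * ∑ c,
      if AgreeOff c m n then w m n * (x (c, m c, n c) ^ 2 + x (c, n c, m c) ^ 2) else 0 := by
    refine Finset.sum_le_sum fun m _ => Finset.sum_le_sum fun n _ => ?_
    refine (mul_le_mul_of_nonneg_left (norm_tensorSum_sq_le _ m n) (hw m n)).trans ?_
    rw [mul_left_comm]
    refine mul_le_mul_of_nonneg_left ?_ (by norm_num)
    rw [Finset.mul_sum]
    refine Finset.sum_le_sum fun c _ => ?_
    split_ifs
    · exact mul_le_mul_of_nonneg_left (norm_hermField_sq_le x c _ _) (hw m n)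
    · rw [mul_zero]
  refine h1.trans (le_of_eq ?_)
  have h2 : ∀ c, ∑ k ∈ S, ∑ l ∈ S, wCoeff F w c k l * (x (c, k, l) ^ 2 + x (c, l, k) ^ 2)
      = ∑ k ∈ S, ∑ l ∈ S, (wCoeff F w c k l + wCoeff F w c l k) * x (c, k, l) ^ 2 := by
    intro c
    simp only [mul_add, add_mul, Finset.sum_add_distrib]
    congr 1
    rw [Finset.sum_comm]
  simp only [← Finset.mul_sum]
  rw [Finset.sum_product]
  simp only [Finset.sum_product, coordCoeff, mul_assoc, ← Finset.mul_sum]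
  congr 1
  simp only [← h2]
  simp only [sum_wCoeff_mul hFS w _ fun k l => x (_, k, l) ^ 2 + x (_, l, k) ^ 2]
  rw [Finset.sum_comm (s := Finset.univ)]
  refine Finset.sum_congr rfl fun m _ => ?_
  rw [Finset.sum_comm]

/-- The standard Gaussian law of the coordinates of a quadruple of Hermitian matrices. -/
def fieldLaw : Measure Coord := Measure.infinitePi fun _ => gaussianReal 0 1

instance : IsProbabilityMeasure fieldLaw := by
  unfold fieldLaw
  infer_instance

/-- Each diagonal coefficient is at most 8v, so 32tv ≤ 1 is the condition t · 8v ≤ 1/4 of the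
one-dimensional integral; 16 is twice the 8 of `sum_coordCoeff`. -/
theorem lintegral_exp_quadForm_le {F : Finset Momentum} {S : Finset ℤ}
    (hFS : ∀ n ∈ F, ∀ c, n c ∈ S) {w : Momentum → Momentum → ℝ} (hw : ∀ m n, 0 ≤ w m n)
    {t v : ℝ} (ht : 0 ≤ t) (hv : ∀ c k l, wCoeff F w c k l ≤ v) (htv : 32 * t * v ≤ 1) :
    ∫⁻ x, ENNReal.ofReal (Real.exp (t * quadForm F w (hermField x))) ∂fieldLaw
      ≤ ENNReal.ofReal (Real.exp (16 * t * wTrace F w)) := by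
  have h0 : ∀ c k l, 0 ≤ wCoeff F w c k l := fun c k l =>
    Finset.sum_nonneg fun m _ => Finset.sum_nonneg fun n _ => by
      split_ifs
      · exact hw m n
      · exact le_rfl
  calc _ ≤ ∫⁻ x, ENNReal.ofReal (Real.exp (∑ i ∈ Finset.univ ×ˢ S ×ˢ S,
        t * coordCoeff F w i * x i ^ 2)) ∂fieldLaw := by
        refine lintegral_mono fun x => ENNReal.ofReal_le_ofReal (Real.exp_le_exp.2 ?_)
        simp only [mul_assoc, ← Finset.mul_sum]
        exact mul_le_mul_of_nonneg_left (quadForm_hermField_le hFS hw x) ht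
    _ ≤ ENNReal.ofReal (Real.exp (2 * ∑ i ∈ Finset.univ ×ˢ S ×ˢ S, t * coordCoeff F w i)) := by
        refine lintegral_exp_sum_sq_le _ (fun i => ?_) (fun i => ?_)
        · exact mul_nonneg ht (mul_nonneg (by norm_num) (add_nonneg (h0 _ _ _) (h0 _ _ _)))
        · unfold coordCoeff
          have h1 := hv i.1 i.2.1 i.2.2
          have h2 := hv i.1 i.2.2 i.2.1
          calc _ ≤ t * (4 * (v + v)) := by gcongr
            _ ≤ _ := by linarith
    _ = _ := by
        rw [← Finset.mul_sum, sum_coordCoeff hFS]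
        ring_nf

end HermitianFields

end TensorT44
end

noncomputable section

namespace TensorT44

open MeasureTheory ProbabilityTheory Complex

/-! ### Large norm and large quadratic form on a ball. -/

section Rayleigh

open scoped Matrix.Norms.L2Operator

variable {ι : Type*} [Fintype ι] [DecidableEq ι]

theorem exists_eigenvector_of_isHermitian {A : Matrix ι ι ℂ} (hA : A.IsHermitian) (h0 : 0 < ‖A‖) :
    ∃ (v : EuclideanSpace ℂ ι) (l : ℝ), ‖v‖ = 1 ∧ ‖A‖ ≤ |l| ∧
      Matrix.toEuclideanCLM (𝕜 := ℂ) A v = (l : ℂ) • v := by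
  have hne : Nonempty ι := by
    by_contra h
    rw [not_nonempty_iff] at h
    rw [Subsingleton.elim A 0, norm_zero] at h0
    exact lt_irrefl _ h0
  obtain ⟨i, -, hi⟩ := Finset.exists_max_image Finset.univ (fun i => |hA.eigenvalues i|)
    Finset.univ_nonempty
  refine ⟨hA.eigenvectorBasis i, hA.eigenvalues i, hA.eigenvectorBasis.norm_eq_one i, ?_, ?_⟩
  · have h1 : ‖A‖ = ‖Matrix.diagonal ((RCLike.ofReal : ℝ → ℂ) ∘ hA.eigenvalues)‖ := by
      nth_rewrite 1 [hA.spectral_theorem]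
      rw [Unitary.conjStarAlgAut_apply, ← Unitary.coe_star, CStarRing.norm_mul_coe_unitary,
        CStarRing.norm_coe_unitary_mul]
    rw [h1]
    refine l2_opNorm_diagonal_le (abs_nonneg _) fun j => ?_
    rw [Function.comp_apply, RCLike.norm_ofReal]
    exact hi j (Finset.mem_univ j)
  · refine (WithLp.ofLp_injective 2) ?_
    rw [Matrix.ofLp_toEuclideanCLM, hA.mulVec_eigenvectorBasis]
    rfl

/-- The real part of the quadratic form of a matrix. -/
def rayleigh (A : Matrix ι ι ℂ) (v : EuclideanSpace ℂ ι) : ℝ :=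
  (inner ℂ v (Matrix.toEuclideanCLM (𝕜 := ℂ) A v)).re

theorem rayleigh_eq_sum (A : Matrix ι ι ℂ) (v : EuclideanSpace ℂ ι) :
    rayleigh A v = ∑ k, ∑ l, ((starRingEnd ℂ) (v k) * v l * A k l).re := by
  rw [rayleigh, PiLp.inner_apply, Complex.re_sum]
  refine Finset.sum_congr rfl fun k _ => ?_
  rw [Matrix.ofLp_toEuclideanCLM, Matrix.mulVec, dotProduct, RCLike.inner_apply, Finset.sum_mul,
    Complex.re_sum]
  refine Finset.sum_congr rfl fun l _ => ?_
  congr 1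
  ring

/-- Around a unit eigenvector the two linear terms are at most ‖A‖/8 each and the quadratic one at
most ‖A‖/64. -/
theorem abs_rayleigh_sub_le {A : Matrix ι ι ℂ} {v z : EuclideanSpace ℂ ι} {l : ℝ} (hv : ‖v‖ = 1)
    (hA : Matrix.toEuclideanCLM (𝕜 := ℂ) A v = (l : ℂ) • v) (hz : ‖z‖ ≤ 1 / 8) :
    |rayleigh A (v + z) - l| ≤ ‖A‖ / 2 := by
  set T := Matrix.toEuclideanCLM (𝕜 := ℂ) (n := ι) A with hT
  have hn : ‖T‖ = ‖A‖ := (Matrix.cstar_norm_def A).symm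
  have e1 : inner ℂ v (T v) = (l : ℂ) := by
    rw [hA, inner_smul_right, inner_self_eq_norm_sq_to_K, hv]
    simp
  have e2 : inner ℂ (v + z) (T (v + z)) - (l : ℂ)
      = inner ℂ v (T z) + inner ℂ z (T v) + inner ℂ z (T z) := by
    rw [← e1, map_add, inner_add_left, inner_add_right, inner_add_right]
    ring
  have e3 : rayleigh A (v + z) - l = (inner ℂ (v + z) (T (v + z)) - (l : ℂ)).re := by
    rw [sub_re, ofReal_re]
    rfl
  rw [e3, e2]
  refine (abs_re_le_norm _).trans (norm_add₃_le.trans ?_)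
  have b : ∀ x y : EuclideanSpace ℂ ι, ‖inner ℂ x (T y)‖ ≤ ‖x‖ * (‖A‖ * ‖y‖) := fun x y =>
    (norm_inner_le_norm _ _).trans
      (mul_le_mul_of_nonneg_left (hn ▸ T.le_opNorm y) (norm_nonneg _))
  have b1 := b v z
  have b2 := b z v
  have b3 := b z z
  rw [hv] at b1 b2
  have h0 := norm_nonneg A
  have hz0 := norm_nonneg z
  have c1 : ‖A‖ * ‖z‖ ≤ ‖A‖ * (1 / 8) := by gcongr
  have c2 : ‖z‖ * (‖A‖ * ‖z‖) ≤ 1 / 8 * (‖A‖ * (1 / 8)) := by gcongr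
  linarith

variable [MeasurableSpace (EuclideanSpace ℂ ι)] [BorelSpace (EuclideanSpace ℂ ι)]

/-- A Hermitian matrix of large norm has a large quadratic form on a ball of fixed radius. -/
theorem exp_mul_measure_ball_le (μ : Measure (EuclideanSpace ℂ ι)) [μ.IsAddHaarMeasure]
    {A : Matrix ι ι ℂ} (hA : A.IsHermitian) {θ t : ℝ} (hθ : 0 ≤ θ) (ht : 0 ≤ t) (h : θ < ‖A‖) :
    ENNReal.ofReal (Real.exp (t * (θ / 2))) * μ (Metric.ball 0 (1 / 8))
      ≤ ∫⁻ v in Metric.ball 0 2, (ENNReal.ofReal (Real.exp (t * rayleigh A v))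
        + ENNReal.ofReal (Real.exp (-t * rayleigh A v))) ∂μ := by
  obtain ⟨v, l, hv, hl, hAv⟩ := exists_eigenvector_of_isHermitian hA (hθ.trans_lt h)
  have hsub : Metric.ball v (1 / 8) ⊆ Metric.ball 0 2 := by
    intro w hw
    rw [Metric.mem_ball, dist_eq_norm] at hw ⊢
    have := norm_add_le (w - v) v
    rw [sub_add_cancel, hv] at this
    rw [sub_zero]
    linarith
  rw [← Measure.addHaar_ball_center μ v, ← setLIntegral_const]
  refine le_trans ?_ (lintegral_mono_set hsub)
  refine setLIntegral_mono' measurableSet_ball fun w hw => ?_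
  rw [Metric.mem_ball, dist_eq_norm] at hw
  have h1 := abs_le.1 (abs_rayleigh_sub_le hv hAv hw.le)
  rw [add_sub_cancel] at h1
  rcases le_total 0 l with hl0 | hl0
  · rw [abs_of_nonneg hl0] at hl
    refine le_add_right (ENNReal.ofReal_le_ofReal (Real.exp_le_exp.2 ?_))
    refine mul_le_mul_of_nonneg_left ?_ ht
    linarith [h1.1]
  · rw [abs_of_nonpos hl0] at hl
    refine le_add_left (ENNReal.ofReal_le_ofReal (Real.exp_le_exp.2 ?_))
    rw [neg_mul, ← mul_neg]
    refine mul_le_mul_of_nonneg_left ?_ ht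
    linarith [h1.2]

end Rayleigh

/-! ### Tail of the operator norm of a Gaussian block. -/

section Tail

open scoped Matrix.Norms.L2Operator

theorem measurable_hermField (c : Fin 4) (k l : ℤ) : Measurable fun x => hermField x c k l := by
  unfold hermField
  split_ifs <;> fun_prop

theorem colourBlock_hermField_isHermitian (S : Finset ℤ) (x : Coord) (c : Fin 4) :
    (colourBlock S (hermField x) c).IsHermitian := by
  ext k l
  rw [Matrix.conjTranspose_apply]
  exact (hermField_isHermitian x c l k).symm

/-- Real coefficients of the two coordinates in `re (z (σ_c)_{kl})`. -/
def coordPair (k l : ℤ) (z : ℂ) : ℝ × ℝ :=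
  if k = l then (z.re, 0) else if k < l then (z.re / √2, -z.im / √2) else (z.im / √2, z.re / √2)

theorem re_mul_hermField (x : Coord) (c : Fin 4) (k l : ℤ) (z : ℂ) :
    (z * hermField x c k l).re
      = (coordPair k l z).1 * x (c, k, l) + (coordPair k l z).2 * x (c, l, k) := by
  unfold hermField coordPair
  split_ifs with h1 h2
  · subst h1
    simp [mul_re]
  · have e : z * (((x (c, k, l) : ℂ) + I * (x (c, l, k) : ℂ)) / (√2 : ℂ))
        = (z * ((x (c, k, l) : ℂ) + I * (x (c, l, k) : ℂ))) / ((√2 : ℝ) : ℂ) := by ring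
    rw [e, div_ofReal_re]
    simp only [mul_re, add_re, add_im, mul_im, I_re, I_im, ofReal_re, ofReal_im]
    ring
  · have e : z * (((x (c, l, k) : ℂ) - I * (x (c, k, l) : ℂ)) / (√2 : ℂ))
        = (z * ((x (c, l, k) : ℂ) - I * (x (c, k, l) : ℂ))) / ((√2 : ℝ) : ℂ) := by ring
    rw [e, div_ofReal_re]
    simp only [mul_re, sub_re, sub_im, mul_im, I_re, I_im, ofReal_re, ofReal_im]
    ring

theorem coordPair_sq_le (k l : ℤ) (z : ℂ) :
    (coordPair k l z).1 ^ 2 + (coordPair k l z).2 ^ 2 ≤ ‖z‖ ^ 2 := by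
  rw [Complex.sq_norm, Complex.normSq_apply]
  have h2 : √2 ^ 2 = (2 : ℝ) := Real.sq_sqrt zero_le_two
  unfold coordPair
  split_ifs
  · nlinarith [sq_nonneg z.im]
  · simp only [div_pow, h2]
    nlinarith [sq_nonneg z.im, sq_nonneg z.re]
  · simp only [div_pow, h2]
    nlinarith [sq_nonneg z.im, sq_nonneg z.re]

/-- Coefficients of the quadratic form of a block as a linear form in the coordinates. -/
def rayleighCoeff {S : Finset ℤ} (v : EuclideanSpace ℂ S) (k l : S) : ℝ :=
  (coordPair k l ((starRingEnd ℂ) (v k) * v l)).1 + (coordPair l k ((starRingEnd ℂ) (v l) * v k)).2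

theorem rayleigh_colourBlock (S : Finset ℤ) (x : Coord) (c : Fin 4) (v : EuclideanSpace ℂ S) :
    rayleigh (colourBlock S (hermField x) c) v
      = ∑ k : S, ∑ l : S, rayleighCoeff v k l * x (c, (k : ℤ), (l : ℤ)) := by
  rw [rayleigh_eq_sum]
  have h1 : ∀ k l : S, ((starRingEnd ℂ) (v k) * v l * colourBlock S (hermField x) c k l).re
      = (coordPair k l ((starRingEnd ℂ) (v k) * v l)).1 * x (c, (k : ℤ), (l : ℤ))
        + (coordPair k l ((starRingEnd ℂ) (v k) * v l)).2 * x (c, (l : ℤ), (k : ℤ)) :=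
    fun k l => re_mul_hermField x c k l _
  simp only [h1, rayleighCoeff, add_mul, Finset.sum_add_distrib]
  congr 1
  rw [Finset.sum_comm]

theorem sum_rayleighCoeff_sq_le {S : Finset ℤ} (v : EuclideanSpace ℂ S) :
    ∑ k, ∑ l, rayleighCoeff v k l ^ 2 ≤ 2 * ‖v‖ ^ 4 := by
  calc _ ≤ ∑ k : S, ∑ l : S, (2 * (coordPair k l ((starRingEnd ℂ) (v k) * v l)).1 ^ 2
        + 2 * (coordPair l k ((starRingEnd ℂ) (v l) * v k)).2 ^ 2) := by
        refine Finset.sum_le_sum fun k _ => Finset.sum_le_sum fun l _ => ?_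
        unfold rayleighCoeff
        nlinarith [sq_nonneg ((coordPair k l ((starRingEnd ℂ) (v k) * v l)).1
          - (coordPair l k ((starRingEnd ℂ) (v l) * v k)).2)]
    _ = ∑ k : S, ∑ l : S, (2 * (coordPair k l ((starRingEnd ℂ) (v k) * v l)).1 ^ 2
        + 2 * (coordPair k l ((starRingEnd ℂ) (v k) * v l)).2 ^ 2) := by
        simp only [Finset.sum_add_distrib]
        congr 1
        rw [Finset.sum_comm]
    _ ≤ ∑ k : S, ∑ l : S, 2 * (‖v k‖ ^ 2 * ‖v l‖ ^ 2) := by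
        refine Finset.sum_le_sum fun k _ => Finset.sum_le_sum fun l _ => ?_
        have := coordPair_sq_le k l ((starRingEnd ℂ) (v k) * v l)
        rw [norm_mul, RCLike.norm_conj, mul_pow] at this
        linarith
    _ = 2 * ‖v‖ ^ 4 := by
        simp only [← Finset.mul_sum, ← Finset.sum_mul]
        rw [← EuclideanSpace.norm_sq_eq]
        ring

/-- At a fixed vector the quadratic form is a centred Gaussian variable of variance at most 2‖v‖⁴.
-/
theorem lintegral_exp_rayleigh_le (S : Finset ℤ) (c : Fin 4) (v : EuclideanSpace ℂ S) (t : ℝ) :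
    ∫⁻ x, ENNReal.ofReal (Real.exp (t * rayleigh (colourBlock S (hermField x) c) v)) ∂fieldLaw
      ≤ ENNReal.ofReal (Real.exp (t ^ 2 * ‖v‖ ^ 4)) := by
  set b : Fin 4 × ℤ × ℤ → ℝ := fun i =>
    if h : i.2.1 ∈ S ∧ i.2.2 ∈ S then rayleighCoeff v ⟨i.2.1, h.1⟩ ⟨i.2.2, h.2⟩ else 0 with hb
  have hbv : ∀ k l : S, b (c, (k : ℤ), (l : ℤ)) = rayleighCoeff v k l := fun k l => by
    rw [hb]
    exact dif_pos ⟨k.2, l.2⟩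
  have hsum : ∀ f : Fin 4 × ℤ × ℤ → ℝ, ∑ i ∈ {c} ×ˢ S ×ˢ S, f i
      = ∑ k : S, ∑ l : S, f (c, (k : ℤ), (l : ℤ)) := by
    intro f
    rw [Finset.sum_product, Finset.sum_singleton, Finset.sum_product, ← Finset.sum_coe_sort S]
    exact Finset.sum_congr rfl fun k _ => (Finset.sum_coe_sort S fun l => f (c, (k : ℤ), l)).symm
  have e1 : ∀ x, t * rayleigh (colourBlock S (hermField x) c) v
      = ∑ i ∈ {c} ×ˢ S ×ˢ S, (t * b i) * x i := by
    intro x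
    rw [rayleigh_colourBlock, hsum]
    simp only [hbv, mul_assoc, ← Finset.mul_sum]
  simp only [e1]
  rw [fieldLaw, lintegral_exp_sum_mul]
  refine ENNReal.ofReal_le_ofReal (Real.exp_le_exp.2 ?_)
  rw [hsum]
  simp only [hbv, mul_pow, ← Finset.mul_sum]
  have := mul_le_mul_of_nonneg_left (sum_rayleighCoeff_sq_le v) (sq_nonneg t)
  linarith

theorem measurable_rayleigh (S : Finset ℤ) (c : Fin 4) :
    Measurable fun p : Coord × EuclideanSpace ℂ S =>
      rayleigh (colourBlock S (hermField p.1) c) p.2 := by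
  simp only [rayleigh_eq_sum]
  refine Finset.measurable_sum _ fun k _ => Finset.measurable_sum _ fun l _ => ?_
  have h1 : Measurable fun p : Coord × EuclideanSpace ℂ S => colourBlock S (hermField p.1) c k l :=
    (measurable_hermField c k l).comp measurable_fst
  have h2 : ∀ k : S, Measurable fun p : Coord × EuclideanSpace ℂ S => p.2 k := fun k => by fun_prop
  exact measurable_re.comp
    (((continuous_conj.measurable.comp (h2 k)).mul (h2 l)).mul h1)

theorem measurable_rayleigh_left (S : Finset ℤ) (c : Fin 4) (v : EuclideanSpace ℂ S) :
    Measurable fun x : Coord => rayleigh (colourBlock S (hermField x) c) v := by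
  simp only [rayleigh_eq_sum]
  refine Finset.measurable_sum _ fun k _ => Finset.measurable_sum _ fun l _ => ?_
  have h1 : Measurable fun x : Coord => colourBlock S (hermField x) c k l :=
    measurable_hermField c k l
  exact measurable_re.comp (h1.const_mul _)

/-- Amounts to 16⁶ ≤ e¹⁷. -/
theorem sixteen_pow_le_exp {d : ℕ} {N : ℝ} (hd : (d : ℝ) ≤ 6 * N) :
    (16 : ℝ) ^ d ≤ Real.exp (17 * N) := by
  have h1 : (16 : ℝ) ≤ Real.exp (17 / 6) := by
    have h2 : (2.7182818283 : ℝ) < Real.exp 1 := Real.exp_one_gt_d9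
    refine le_of_pow_le_pow_left₀ (n := 6) (by norm_num) (Real.exp_pos _).le ?_
    rw [← Real.exp_nat_mul]
    have h3 : Real.exp ((6 : ℕ) * (17 / 6)) = Real.exp 1 ^ 17 := by
      rw [← Real.exp_nat_mul]
      norm_num
    rw [h3]
    calc (16 : ℝ) ^ 6 ≤ 2.7182818283 ^ 17 := by norm_num
      _ ≤ _ := by gcongr
  calc (16 : ℝ) ^ d ≤ Real.exp (17 / 6) ^ d := by gcongr
    _ = Real.exp (d * (17 / 6)) := by rw [← Real.exp_nat_mul]
    _ ≤ _ := Real.exp_le_exp.2 (by linarith)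

/-- An average over the ball of radius 2 replaces a net of the sphere: `exp_mul_measure_ball_le`,
Markov's inequality and Fubini. The balls of radii 2 and 1/8, in real dimension 2|S| ≤ 6N, have
volume ratio at most exp(17N), and t = θ/64 minimizes -tθ/2 + 16t², with value -θ²/256. -/
theorem fieldLaw_norm_colourBlock_gt_le (S : Finset ℤ) (c : Fin 4) {θ N : ℝ} (hθ : 0 ≤ θ)
    (hS : (S.card : ℝ) ≤ 3 * N) :
    fieldLaw {x | θ < ‖colourBlock S (hermField x) c‖}
      ≤ ENNReal.ofReal (2 * Real.exp (17 * N - θ ^ 2 / 256)) := by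
  set μ : Measure (EuclideanSpace ℂ S) := Measure.addHaar with hμ
  set t := θ / 64 with ht
  have ht0 : 0 ≤ t := by positivity
  set G : Coord → ENNReal := fun x => ∫⁻ v in Metric.ball 0 2,
    (ENNReal.ofReal (Real.exp (t * rayleigh (colourBlock S (hermField x) c) v))
      + ENNReal.ofReal (Real.exp (-t * rayleigh (colourBlock S (hermField x) c) v))) ∂μ with hG
  have hmeas : Measurable (Function.uncurry fun (x : Coord) (v : EuclideanSpace ℂ S) =>
      ENNReal.ofReal (Real.exp (t * rayleigh (colourBlock S (hermField x) c) v))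
      + ENNReal.ofReal (Real.exp (-t * rayleigh (colourBlock S (hermField x) c) v))) := by
    have h := measurable_rayleigh S c
    exact (Real.measurable_exp.comp (h.const_mul t)).ennreal_ofReal.add
      (Real.measurable_exp.comp (h.const_mul (-t))).ennreal_ofReal
  set ε := ENNReal.ofReal (Real.exp (t * (θ / 2))) * μ (Metric.ball 0 (1 / 8)) with hε
  have hsub : {x | θ < ‖colourBlock S (hermField x) c‖} ⊆ {x | ε ≤ G x} := fun x hx =>
    exp_mul_measure_ball_le μ (colourBlock_hermField_isHermitian S x c) hθ ht0 hx
  have hint : ∫⁻ x, G x ∂fieldLaw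
      ≤ ENNReal.ofReal (2 * Real.exp (16 * t ^ 2)) * μ (Metric.ball 0 2) := by
    rw [hG, lintegral_lintegral_swap hmeas.aemeasurable, ← setLIntegral_const]
    refine setLIntegral_mono' measurableSet_ball fun v hv => ?_
    rw [mem_ball_zero_iff] at hv
    have h4 : ‖v‖ ^ 4 ≤ 16 := (pow_le_pow_left₀ (norm_nonneg _) hv.le 4).trans (by norm_num)
    have hb : ∀ s : ℝ, s ^ 2 = t ^ 2 → ∫⁻ x, ENNReal.ofReal
        (Real.exp (s * rayleigh (colourBlock S (hermField x) c) v)) ∂fieldLaw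
        ≤ ENNReal.ofReal (Real.exp (16 * t ^ 2)) := by
      intro s hs
      refine (lintegral_exp_rayleigh_le S c v s).trans
        (ENNReal.ofReal_le_ofReal (Real.exp_le_exp.2 ?_))
      rw [hs]
      nlinarith [sq_nonneg t]
    have hm := measurable_rayleigh_left S c v
    have hm' : Measurable fun x : Coord => ENNReal.ofReal
        (Real.exp (t * rayleigh (colourBlock S (hermField x) c) v)) :=
      (Real.measurable_exp.comp (hm.const_mul t)).ennreal_ofReal
    rw [lintegral_add_left hm', two_mul,
      ENNReal.ofReal_add (Real.exp_pos _).le (Real.exp_pos _).le]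
    exact add_le_add (hb t rfl) (hb (-t) (neg_sq t))
  have hmain : ε * fieldLaw {x | θ < ‖colourBlock S (hermField x) c‖}
      ≤ ENNReal.ofReal (2 * Real.exp (16 * t ^ 2)) * μ (Metric.ball 0 2) :=
    (mul_le_mul_right (measure_mono hsub) _).trans
      ((mul_meas_ge_le_lintegral₀ (hmeas.lintegral_prod_right').aemeasurable ε).trans hint)
  have hball : μ (Metric.ball 0 2) = ENNReal.ofReal (16 ^ Module.finrank ℝ (EuclideanSpace ℂ S))
      * μ (Metric.ball 0 (1 / 8)) := by
    rw [← Measure.addHaar_ball_mul_of_pos μ 0 (by norm_num : (0 : ℝ) < 16)]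
    norm_num
  have hd : (Module.finrank ℝ (EuclideanSpace ℂ S) : ℝ) ≤ 6 * N := by
    rw [finrank_real_of_complex, finrank_euclideanSpace, Fintype.card_coe]
    push_cast
    linarith
  have hm0 : μ (Metric.ball 0 (1 / 8)) ≠ 0 := (Metric.measure_ball_pos μ 0 (by norm_num)).ne'
  have hm1 : μ (Metric.ball 0 (1 / 8)) ≠ ⊤ := measure_ball_lt_top.ne
  rw [hε, hball, ← mul_assoc, mul_right_comm, ENNReal.mul_le_mul_iff_left hm0 hm1,
    ← ENNReal.ofReal_mul (by positivity)] at hmain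
  have hexp : ENNReal.ofReal (Real.exp (t * (θ / 2))) ≠ 0 := by
    rw [Ne, ENNReal.ofReal_eq_zero, not_le]
    exact Real.exp_pos _
  refine (ENNReal.mul_le_mul_iff_right hexp ENNReal.ofReal_ne_top).1 (hmain.trans ?_)
  rw [← ENNReal.ofReal_mul (Real.exp_pos _).le]
  refine ENNReal.ofReal_le_ofReal ?_
  calc _ ≤ 2 * Real.exp (16 * t ^ 2) * Real.exp (17 * N) := by
        have := sixteen_pow_le_exp hd
        gcongr
    _ = 2 * (Real.exp (16 * t ^ 2) * Real.exp (17 * N)) := by ring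
    _ = 2 * (Real.exp (t * (θ / 2)) * Real.exp (17 * N - θ ^ 2 / 256)) := by
        rw [← Real.exp_add, ← Real.exp_add]
        congr 2
        rw [ht]
        ring
    _ = _ := by ring

end Tail

end TensorT44
end

noncomputable section

namespace TensorT44

open MeasureTheory ProbabilityTheory Complex

/-! ### Exponential moments of the interaction in one slice. -/

section SingleNode

open scoped Matrix.Norms.L2Operator

theorem measurable_tensorSum (m n : Momentum) :
    Measurable fun x : Coord => tensorSum (hermField x) m n := by
  unfold tensorSum
  refine Finset.measurable_sum _ fun c _ => ?_
  split_ifs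
  · exact measurable_hermField c _ _
  · exact measurable_const

theorem measurable_quadForm (F : Finset Momentum) (w : Momentum → Momentum → ℝ) :
    Measurable fun x : Coord => quadForm F w (hermField x) := by
  unfold quadForm
  exact Finset.measurable_sum _ fun m _ => Finset.measurable_sum _ fun n _ =>
    ((measurable_tensorSum m n).norm.pow_const 2).const_mul _

theorem wSmall_nonneg {M : ℕ} (hM : 1 < M) (J : ℕ) (m n : Momentum) : 0 ≤ wSmall M J m n := by
  have hη : 0 < etaScale M J := zero_lt_one.trans_le (one_le_etaScale hM J)
  have h1 := wDiag_nonneg M J m n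
  have h2 := wHalf_nonneg M J m n
  have h3 := wTwo_nonneg M J m n
  have h4 := wLow_nonneg (etaScale M J ^ 4) m n
  unfold wSmall
  positivity

theorem wLarge_nonneg (M J : ℕ) (m n : Momentum) : 0 ≤ wLarge M J m n :=
  add_nonneg (add_nonneg (wDiag_nonneg M J m n) (wHalf_nonneg M J m n)) (wOne_nonneg M J m n)

/-- The fields for which some block has a large operator norm. -/
def largeFields (M J : ℕ) : Set Coord :=
  ⋃ c, {x | 80 * etaScale M J ^ 5
    < ‖colourBlock (Finset.Icc (-(M : ℤ) ^ J) ((M : ℤ) ^ J)) (hermField x) c‖}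

/-- With θ = 80 η⁵ the exponent is 17 η⁸ - 25 η¹⁰ ≤ -8 η¹⁰, which leaves room for the factor 2 · 4 ≤
e⁷ from two signs and four colours. A threshold above the typical size η⁴ of the norm makes the
probability decay faster than exp(-N). -/
theorem fieldLaw_largeFields_le {M : ℕ} (hM : 1 < M) (J : ℕ) :
    fieldLaw (largeFields M J) ≤ ENNReal.ofReal (Real.exp (-(etaScale M J ^ 10))) := by
  have hη := one_le_etaScale hM J
  have hp := etaScale_pow M J
  set η := etaScale M J with hηdef
  have h1 : ∀ c, fieldLaw {x | 80 * η ^ 5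
      < ‖colourBlock (Finset.Icc (-(M : ℤ) ^ J) ((M : ℤ) ^ J)) (hermField x) c‖}
      ≤ ENNReal.ofReal (2 * Real.exp (-(8 * η ^ 10))) := by
    intro c
    refine (fieldLaw_norm_colourBlock_gt_le _ c (by positivity) (card_Icc_le hM J)).trans
      (ENNReal.ofReal_le_ofReal ?_)
    have h3 : η ^ 8 ≤ η ^ 10 := pow_le_pow_right₀ hη (by norm_num)
    have h4 : 17 * (M : ℝ) ^ J - (80 * η ^ 5) ^ 2 / 256 ≤ -(8 * η ^ 10) := by
      rw [← hp]
      have : (80 * η ^ 5) ^ 2 / 256 = 25 * η ^ 10 := by ring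
      linarith
    exact mul_le_mul_of_nonneg_left (Real.exp_le_exp.2 h4) zero_le_two
  refine (measure_iUnion_fintype_le _ _).trans ((Finset.sum_le_sum fun c _ => h1 c).trans ?_)
  rw [Finset.sum_const, Finset.card_univ, Fintype.card_fin, nsmul_eq_mul]
  have h5 : ((4 : ℕ) : ENNReal) = ENNReal.ofReal 4 := by norm_num
  rw [h5, ← ENNReal.ofReal_mul (by norm_num)]
  refine ENNReal.ofReal_le_ofReal ?_
  have h6 : 1 ≤ η ^ 10 := one_le_pow₀ hη
  have h7 : (8 : ℝ) ≤ Real.exp 7 := by linarith [Real.add_one_le_exp (7 : ℝ)]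
  calc 4 * (2 * Real.exp (-(8 * η ^ 10))) = 8 * Real.exp (-(8 * η ^ 10)) := by ring
    _ ≤ Real.exp 7 * Real.exp (-(8 * η ^ 10)) := by gcongr
    _ = Real.exp (7 - 8 * η ^ 10) := by rw [← Real.exp_add]; ring_nf
    _ ≤ _ := Real.exp_le_exp.2 (by linarith)

theorem norm_tensorOp_le_of_notMem {M J : ℕ} {x : Coord} (hx : x ∉ largeFields M J) :
    ‖tensorOp (momenta M J) (hermField x)‖ ≤ 320 * etaScale M J ^ 5 := by
  have h1 : ∀ c, ‖colourBlock (Finset.Icc (-(M : ℤ) ^ J) ((M : ℤ) ^ J)) (hermField x) c‖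
      ≤ 80 * etaScale M J ^ 5 := by
    intro c
    by_contra h
    exact hx (Set.mem_iUnion.2 ⟨c, not_le.1 h⟩)
  refine (norm_tensorOp_le (fun n hn c => apply_mem_Icc hn c) h1).trans (le_of_eq ?_)
  ring

theorem exp_le_half_add (y b : ℝ) :
    Real.exp y ≤ Real.exp b / 2 + Real.exp (2 * y - b) / 2 := by
  have h1 : Real.exp y = Real.exp (b / 2) * Real.exp (y - b / 2) := by
    rw [← Real.exp_add]; ring_nf
  have h2 : Real.exp b = Real.exp (b / 2) ^ 2 := by rw [← Real.exp_nat_mul]; push_cast; ring_nf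
  have h3 : Real.exp (2 * y - b) = Real.exp (y - b / 2) ^ 2 := by
    rw [← Real.exp_nat_mul]; push_cast; ring_nf
  rw [h1, h2, h3]
  nlinarith [sq_nonneg (Real.exp (b / 2) - Real.exp (y - b / 2))]

/-- A random variable bounded by one quantity off a rare event, and by a larger one always, has
the exponential moments of the first one. -/
theorem lintegral_exp_le_of_rare {Ω : Type*} [MeasurableSpace Ω] {P : Measure Ω}
    {X Y Z : Ω → ℝ} {S : Set Ω} {b y z : ℝ} (hY : Measurable Y) (hZ : Measurable Z)
    (hXY : ∀ ω ∉ S, X ω ≤ Y ω) (hXZ : ∀ ω, X ω ≤ Z ω)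
    (hS : P S ≤ ENNReal.ofReal (Real.exp (-b)))
    (hYi : ∫⁻ ω, ENNReal.ofReal (Real.exp (Y ω)) ∂P ≤ ENNReal.ofReal y)
    (hZi : ∫⁻ ω, ENNReal.ofReal (Real.exp (2 * Z ω)) ∂P ≤ ENNReal.ofReal (Real.exp z))
    (hy : 0 ≤ y) (hzb : z ≤ b) :
    ∫⁻ ω, ENNReal.ofReal (Real.exp (X ω)) ∂P ≤ ENNReal.ofReal (y + 1) := by
  -- On the rare event e^Z ≤ e^b/2 + e^{2Z-b}/2; the first term integrates to at most 1/2 by rarity,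
  -- the second by the moment of 2Z and z ≤ b.
  have hpt : ∀ ω, ENNReal.ofReal (Real.exp (X ω)) ≤ ENNReal.ofReal (Real.exp (Y ω))
      + (S.indicator (fun _ => ENNReal.ofReal (Real.exp b / 2)) ω
        + ENNReal.ofReal (Real.exp (-b) / 2) * ENNReal.ofReal (Real.exp (2 * Z ω))) := by
    intro ω
    by_cases hω : ω ∈ S
    · rw [Set.indicator_of_mem hω]
      refine le_add_left ?_
      rw [← ENNReal.ofReal_mul (by positivity), ← ENNReal.ofReal_add (by positivity)
        (by positivity)]
      refine ENNReal.ofReal_le_ofReal ((Real.exp_le_exp.2 (hXZ ω)).trans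
        ((exp_le_half_add (Z ω) b).trans (le_of_eq ?_)))
      rw [sub_eq_add_neg, Real.exp_add]
      ring
    · exact le_add_right (ENNReal.ofReal_le_ofReal (Real.exp_le_exp.2 (hXY ω hω)))
  refine (lintegral_mono hpt).trans ?_
  have hYm : Measurable fun ω => ENNReal.ofReal (Real.exp (Y ω)) :=
    (Real.measurable_exp.comp hY).ennreal_ofReal
  have hZm : Measurable fun ω => ENNReal.ofReal (Real.exp (2 * Z ω)) :=
    (Real.measurable_exp.comp (hZ.const_mul 2)).ennreal_ofReal
  rw [lintegral_add_left hYm, lintegral_add_right _ (hZm.const_mul _), lintegral_const_mul _ hZm,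
    ENNReal.ofReal_add hy zero_le_one]
  refine add_le_add hYi ?_
  have h1 : ∫⁻ ω, S.indicator (fun _ => ENNReal.ofReal (Real.exp b / 2)) ω ∂P
      ≤ ENNReal.ofReal (1 / 2) := by
    refine (lintegral_indicator_const_le S _).trans ?_
    refine (mul_le_mul_right hS _).trans ?_
    rw [← ENNReal.ofReal_mul (by positivity)]
    refine ENNReal.ofReal_le_ofReal (le_of_eq ?_)
    rw [div_mul_eq_mul_div, ← Real.exp_add, add_neg_cancel, Real.exp_zero]
  have h2 : ENNReal.ofReal (Real.exp (-b) / 2) * ∫⁻ ω, ENNReal.ofReal (Real.exp (2 * Z ω)) ∂P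
      ≤ ENNReal.ofReal (1 / 2) := by
    refine (mul_le_mul_right hZi _).trans ?_
    rw [← ENNReal.ofReal_mul (by positivity)]
    refine ENNReal.ofReal_le_ofReal ?_
    rw [div_mul_eq_mul_div, ← Real.exp_add]
    have : Real.exp (-b + z) ≤ 1 := Real.exp_le_one_iff.2 (by linarith)
    linarith
  refine (add_le_add h1 h2).trans (le_of_eq ?_)
  rw [← ENNReal.ofReal_add (by norm_num) (by norm_num)]
  norm_num

theorem lintegral_exp_affine_quadForm_le {M J : ℕ} {w : Momentum → Momentum → ℝ}
    (hw : ∀ m n, 0 ≤ w m n) {u v τ : ℝ} (hu : 0 ≤ u)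
    (hv : ∀ c k l, wCoeff (momenta M J) w c k l ≤ v) (huv : 32 * u * v ≤ 1)
    (hτ : wTrace (momenta M J) w ≤ τ) :
    ∫⁻ x, ENNReal.ofReal (Real.exp (u * (1 + quadForm (momenta M J) w (hermField x)))) ∂fieldLaw
      ≤ ENNReal.ofReal (Real.exp (u * (1 + 16 * τ))) := by
  have h1 := lintegral_exp_quadForm_le (F := momenta M J)
    (fun n hn c => apply_mem_Icc hn c) hw hu hv huv
  have hm : Measurable fun x : Coord =>
      ENNReal.ofReal (Real.exp (u * quadForm (momenta M J) w (hermField x))) :=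
    (Real.measurable_exp.comp ((measurable_quadForm _ w).const_mul u)).ennreal_ofReal
  simp only [mul_add, mul_one, Real.exp_add, ENNReal.ofReal_mul (Real.exp_pos u).le]
  rw [lintegral_const_mul _ hm]
  refine mul_le_mul_right (h1.trans (ENNReal.ofReal_le_ofReal (Real.exp_le_exp.2 ?_))) _
  calc 16 * u * wTrace (momenta M J) w ≤ 16 * u * τ := by gcongr
    _ = _ := by ring

/-- The exponent attached to the slice `J`; the inverses of these exponents have sum at most one. -/
def sliceExponent (J : ℕ) : ℕ := J * (J + 1)

theorem sliceExponent_le {M : ℕ} (hM : 1 < M) (J : ℕ) :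
    (sliceExponent J : ℝ) ≤ 256 * etaScale M J ^ 2 := by
  have h1 := one_add_le_etaScale hM J
  have h2 : (0 : ℝ) ≤ J := Nat.cast_nonneg J
  unfold sliceExponent
  push_cast
  nlinarith

theorem two_le_sliceExponent {J : ℕ} (hJ : 1 ≤ J) : 2 ≤ sliceExponent J := by
  unfold sliceExponent
  nlinarith

theorem exp_add_one_le_two_pow {p : ℕ} (hp : 2 ≤ p) {s : ℝ} (hs : s ≤ p / 4) (hs0 : 0 ≤ s) :
    Real.exp s + 1 ≤ 2 ^ p := by
  have hl : (0.6931471803 : ℝ) < Real.log 2 := Real.log_two_gt_d9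
  have hp' : (2 : ℝ) ≤ p := by exact_mod_cast hp
  have h1 : (2 : ℝ) ^ p = Real.exp (p * Real.log 2) := by
    rw [Real.exp_nat_mul, Real.exp_log zero_lt_two]
  have h2 : (1 : ℝ) ≤ Real.exp s := Real.one_le_exp hs0
  calc Real.exp s + 1 ≤ 2 * Real.exp s := by linarith
    _ = Real.exp (Real.log 2 + s) := by rw [Real.exp_add, Real.exp_log zero_lt_two]
    _ ≤ _ := by
      rw [h1]
      refine Real.exp_le_exp.2 ?_
      -- p (log 2 - 1/4) ≥ log 2 already for p = 2.
      nlinarith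

/-- `lintegral_exp_le_of_rare` with the forms of `wSmall` and `wLarge` multiplied by u = p a K ρ.
Since p = O(η²) and the coefficients are O(η⁻⁶), the exponential integrals converge with a margin
η⁻⁴; the bounded trace of `wSmall` gives exp(O(pρ)), which a small ρ brings below 2^p. -/
theorem exists_single_node_bound {M : ℕ} (hM : 1 < M) {a : ℝ} (ha : 0 ≤ a) :
    ∃ ρ₀ > (0 : ℝ), ∀ ρ : ℝ, 0 < ρ → ρ ≤ ρ₀ → ∀ g ∈ cardioid ρ, ∀ J : ℕ, 1 ≤ J →
      ∫⁻ x, ENNReal.ofReal (Real.exp (sliceExponent J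
        * (a * ‖interactionSlice M g J (hermField x)‖))) ∂fieldLaw
        ≤ ENNReal.ofReal (2 ^ sliceExponent J) := by
  obtain ⟨k, hk, hk1, hk2⟩ := exists_amplitude_bounds
  obtain ⟨T, hT, hTb⟩ := exists_weight_bounds hM
  have hM1 : (1 : ℝ) ≤ M := by exact_mod_cast hM.le
  set K := 50000 * (k ^ 4 * (M : ℝ) ^ 4) with hK
  have hK0 : 0 < K := by positivity
  have hden : 0 < 4 * k * M + 16384 * a * K * (1 + 16 * T) := by positivity
  -- The term 4kM serves `SmallCoupling`. In the other one, 16384 = 32 · 2 · 256 collects the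
  -- condition 32tv ≤ 1, the doubled exponent 2u and p ≤ 256 η².
  refine ⟨(4 * k * M + 16384 * a * K * (1 + 16 * T))⁻¹, by positivity,
    fun ρ hρ hρ₀ g hg J hJ => ?_⟩
  rw [le_inv_comm₀ hρ hden] at hρ₀
  have hsum : (4 * k * M + 16384 * a * K * (1 + 16 * T)) * ρ ≤ 1 := by
    calc _ ≤ ρ⁻¹ * ρ := by gcongr
      _ = 1 := inv_mul_cancel₀ hρ.ne'
  have hsmall : 4 * k * M * ρ ≤ 1 := by
    have : 0 ≤ 16384 * a * K * (1 + 16 * T) * ρ := by positivity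
    linarith
  set s := a * K * ρ with hs
  have hs0 : 0 ≤ s := by positivity
  have hsT : 16384 * (s * (1 + 16 * T)) ≤ 1 := by
    have : 0 ≤ 4 * k * M * ρ := by positivity
    have e : 16384 * (s * (1 + 16 * T)) = 16384 * a * K * (1 + 16 * T) * ρ := by rw [hs]; ring
    linarith
  have h : SmallCoupling M k ρ g := ⟨hM, hg.1, hg.2.1, hg.2.2, hk, hk1, hk2, hsmall⟩
  obtain ⟨t1, t2, t3, t4⟩ := hTb J
  have hη := one_le_etaScale hM J
  have hpη := sliceExponent_le hM J
  have hp2 := two_le_sliceExponent hJ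
  set p := sliceExponent J with hp
  set η := etaScale M J with hηdef
  have hη0 : 0 < η := by linarith
  have hp0 : (0 : ℝ) ≤ p := Nat.cast_nonneg p
  set u := (p : ℝ) * s with hu
  have hu0 : 0 ≤ u := by positivity
  have hus : u ≤ 256 * s * η ^ 2 := by
    calc u ≤ 256 * η ^ 2 * s := by rw [hu]; gcongr
      _ = _ := by ring
  have hcoef : 32 * (2 * u) * (T * (η ^ 6)⁻¹) ≤ 1 := by
    have i1 : (η ^ 4)⁻¹ ≤ 1 := inv_le_one_of_one_le₀ (one_le_pow₀ hη)
    calc _ ≤ 32 * (2 * (256 * s * η ^ 2)) * (T * (η ^ 6)⁻¹) := by gcongr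
      _ = 16384 * s * T * (η ^ 4)⁻¹ := by field_simp; ring
      _ ≤ 16384 * s * T * 1 := by gcongr
      _ ≤ 1 := by
        have : 0 ≤ s * (1 + 15 * T) := by positivity
        linarith
  have hcoef' : 32 * u * (T * (η ^ 6)⁻¹) ≤ 1 := by
    have : 0 ≤ u * (T * (η ^ 6)⁻¹) := by positivity
    linarith
  have hbound : ∀ {V q : ℝ}, V ≤ K * ρ * (1 + q) → p * (a * V) ≤ u * (1 + q) := by
    intro V q hV
    calc p * (a * V) ≤ p * (a * (K * ρ * (1 + q))) := by gcongr
      _ = _ := by rw [hu, hs]; ring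
  refine (lintegral_exp_le_of_rare (S := largeFields M J) (b := η ^ 10)
    (Y := fun x => u * (1 + quadForm (momenta M J) (wSmall M J) (hermField x)))
    (Z := fun x => u * (1 + quadForm (momenta M J) (wLarge M J) (hermField x)))
    (y := Real.exp (u * (1 + 16 * T))) (z := 2 * u * (1 + 16 * (T * η ^ 8)))
    (((measurable_quadForm _ _).const_add 1).const_mul u)
    (((measurable_quadForm _ _).const_add 1).const_mul u)
    (fun x hx => hbound (h.norm_interactionSlice_le_small hJ (hermField_isHermitian x)
      (norm_tensorOp_le_of_notMem hx)))
    (fun x => hbound (h.norm_interactionSlice_le_large hJ (hermField_isHermitian x)))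
    (fieldLaw_largeFields_le hM J)
    (lintegral_exp_affine_quadForm_le (wSmall_nonneg hM J) hu0 t2 hcoef' t1) ?_
    (Real.exp_pos _).le ?_).trans (ENNReal.ofReal_le_ofReal ?_)
  · have := lintegral_exp_affine_quadForm_le (wLarge_nonneg M J) (u := 2 * u) (by positivity) t4
      hcoef t3
    simpa only [mul_assoc] using this
  -- The order p of the moment and the trace of `wLarge` give η² · η⁸, just the power η¹⁰ in the
  -- probability of the large fields.
  · have i1 : 1 ≤ η ^ 8 := one_le_pow₀ hη
    calc 2 * u * (1 + 16 * (T * η ^ 8)) ≤ 2 * (256 * s * η ^ 2) * (η ^ 8 + 16 * (T * η ^ 8)) := by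
          gcongr
      _ = 512 * (s * (1 + 16 * T)) * η ^ 10 := by ring
      _ ≤ 1 * η ^ 10 := by
          have : 0 ≤ s * (1 + 16 * T) := by positivity
          gcongr
          linarith
      _ = _ := one_mul _
  · refine exp_add_one_le_two_pow hp2 ?_ (by positivity)
    rw [hu, mul_assoc]
    have : 0 ≤ s * (1 + 16 * T) := by positivity
    rw [div_eq_mul_inv]
    refine mul_le_mul_of_nonneg_left ?_ hp0
    norm_num
    linarith

end SingleNode

end TensorT44
end

noncomputable section

namespace TensorT44

open MeasureTheory ProbabilityTheory Complex

/-! ### Measurability of the interaction. -/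

section Measurability

variable {Ω ι : Type*} [MeasurableSpace Ω] [Fintype ι]

theorem measurable_mul_apply {A B : Ω → Matrix ι ι ℂ} (hA : ∀ i j, Measurable fun ω => A ω i j)
    (hB : ∀ i j, Measurable fun ω => B ω i j) (i j : ι) : Measurable fun ω => (A ω * B ω) i j := by
  simp only [Matrix.mul_apply]
  exact Finset.measurable_sum _ fun k _ => (hA i k).mul (hB k j)

theorem measurable_trace {A : Ω → Matrix ι ι ℂ} (hA : ∀ i j, Measurable fun ω => A ω i j) :
    Measurable fun ω => (A ω).trace := by
  simp only [Matrix.trace, Matrix.diag]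
  exact Finset.measurable_sum _ fun i _ => hA i i

variable [DecidableEq ι]

theorem measurable_det {A : Ω → Matrix ι ι ℂ} (hA : ∀ i j, Measurable fun ω => A ω i j) :
    Measurable fun ω => (A ω).det := by
  simp only [Matrix.det_apply]
  exact Finset.measurable_sum _ fun p _ =>
    (Finset.measurable_prod _ fun i _ => hA (p i) i).const_smul _

theorem measurable_inv_apply {A : Ω → Matrix ι ι ℂ} (hA : ∀ i j, Measurable fun ω => A ω i j)
    (i j : ι) : Measurable fun ω => (A ω)⁻¹ i j := by
  simp only [inv_eq_det_inv_smul, Matrix.smul_apply, smul_eq_mul, Matrix.adjugate_apply]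
  refine (measurable_det hA).inv.mul (measurable_det fun k l => ?_)
  simp only [Matrix.updateRow_apply]
  split_ifs
  · exact measurable_const
  · exact hA k l

/-- The resolvent is measurable by Cramer's rule, and a parameter integral of a jointly measurable
function is measurable even where it fails to converge. -/
theorem measurable_traceLogThree {U : Ω → Matrix ι ι ℂ}
    (hU : ∀ i j, Measurable fun ω => U ω i j) : Measurable fun ω => traceLogThree (U ω) := by
  unfold traceLogThree
  have h2 : Measurable fun ω => (U ω ^ 2).trace := by
    simp only [pow_two]
    exact measurable_trace (measurable_mul_apply hU hU)
  refine ((measurable_trace hU).add (h2.div_const 2)).sub ?_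
  simp only [intervalIntegral.integral_of_le zero_le_one]
  have hJ : Measurable fun p : Ω × ℝ => (U p.1 * (1 - (p.2 : ℂ) • U p.1)⁻¹).trace := by
    have hU' : ∀ i j, Measurable fun p : Ω × ℝ => U p.1 i j :=
      fun i j => (hU i j).comp measurable_fst
    refine measurable_trace (measurable_mul_apply hU' (measurable_inv_apply fun i j => ?_))
    simp only [Matrix.sub_apply, Matrix.smul_apply, smul_eq_mul]
    exact ((measurable_ofReal.comp measurable_snd).mul (hU' i j)).const_sub _
  exact hJ.stronglyMeasurable.integral_prod_right'.measurable

end Measurability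

theorem measurable_interactionLe (M : ℕ) (g : ℂ) (j : ℕ) :
    Measurable fun x : Coord => interactionLe M g j (hermField x) := by
  unfold interactionLe
  split_ifs
  · exact measurable_const
  have hS : ∀ m n, Measurable fun x : Coord => sigmaOp M g j (hermField x) m n := by
    intro m n
    simp only [sigmaOp, Matrix.of_apply]
    exact ((measurable_tensorSum _ _).const_mul _).mul_const _
  have hU : ∀ m n, Measurable fun x : Coord => uOp M g j (hermField x) m n := by
    intro m n
    simp only [uOp, Matrix.add_apply]
    exact ((hS m n).add_const _).add_const _
  refine ((measurable_traceLogThree hU).add (measurable_trace ?_)).add_const _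
  simp only [pow_two]
  exact measurable_mul_apply (fun _ _ => measurable_const) (measurable_mul_apply hS hS)

theorem measurable_interactionSlice (M : ℕ) (g : ℂ) (j : ℕ) :
    Measurable fun x : Coord => interactionSlice M g j (hermField x) :=
  (measurable_interactionLe M g j).sub (measurable_interactionLe M g (j - 1))

/-! ### Positivity of the weakening matrix. -/

section Weakening

/-- The quadratic form of an equivalence relation is a sum of squares over its classes. -/
theorem sum_setoid_nonneg {B : Type*} [Fintype B] (r : Setoid B) [DecidableRel r.r] (x : B → ℝ) :
    0 ≤ ∑ a, ∑ b, if r.r a b then x a * x b else 0 := by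
  classical
  have h : ∑ a, ∑ b, (if r.r a b then x a * x b else 0)
      = ∑ q : Quotient r, (∑ a, if Quotient.mk r a = q then x a else 0) ^ 2 := by
    have h1 : ∀ q : Quotient r, (∑ a, if Quotient.mk r a = q then x a else 0) ^ 2
        = ∑ a, ∑ b, if Quotient.mk r a = q then
          (if Quotient.mk r b = q then x a * x b else 0) else 0 := by
      intro q
      rw [pow_two, Finset.sum_mul_sum]
      refine Finset.sum_congr rfl fun a _ => Finset.sum_congr rfl fun b _ => ?_
      split_ifs <;> simp
    simp only [h1]
    symm
    rw [Finset.sum_comm]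
    refine Finset.sum_congr rfl fun a _ => ?_
    rw [Finset.sum_comm]
    refine Finset.sum_congr rfl fun b _ => ?_
    rw [Finset.sum_ite_eq Finset.univ (Quotient.mk r a), if_pos (Finset.mem_univ _)]
    refine if_congr ?_ rfl rfl
    exact ⟨fun h => r.symm (Quotient.exact h), fun h => Quotient.sound (r.symm h)⟩
  rw [h]
  exact Finset.sum_nonneg fun _ _ => sq_nonneg _

/-- Ultrametric matrices with unit diagonal are positive semidefinite. -/
theorem posSemidef_of_ultrametric {B : Type*} [Fintype B] {X : Matrix B B ℝ}
    (h1 : ∀ a, X a a = 1) (h01 : ∀ a b, X a b ∈ Set.Icc (0 : ℝ) 1)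
    (hs : ∀ a b, X a b = X b a) (hu : ∀ a b c, min (X a b) (X b c) ≤ X a c) :
    X.PosSemidef := by
  classical
  refine Matrix.PosSemidef.of_dotProduct_mulVec_nonneg ?_ fun x => ?_
  · ext a b
    simp [hs a b]
  -- Layer cake: X is the average over t in [0, 1] of the indicators of t ≤ X a b. By the
  -- ultrametric inequality each of these is an equivalence relation, whose quadratic form is a sum
  -- of squares.
  · have hlayer : ∀ a b, X a b = ∫ t in (0 : ℝ)..1, if t ≤ X a b then (1 : ℝ) else 0 := by
      intro a b
      have e : (fun t : ℝ => if t ≤ X a b then (1 : ℝ) else 0)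
          = (Set.Iic (X a b)).indicator fun _ => 1 := by
        ext t
        simp [Set.indicator_apply]
      rw [e, intervalIntegral.integral_of_le zero_le_one,
        setIntegral_indicator measurableSet_Iic, Set.Ioc_inter_Iic,
        min_eq_right (h01 a b).2]
      simp [(h01 a b).1]
    have hii : ∀ a b, IntervalIntegrable (fun t : ℝ => if t ≤ X a b then x a * x b else 0)
        volume 0 1 := by
      intro a b
      refine (intervalIntegrable_iff_integrableOn_Ioc_of_le zero_le_one).2 ?_
      have e : (fun t : ℝ => if t ≤ X a b then x a * x b else 0)
          = (Set.Iic (X a b)).indicator fun _ => x a * x b := by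
        ext t
        simp [Set.indicator_apply]
      rw [e]
      exact (integrableOn_const (by simp)).indicator measurableSet_Iic
    have heq : star x ⬝ᵥ X.mulVec x
        = ∫ t in (0 : ℝ)..1, ∑ a, ∑ b, if t ≤ X a b then x a * x b else 0 := by
      have hsum : ∀ a, IntervalIntegrable
          (fun t : ℝ => ∑ b, if t ≤ X a b then x a * x b else 0) volume 0 1 := by
        intro a
        have := IntervalIntegrable.sum Finset.univ fun b _ => hii a b
        simpa only [Finset.sum_fn] using this
      rw [intervalIntegral.integral_finsetSum fun a _ => hsum a]
      simp only [dotProduct, Matrix.mulVec, Finset.mul_sum]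
      refine Finset.sum_congr rfl fun a _ => ?_
      rw [intervalIntegral.integral_finsetSum fun b _ => hii a b]
      refine Finset.sum_congr rfl fun b _ => ?_
      have e : (fun t : ℝ => if t ≤ X a b then x a * x b else 0)
          = fun t => (x a * x b) * if t ≤ X a b then (1 : ℝ) else 0 := by
        ext t
        split_ifs <;> simp
      rw [e, intervalIntegral.integral_const_mul, ← hlayer]
      simp only [Pi.star_apply, star_trivial]
      ring
    rw [heq]
    refine intervalIntegral.integral_nonneg zero_le_one fun t ht => ?_
    exact sum_setoid_nonneg
      ⟨fun a b => t ≤ X a b, fun a => (h1 a).symm ▸ ht.2, fun {a b} h => hs a b ▸ h,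
        fun {a b c} h h' => (le_min h h').trans (hu a b c)⟩ x

variable {B : Type*} {T : SimpleGraph B} {w : Sym2 B → ℝ}

theorem finite_path_weights (T : SimpleGraph B) [Finite B] (w : Sym2 B → ℝ) (a b : B) :
    {x | ∃ p : T.Path a b, ∃ e ∈ p.1.edges, x = w e}.Finite := by
  refine (Set.toFinite (Set.range w)).subset ?_
  rintro x ⟨p, e, he, rfl⟩
  exact ⟨e, rfl⟩

variable [DecidableEq B]

theorem nonempty_path_weights (hT : T.IsTree) (w : Sym2 B → ℝ) {a b : B} (hab : a ≠ b) :
    {x | ∃ p : T.Path a b, ∃ e ∈ p.1.edges, x = w e}.Nonempty := by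
  obtain ⟨q⟩ := hT.connected.preconnected a b
  have hne : q.toPath.1.edges ≠ [] := by
    intro h
    have : q.toPath.1.Nil := SimpleGraph.Walk.edges_eq_nil.1 h
    exact hab this.eq
  obtain ⟨e, he⟩ := List.exists_mem_of_ne_nil _ hne
  exact ⟨w e, q.toPath, e, he, rfl⟩

theorem weakening_self (a : B) : weakening T w a a = 1 := by
  simp [weakening]

theorem weakening_of_ne {a b : B} (h : a ≠ b) :
    weakening T w a b = sInf {x | ∃ p : T.Path a b, ∃ e ∈ p.1.edges, x = w e} := by
  simp [weakening, h]

theorem weakening_comm (a b : B) : weakening T w a b = weakening T w b a := by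
  by_cases hab : a = b
  · rw [hab]
  · rw [weakening_of_ne hab, weakening_of_ne (Ne.symm hab)]
    congr 1
    ext x
    constructor <;>
    · rintro ⟨p, e, he, rfl⟩
      exact ⟨p.reverse, e, by simpa using he, rfl⟩

variable [Finite B]

theorem weakening_mem_Icc (hT : T.IsTree) (hw : ∀ e ∈ T.edgeSet, w e ∈ Set.Icc (0 : ℝ) 1)
    (a b : B) : weakening T w a b ∈ Set.Icc (0 : ℝ) 1 := by
  by_cases hab : a = b
  · subst hab
    rw [weakening_self]
    exact ⟨zero_le_one, le_rfl⟩
  · rw [weakening_of_ne hab]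
    obtain ⟨p, e, he, hx⟩ :=
      (nonempty_path_weights hT w hab).csInf_mem (finite_path_weights T w a b)
    rw [hx]
    exact hw e (p.1.edges_subset_edgeSet he)

/-- In a tree the path from `a` to `c` is the reduction of the concatenated paths through `b`, so
each of its edges lies on one of these two. -/
theorem min_weakening_le (hT : T.IsTree) (hw : ∀ e ∈ T.edgeSet, w e ∈ Set.Icc (0 : ℝ) 1)
    (a b c : B) : min (weakening T w a b) (weakening T w b c) ≤ weakening T w a c := by
  by_cases hac : a = c
  · subst hac
    rw [weakening_self]
    exact (min_le_left _ _).trans (weakening_mem_Icc hT hw a b).2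
  by_cases hab : a = b
  · subst hab
    exact min_le_right _ _
  by_cases hbc : b = c
  · subst hbc
    exact min_le_left _ _
  rw [weakening_of_ne hac, weakening_of_ne hab, weakening_of_ne hbc]
  refine le_csInf (nonempty_path_weights hT w hac) ?_
  rintro x ⟨p, e, he, rfl⟩
  obtain ⟨q⟩ := hT.connected.preconnected a b
  obtain ⟨r⟩ := hT.connected.preconnected b c
  have hp : p = (q.toPath.1.append r.toPath.1).toPath := (hT.isAcyclic.subsingleton_path a c).elim _ _
  rw [hp] at he
  have he' := SimpleGraph.Walk.edges_toPath_subset_edges _ he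
  rw [SimpleGraph.Walk.edges_append, List.mem_append] at he'
  rcases he' with h | h
  · exact (min_le_left _ _).trans
      (csInf_le (finite_path_weights T w a b).bddBelow ⟨q.toPath, e, h, rfl⟩)
  · exact (min_le_right _ _).trans
      (csInf_le (finite_path_weights T w b c).bddBelow ⟨r.toPath, e, h, rfl⟩)

end Weakening

/-- Needed for the multivariate Gaussian to have the weakening matrix as its covariance. -/
theorem posSemidef_weakening {B : Type*} [Fintype B] [DecidableEq B] {T : SimpleGraph B}
    {w : Sym2 B → ℝ} (hT : T.IsTree) (hw : ∀ e ∈ T.edgeSet, w e ∈ Set.Icc (0 : ℝ) 1) :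
    (weakening T w).PosSemidef :=
  posSemidef_of_ultrametric weakening_self (weakening_mem_Icc hT hw) weakening_comm
    (min_weakening_le hT hw)

end TensorT44
end

/-! ### Hölder's inequality over a block, and the theorem. -/

noncomputable section

namespace TensorT44

open MeasureTheory ProbabilityTheory Complex

/-- Distinct scales use each term of the telescoping series ∑ 1/(J(J+1)) = 1 at most once. -/
theorem sum_inv_sliceExponent_le {B : Type*} {j : B → ℕ} (hj : Function.Injective j)
    (hj1 : ∀ a, 1 ≤ j a) (s : Finset B) : ∑ a ∈ s, (sliceExponent (j a) : ℝ)⁻¹ ≤ 1 := by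
  classical
  have htel : ∀ n : ℕ, ∑ i ∈ Finset.range n, (sliceExponent (i + 1) : ℝ)⁻¹ = 1 - (n + 1 : ℝ)⁻¹ := by
    intro n
    induction n with
    | zero => simp
    | succ n ih =>
      rw [Finset.sum_range_succ, ih, sliceExponent]
      push_cast
      field_simp
      ring
  -- Scales start at 1, hence the shift by one.
  obtain ⟨n, hn⟩ : ∃ n, s.image (fun a => j a - 1) ⊆ Finset.range n :=
    Finset.exists_nat_subset_range _
  have hinj : Set.InjOn (fun a => j a - 1) s := by
    intro a _ b _ hab
    have h1 := hj1 a
    have h2 := hj1 b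
    simp only at hab
    exact hj (by omega)
  calc ∑ a ∈ s, (sliceExponent (j a) : ℝ)⁻¹
      = ∑ i ∈ s.image (fun a => j a - 1), (sliceExponent (i + 1) : ℝ)⁻¹ := by
        rw [Finset.sum_image hinj]
        exact Finset.sum_congr rfl fun a _ => by rw [Nat.sub_add_cancel (hj1 a)]
    _ ≤ ∑ i ∈ Finset.range n, (sliceExponent (i + 1) : ℝ)⁻¹ :=
        Finset.sum_le_sum_of_subset_of_nonneg hn fun i _ _ => by positivity
    _ ≤ 1 := by
        rw [htel]
        have : (0 : ℝ) ≤ (n + 1 : ℝ)⁻¹ := by positivity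
        linarith

theorem measurable_replica_slice {B : Type*} (M : ℕ) (g : ℂ) (J : ℕ) (a : B) :
    Measurable fun ξ : Fin 4 × ℤ × ℤ → EuclideanSpace ℝ B =>
      interactionSlice M g J (replica ξ a) := by
  have h : Measurable fun (ξ : Fin 4 × ℤ × ℤ → EuclideanSpace ℝ B) i => ξ i a := by fun_prop
  have h' := (measurable_interactionSlice M g J).comp h
  simp only [replica_eq]
  exact h'

section Block

variable {B : Type*} [Fintype B] [DecidableEq B] {T : SimpleGraph B} {w : Sym2 B → ℝ}

instance : IsProbabilityMeasure (blockMeasure T w) := by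
  unfold blockMeasure
  infer_instance

/-- Every replica has the law of independent standard Gaussian coordinates. -/
theorem measurePreserving_node (hT : T.IsTree) (hw : ∀ e ∈ T.edgeSet, w e ∈ Set.Icc (0 : ℝ) 1)
    (a : B) : MeasurePreserving
      (fun (ξ : Fin 4 × ℤ × ℤ → EuclideanSpace ℝ B) i => ξ i a) (blockMeasure T w) fieldLaw := by
  have h := measurePreserving_eval_multivariateGaussian (μ := 0) (posSemidef_weakening hT hw)
    (i := a)
  refine ⟨measurable_pi_lambda _ fun i => h.measurable.comp (measurable_pi_apply i), ?_⟩
  have h1 := h.map_eq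
  -- The unit diagonal of the weakening matrix makes every coordinate of a node standard.
  rw [weakening_self, PiLp.zero_apply, Real.toNNReal_one] at h1
  unfold blockMeasure fieldLaw
  rw [Measure.infinitePi_map_pi _ fun _ => h.measurable]
  simp only [h1]

/-- Hölder's inequality over the nodes of a block, with the inverses of the slice exponents. -/
theorem lintegral_block_le {M : ℕ} {g : ℂ} {α : ℝ} (hT : T.IsTree)
    (hw : ∀ e ∈ T.edgeSet, w e ∈ Set.Icc (0 : ℝ) 1) {j : B → ℕ} (hj : Function.Injective j)
    (hj1 : ∀ a, 1 ≤ j a)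
    (hnode : ∀ J : ℕ, 1 ≤ J → ∫⁻ x, ENNReal.ofReal (Real.exp (sliceExponent J
      * (α * ‖interactionSlice M g J (hermField x)‖))) ∂fieldLaw
        ≤ ENNReal.ofReal (2 ^ sliceExponent J)) (s : Finset B) :
    ∫⁻ ξ, ENNReal.ofReal (∏ a ∈ s, Real.exp (α * ‖interactionSlice M g (j a) (replica ξ a)‖))
      ∂(blockMeasure T w) ≤ ENNReal.ofReal (2 ^ s.card) := by
  have hp : ∀ a, (sliceExponent (j a) : ℝ) ≠ 0 := fun a => by
    have := two_le_sliceExponent (hj1 a)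
    positivity
  have hsum := sum_inv_sliceExponent_le hj hj1 s
  have hmeas : ∀ a, Measurable fun ξ : Fin 4 × ℤ × ℤ → EuclideanSpace ℝ B =>
      ENNReal.ofReal (Real.exp (sliceExponent (j a)
        * (α * ‖interactionSlice M g (j a) (replica ξ a)‖))) := fun a =>
    (Real.measurable_exp.comp
      (((measurable_replica_slice M g (j a) a).norm.const_mul α).const_mul _)).ennreal_ofReal
  -- The unused weight 1 - ∑ 1/p goes to the constant function 1, whose integral is 1 for a
  -- probability measure.
  have hH := ENNReal.lintegral_mul_prod_norm_pow_le (μ := blockMeasure T w) s (g := fun _ => 1)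
    aemeasurable_const (fun a _ => (hmeas a).aemeasurable)
    (1 - ∑ a ∈ s, (sliceExponent (j a) : ℝ)⁻¹) (p := fun a => (sliceExponent (j a) : ℝ)⁻¹)
    (by ring) (by linarith) fun a _ => by positivity
  simp only [ENNReal.one_rpow, one_mul, lintegral_one, measure_univ] at hH
  have hpt : ∀ ξ : Fin 4 × ℤ × ℤ → EuclideanSpace ℝ B,
      ENNReal.ofReal (∏ a ∈ s, Real.exp (α * ‖interactionSlice M g (j a) (replica ξ a)‖))
      = ∏ a ∈ s, ENNReal.ofReal (Real.exp (sliceExponent (j a)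
        * (α * ‖interactionSlice M g (j a) (replica ξ a)‖))) ^ (sliceExponent (j a) : ℝ)⁻¹ := by
    intro ξ
    rw [ENNReal.ofReal_prod_of_nonneg fun a _ => (Real.exp_pos _).le]
    refine Finset.prod_congr rfl fun a _ => ?_
    rw [ENNReal.ofReal_rpow_of_pos (Real.exp_pos _), ← Real.exp_mul, mul_right_comm,
      mul_inv_cancel₀ (hp a), one_mul]
  simp only [hpt]
  refine hH.trans ?_
  rw [← Finset.prod_const, ENNReal.ofReal_prod_of_nonneg fun _ _ => zero_le_two]
  refine Finset.prod_le_prod' fun a _ => ?_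
  have hn := hnode (j a) (hj1 a)
  rw [← (measurePreserving_node hT hw a).lintegral_comp] at hn
  · refine (ENNReal.rpow_le_rpow hn (by positivity)).trans (le_of_eq ?_)
    rw [ENNReal.ofReal_rpow_of_pos (by positivity), ← Real.rpow_natCast, ← Real.rpow_mul zero_le_two,
      mul_inv_cancel₀ (hp a), Real.rpow_one]
  · exact (Real.measurable_exp.comp
      (((measurable_interactionSlice M g (j a)).norm.const_mul α).const_mul _)).ennreal_ofReal

end Block

end TensorT44
end

theorem mainTheorem3 (M : ℕ) (hM : 1 < M) (α : ℝ) :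
    ∃ ρ₀ > (0 : ℝ), ∃ K₁ > (0 : ℝ), ∃ K₂ > (0 : ℝ),
      ∀ ρ : ℝ, 0 < ρ → ρ ≤ ρ₀ →
      ∀ g ∈ TensorT44.cardioid ρ,
      ∀ (B : Type) [Fintype B] [DecidableEq B] (T : SimpleGraph B), T.IsTree →
      ∀ w : Sym2 B → ℝ, (∀ e ∈ T.edgeSet, w e ∈ Set.Icc (0 : ℝ) 1) →
      ∀ j : B → ℕ, Function.Injective j → (∀ a, 1 ≤ j a) →
      ∀ B' : Finset B,
        MeasureTheory.Integrable
          (fun ξ => ∏ a ∈ B', Real.exp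
            (α * ‖TensorT44.interactionSlice M g (j a) (TensorT44.replica ξ a)‖))
          (TensorT44.blockMeasure T w) ∧
        ∫ ξ, ∏ a ∈ B', Real.exp
            (α * ‖TensorT44.interactionSlice M g (j a) (TensorT44.replica ξ a)‖)
          ∂(TensorT44.blockMeasure T w)
        ≤ K₁ * 2 ^ B'.card * Real.exp (K₂ * ρ ^ (3 / 2 : ℝ) * (B'.card : ℝ)) := by
  obtain ⟨ρ₀, hρ₀, hnode⟩ := TensorT44.exists_single_node_bound hM (abs_nonneg α)
  -- The product is bounded by 2^{|B'|} alone, so both constants may be 1 and the last exponential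
  -- only weakens the bound; negative α is covered by |α|.
  refine ⟨ρ₀, hρ₀, 1, one_pos, 1, one_pos,
    fun ρ hρ hle g hg B _ _ T hT w hw j hj hj1 B' => ?_⟩
  have hmeas : Measurable fun ξ : Fin 4 × ℤ × ℤ → EuclideanSpace ℝ B =>
      ∏ a ∈ B', Real.exp
        (α * ‖TensorT44.interactionSlice M g (j a) (TensorT44.replica ξ a)‖) :=
    Finset.measurable_prod _ fun a _ => Real.measurable_exp.comp
      ((TensorT44.measurable_replica_slice M g (j a) a).norm.const_mul α)
  have hnonneg : ∀ ξ : Fin 4 × ℤ × ℤ → EuclideanSpace ℝ B, 0 ≤ ∏ a ∈ B', Real.exp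
      (α * ‖TensorT44.interactionSlice M g (j a) (TensorT44.replica ξ a)‖) :=
    fun ξ => Finset.prod_nonneg fun a _ => (Real.exp_pos _).le
  have hbound : ∫⁻ ξ, ENNReal.ofReal (∏ a ∈ B', Real.exp
      (α * ‖TensorT44.interactionSlice M g (j a) (TensorT44.replica ξ a)‖))
      ∂(TensorT44.blockMeasure T w) ≤ ENNReal.ofReal (2 ^ B'.card) := by
    refine (MeasureTheory.lintegral_mono fun ξ => ENNReal.ofReal_le_ofReal ?_).trans
      (TensorT44.lintegral_block_le hT hw hj hj1 (hnode ρ hρ hle g hg) B')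
    exact Finset.prod_le_prod (fun a _ => (Real.exp_pos _).le) fun a _ =>
      Real.exp_le_exp.2 (mul_le_mul_of_nonneg_right (le_abs_self α) (norm_nonneg _))
  refine ⟨⟨hmeas.aestronglyMeasurable, ?_⟩, ?_⟩
  · rw [MeasureTheory.hasFiniteIntegral_iff_ofReal (Filter.Eventually.of_forall hnonneg)]
    exact hbound.trans_lt ENNReal.ofReal_lt_top
  · rw [MeasureTheory.integral_eq_lintegral_of_nonneg_ae (Filter.Eventually.of_forall hnonneg)
      hmeas.aestronglyMeasurable]
    refine (ENNReal.toReal_le_of_le_ofReal (by positivity) hbound).trans ?_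
    rw [one_mul, one_mul]
    exact le_mul_of_one_le_right (by positivity) (Real.one_le_exp (by positivity))
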